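/- **Theorem.** Let $G$ be a Lie group (Hausdorff, second countable) with Lie algebra $\mathfrak g$, let $H\subseteq G$ be a closed connected subgroup with Lie algebra $\mathfrak h$, and let $M=G/H$ be the homogeneous manifold, with projection $\pi\colon G\to M$ and base point $o=\pi(e)$. Suppose that $(\mathfrak g,\mathfrak h)$ is a *3-Sasakian data*, that is: * $\mathfrak g$ is a simple Lie algebra with negative definite Killing form $\kappa$, and $\mathfrak g=\mathfrak g_0\oplus\mathfrak g_1$ with $[\mathfrak g_i,\mathfrak g_j]\subseteq\mathfrak g_{i+j}$ (indices mod $2$); * $\mathfrak g_0=\mathfrak{sp}(1)\oplus\mathfrak h$ is a direct sum of two ideals of $\mathfrak g_0$, where $\mathfrak{sp}(1)$ denotes a subalgebra identified by a fixed isomorphism with $\mathfrak{su}(2)$, the real Lie algebra of traceless skew-Hermitian complex $2\times 2$ matrices; * there are an $\mathfrak h^{\mathbb C}$-module $W$ and an isomorphism of $\mathfrak g_0^{\mathbb C}$-modules $\mathfrak g_1^{\mathbb C}\cong\mathbb C^2\otimes W$, where $\mathfrak{sp}(1)^{\mathbb C}\cong\mathfrak{sl}(2,\mathbb C)$ acts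 on the column space $\mathbb C^2$ by matrix multiplication. Put $\mathfrak m=\mathfrak{sp}(1)\oplus\mathfrak g_1$. Then $\dim M=4n+3$ and $\dim_{\mathbb C}W=2n$ for some integer $n\ge 0$, and the following hold. 1. $\mathfrak g=\mathfrak h\oplus\mathfrak m$ is a reductive decomposition: it is a direct sum and $\mathrm{Ad}(H)\mathfrak m\subseteq\mathfrak m$. (In what follows $Z_{\mathfrak m}$ is the component in $\mathfrak m$ of $Z\in\mathfrak g$, and $\mathfrak m$ is identified with $T_oM$ by $\pi_*$.) 2. The bilinear form on $\mathfrak m$ given by $$g|_{\mathfrak{sp}(1)}=-\tfrac1{4(n+2)}\kappa,\qquad g|_{\mathfrak g_1}=-\tfrac1{8(n+2)}\kappa,\qquad g|_{\mathfrak{sp}(1)\times\mathfrak g_1}=0$$ is an $\mathrm{Ad}(H)$-invariant inner product, and there is exactly one $G$-invariant smooth Riemannian metric $g$ on $M$ which restricts to it on $\mathfrak m\cong T_oM$. It has a Levi-Civita connection $\nabla^g$, which is $G$-invariant. There is exactly one bilinear map $\alpha^g\colon\mathfrak m\times\mathfrak m\to\mathfrak m$ such that $$\alpha^g(X,Y)=\nabla^g_XV-[X^+,V]_o$$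 for all $X,Y\in\mathfrak m$ and all smooth vector fields $V$ on $M$ with $V_o=Y$, where $X^+$ is the fundamental vector field $X^+_p=\frac{d}{dt}\big|_0\exp(tX)\cdot p$. It satisfies $$\alpha^g(X,Y)=\begin{cases}0&\text{if }X\in\mathfrak{sp}(1),\ Y\in\mathfrak g_1,\\ \tfrac12[X,Y]_{\mathfrak m}&\text{if }X,Y\in\mathfrak{sp}(1)\text{ or }X,Y\in\mathfrak g_1,\\ [X,Y]_{\mathfrak m}&\text{if }X\in\mathfrak g_1,\ Y\in\mathfrak{sp}(1).\end{cases}$$ 3. Consider the elements of $\mathfrak{sp}(1)$ that correspond to $$\xi_1=\begin{pmatrix}\mathbf i&0\\0&-\mathbf i\end{pmatrix},\quad \xi_2=\begin{pmatrix}0&-1\\1&0\end{pmatrix},\quad \xi_3=\begin{pmatrix}0&-\mathbf i\\-\mathbf i&0\end{pmatrix}.$$ There are unique $G$-invariant vector fields on $M$, again denoted $\xi_1,\xi_2,\xi_3$, with these values at $o$. Put $\varphi_i=-\nabla^g\xi_i$ and $\eta_i=g(\xi_i,\cdot)$. At $o$, for each $i$, $$\varphi_i|_{\mathfrak{sp}(1)}=\tfrac12\,\mathrm{ad}\,\xi_i,\qquad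 \varphi_i|_{\mathfrak g_1}=\mathrm{ad}\,\xi_i .$$ Each $\{\xi_i,\eta_i,\varphi_i\}$ is a *Sasakian structure* on $(M,g)$: the tensor fields are smooth, $\xi_i$ is a unit Killing vector field, $\varphi_i=-\nabla^g\xi_i$, $\eta_i=g(\cdot,\xi_i)$, and $(\nabla^g_X\varphi_i)(Y)=g(X,Y)\xi_i-\eta_i(Y)X$ for all vector fields $X,Y$. For $\tau\in\mathbb R^3$ put $\xi_\tau=\sum_i\tau_i\xi_i$, $\eta_\tau=\sum_i\tau_i\eta_i$ and $\varphi_\tau=\sum_i\tau_i\varphi_i$. The family $\{\xi_\tau,\eta_\tau,\varphi_\tau\}_{\tau\in\mathbb S^2}$ is a *3-Sasakian structure* on $(M,g)$: all its members are Sasakian structures, and for $\tau,\tau'\in\mathbb S^2$ $$g(\xi_\tau,\xi_{\tau'})=\tau\cdot\tau',\qquad[\xi_\tau,\xi_{\tau'}]=2\,\xi_{\tau\times\tau'} .$$ -/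

import Mathlib

open Bundle VectorField
open scoped Manifold ContDiff TensorProduct Matrix

/-! ### The compact Lie algebra `sp(1) = su(2)` -/

section Su2

attribute [local instance 100] LieRing.ofAssociativeRing

/-- `sp(1) = su(2)`: the real Lie algebra of traceless skew-Hermitian complex `2 × 2` matrices,
with the commutator as bracket. -/
def su2 : LieSubalgebra ℝ (Matrix (Fin 2) (Fin 2) ℂ) where
  carrier := {A | Aᴴ = -A ∧ A.trace = 0}
  add_mem' := by
    rintro A B ⟨hA, hA'⟩ ⟨hB, hB'⟩
    refine ⟨?_, by rw [Matrix.trace_add, hA', hB', add_zero]⟩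
    rw [Matrix.conjTranspose_add, hA, hB, neg_add]
  zero_mem' := by simp
  smul_mem' := by
    rintro c A ⟨hA, hA'⟩
    refine ⟨?_, by rw [Matrix.trace_smul, hA', smul_zero]⟩
    rw [Matrix.conjTranspose_smul, hA, star_trivial, smul_neg]
  lie_mem' := by
    rintro A B ⟨hA, -⟩ ⟨hB, -⟩
    refine ⟨?_, ?_⟩
    · rw [Ring.lie_def, Matrix.conjTranspose_sub, Matrix.conjTranspose_mul,
        Matrix.conjTranspose_mul, hA, hB]
      simp
    · rw [Ring.lie_def, Matrix.trace_sub, Matrix.trace_mul_comm, sub_self]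

/-- The standard basis of `su(2)`, as matrices. -/
def su2BasisMatrix : Fin 3 → Matrix (Fin 2) (Fin 2) ℂ :=
  ![!![Complex.I, 0; 0, -Complex.I], !![0, -1; 1, 0], !![0, -Complex.I; -Complex.I, 0]]

theorem su2BasisMatrix_mem (i : Fin 3) : su2BasisMatrix i ∈ su2 := by
  change (su2BasisMatrix i)ᴴ = -su2BasisMatrix i ∧ (su2BasisMatrix i).trace = 0
  fin_cases i <;> refine ⟨?_, by simp [su2BasisMatrix, Matrix.trace_fin_two]⟩ <;>
    ext j k <;> fin_cases j <;> fin_cases k <;> simp [su2BasisMatrix]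

/-- The standard basis `ξ₁, ξ₂, ξ₃` of `su(2)`. -/
def su2Basis (i : Fin 3) : su2 := ⟨su2BasisMatrix i, su2BasisMatrix_mem i⟩

end Su2

/-! ### 3-Sasakian data -/

/-- A 3-Sasakian data `(𝔤, 𝔥)`, together with the choices whose existence it asserts:
the `ℤ₂`-grading `𝔤 = 𝔤₀ ⊕ 𝔤₁`, the ideal `sp(1)` of `𝔤₀` with its identification with `su(2)`,
and the isomorphism of `𝔤₀^ℂ`-modules `𝔤₁^ℂ ≅ ℂ² ⊗ W`, where `W` is an `𝔥^ℂ`-module. -/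
structure ThreeSasakianData (𝔤 : Type*) [LieRing 𝔤] [LieAlgebra ℝ 𝔤] (𝔥 : LieSubalgebra ℝ 𝔤)
    (W : Type*) [AddCommGroup W] [Module ℂ W] [LieRingModule (ℂ ⊗[ℝ] 𝔥) W]
    [LieModule ℂ (ℂ ⊗[ℝ] 𝔥) W] where
  /-- `𝔤` is simple. -/
  simple : LieAlgebra.IsSimple ℝ 𝔤
  /-- `𝔤` is compact, i.e. its Killing form is negative definite. -/
  compact : ∀ X : 𝔤, X ≠ 0 → killingForm ℝ 𝔤 X X < 0
  /-- The even part. -/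
  g0 : Submodule ℝ 𝔤
  /-- The odd part. -/
  g1 : Submodule ℝ 𝔤
  isCompl : IsCompl g0 g1
  lie_g0_g0 : ∀ X ∈ g0, ∀ Y ∈ g0, ⁅X, Y⁆ ∈ g0
  lie_g0_g1 : ∀ X ∈ g0, ∀ Y ∈ g1, ⁅X, Y⁆ ∈ g1
  lie_g1_g1 : ∀ X ∈ g1, ∀ Y ∈ g1, ⁅X, Y⁆ ∈ g0
  /-- The subalgebra of `𝔤₀` of type `sp(1)`. -/
  sp1 : LieSubalgebra ℝ 𝔤
  /-- The identification of `su(2)` with that subalgebra. -/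
  su2Equiv : su2 ≃ₗ⁅ℝ⁆ sp1
  /-- `𝔤₀` is the direct sum of `sp(1)` and `𝔥`, ... -/
  sp1_sup_h : sp1.toSubmodule ⊔ 𝔥.toSubmodule = g0
  sp1_disjoint_h : Disjoint sp1.toSubmodule 𝔥.toSubmodule
  /-- ... which are ideals of `𝔤₀`. -/
  lie_g0_sp1 : ∀ X ∈ g0, ∀ Y ∈ sp1, ⁅X, Y⁆ ∈ sp1
  lie_g0_h : ∀ X ∈ g0, ∀ Y ∈ 𝔥, ⁅X, Y⁆ ∈ 𝔥
  /-- The complex linear isomorphism `𝔤₁^ℂ ≅ ℂ² ⊗ W`. -/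
  Φ : (ℂ ⊗[ℝ] g1) ≃ₗ[ℂ] ((Fin 2 → ℂ) ⊗[ℂ] W)
  /-- `Φ` intertwines the actions of `sp(1)^ℂ`: the element `c ⊗ A` acts on `ℂ² ⊗ W` through the
  matrix `c • A ∈ sl(2, ℂ)`, multiplying columns in the first factor. -/
  Φ_sp1 : ∀ (c z : ℂ) (A : su2) (Y : g1),
    Φ ((c * z) ⊗ₜ[ℝ] ⟨⁅(su2Equiv A : 𝔤), (Y : 𝔤)⁆,
        lie_g0_g1 _ (sp1_sup_h ▸ Submodule.mem_sup_left (su2Equiv A).2) _ Y.2⟩) =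
      TensorProduct.map (Matrix.toLin' (c • (A : Matrix (Fin 2) (Fin 2) ℂ))) LinearMap.id
        (Φ (z ⊗ₜ[ℝ] Y))
  /-- `Φ` intertwines the actions of `𝔥^ℂ`: the element `c ⊗ B` acts on `ℂ² ⊗ W` through the
  `𝔥^ℂ`-module `W` in the second factor. -/
  Φ_h : ∀ (c z : ℂ) (B : 𝔥) (Y : g1),
    Φ ((c * z) ⊗ₜ[ℝ] ⟨⁅(B : 𝔤), (Y : 𝔤)⁆,
        lie_g0_g1 _ (sp1_sup_h ▸ Submodule.mem_sup_right B.2) _ Y.2⟩) =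
      TensorProduct.map LinearMap.id (LieModule.toEnd ℂ (ℂ ⊗[ℝ] 𝔥) W (c ⊗ₜ[ℝ] B))
        (Φ (z ⊗ₜ[ℝ] Y))

namespace ThreeSasakianData

variable {𝔤 : Type*} [LieRing 𝔤] [LieAlgebra ℝ 𝔤] {𝔥 : LieSubalgebra ℝ 𝔤}
  {W : Type*} [AddCommGroup W] [Module ℂ W] [LieRingModule (ℂ ⊗[ℝ] 𝔥) W]
  [LieModule ℂ (ℂ ⊗[ℝ] 𝔥) W] (D : ThreeSasakianData 𝔤 𝔥 W)

/-- The complement `𝔪 = sp(1) ⊕ 𝔤₁`. -/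
def m : Submodule ℝ 𝔤 := D.sp1.toSubmodule ⊔ D.g1

theorem isCompl_h_m : IsCompl 𝔥.toSubmodule D.m := by
  have h1 : Disjoint (𝔥.toSubmodule ⊔ D.sp1.toSubmodule) D.g1 := by
    rw [sup_comm, D.sp1_sup_h]; exact D.isCompl.disjoint
  refine ⟨Disjoint.disjoint_sup_right_of_disjoint_sup_left D.sp1_disjoint_h.symm h1, ?_⟩
  rw [codisjoint_iff, m, ← sup_assoc, sup_comm 𝔥.toSubmodule, D.sp1_sup_h]
  exact D.isCompl.sup_eq_top

/-- The projection `𝔤 → 𝔪` along `𝔥`, written `Z ↦ Z_𝔪`. -/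
noncomputable def projM : 𝔤 →ₗ[ℝ] D.m := D.m.projectionOnto 𝔥.toSubmodule D.isCompl_h_m.symm

/-- The basis `ξ₁, ξ₂, ξ₃` of `sp(1) ⊆ 𝔤`. -/
noncomputable def xi (i : Fin 3) : 𝔤 := D.su2Equiv (su2Basis i)

/-- `B` is the bilinear form on `𝔪` which is `-κ / (4 (n + 2))` on `sp(1)` and `-κ / (8 (n + 2))`
on `𝔤₁`, and for which `sp(1)` and `𝔤₁` are orthogonal. -/
structure IsMetricForm (n : ℕ) (B : LinearMap.BilinForm ℝ D.m) : Prop where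
  sp1_sp1 : ∀ X Y : D.m, (X : 𝔤) ∈ D.sp1 → (Y : 𝔤) ∈ D.sp1 →
    B X Y = -(1 / (4 * ((n : ℝ) + 2))) * killingForm ℝ 𝔤 X Y
  g1_g1 : ∀ X Y : D.m, (X : 𝔤) ∈ D.g1 → (Y : 𝔤) ∈ D.g1 →
    B X Y = -(1 / (8 * ((n : ℝ) + 2))) * killingForm ℝ 𝔤 X Y
  sp1_g1 : ∀ X Y : D.m, (X : 𝔤) ∈ D.sp1 → (Y : 𝔤) ∈ D.g1 → B X Y = 0 ∧ B Y X = 0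

end ThreeSasakianData

/-! ### Riemannian and (3-)Sasakian geometry -/

section Geometry

variable {E : Type*} [NormedAddCommGroup E] [NormedSpace ℝ E] [FiniteDimensional ℝ E]
  [CompleteSpace E] {H : Type*} [TopologicalSpace H] {I : ModelWithCorners ℝ E H}
  {M : Type*} [TopologicalSpace M] [ChartedSpace H M] [IsManifold I ∞ M]

/-- A vector field is smooth. -/
def IsSmoothField (X : Π p : M, TangentSpace I p) : Prop :=
  ContMDiff I I.tangent ∞ (fun p => (⟨p, X p⟩ : TangentBundle I M))

/-- A smooth Riemannian metric on `M`. -/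
abbrev SmoothMetric (I : ModelWithCorners ℝ E H) (M : Type*) [TopologicalSpace M]
    [ChartedSpace H M] [IsManifold I ∞ M] :=
  ContMDiffRiemannianMetric I ∞ E (fun p : M => TangentSpace I p)

/-- An affine connection on `M`; `cov Y p v` is `∇_v Y` at `p`. -/
abbrev AffineConnection (I : ModelWithCorners ℝ E H) (M : Type*) [TopologicalSpace M]
    [ChartedSpace H M] [IsManifold I ∞ M] :=
  CovariantDerivative I E (fun p : M => TangentSpace I p)

/-- `cov` is compatible with `g`: `v (g(Y, Z)) = g(∇_v Y, Z) + g(Y, ∇_v Z)`. -/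
def IsMetricConnection (g : SmoothMetric I M) (cov : AffineConnection I M) : Prop :=
  ∀ (p : M) (Y Z : Π q : M, TangentSpace I q),
    MDifferentiableAt I I.tangent (fun q => (⟨q, Y q⟩ : TangentBundle I M)) p →
    MDifferentiableAt I I.tangent (fun q => (⟨q, Z q⟩ : TangentBundle I M)) p →
    ∀ v : TangentSpace I p, mvfderiv I (fun q => g.inner q (Y q) (Z q)) p v =
      g.inner p (cov Y p v) (Z p) + g.inner p (Y p) (cov Z p v)

/-- `cov` is the Levi-Civita connection of `g`: it is metric and has no torsion. -/
def IsLeviCivita (g : SmoothMetric I M) (cov : AffineConnection I M) : Prop :=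
  IsMetricConnection g cov ∧ cov.torsion = 0

/-- `ξ` is a Killing vector field of `g`: the Lie derivative of `g` along `ξ` vanishes. -/
def IsKillingField (g : SmoothMetric I M) (ξ : Π p : M, TangentSpace I p) : Prop :=
  ∀ Y Z : Π p : M, TangentSpace I p, IsSmoothField Y → IsSmoothField Z → ∀ p : M,
    mvfderiv I (fun q => g.inner q (Y q) (Z q)) p (ξ p) =
      g.inner p (mlieBracket I ξ Y p) (Z p) + g.inner p (Y p) (mlieBracket I ξ Z p)

/-- `{ξ, η, φ}` is a Sasakian structure on `(M, g)`, where `cov` is the Levi-Civita connection. -/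
structure IsSasakianStructure (g : SmoothMetric I M) (cov : AffineConnection I M)
    (ξ : Π p : M, TangentSpace I p) (η : Π p : M, TangentSpace I p →L[ℝ] ℝ)
    (φ : Π p : M, TangentSpace I p →L[ℝ] TangentSpace I p) : Prop where
  leviCivita : IsLeviCivita g cov
  smooth_ξ : IsSmoothField ξ
  smooth_η : ContMDiff I (I.prod 𝓘(ℝ, E →L[ℝ] ℝ)) ∞
    (fun p => TotalSpace.mk' (E →L[ℝ] ℝ)
      (E := fun p : M => TangentSpace I p →L[ℝ] Bundle.Trivial M ℝ p) p (η p))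
  smooth_φ : ContMDiff I (I.prod 𝓘(ℝ, E →L[ℝ] E)) ∞
    (fun p => TotalSpace.mk' (E →L[ℝ] E)
      (E := fun p : M => TangentSpace I p →L[ℝ] TangentSpace I p) p (φ p))
  unit : ∀ p, g.inner p (ξ p) (ξ p) = 1
  killing : IsKillingField g ξ
  η_eq : ∀ p (v : TangentSpace I p), η p v = g.inner p v (ξ p)
  φ_eq : ∀ p (v : TangentSpace I p), φ p v = -cov ξ p v
  /-- `(∇_X φ)(Y) = g(X, Y) ξ - η(Y) X`, where `(∇_X φ)(Y) = ∇_X (φ Y) - φ (∇_X Y)`. -/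
  cov_φ : ∀ X Y : Π p : M, TangentSpace I p, IsSmoothField X → IsSmoothField Y → ∀ p,
    cov (fun q => φ q (Y q)) p (X p) - φ p (cov Y p (X p)) =
      g.inner p (X p) (Y p) • ξ p - η p (Y p) • X p

/-- A 3-Sasakian structure on `(M, g)`: a family of Sasakian structures indexed by the unit sphere
of `ℝ³` and extended to `ℝ³` by linearity, satisfying the two compatibility conditions. -/
structure IsThreeSasakianStructure (g : SmoothMetric I M) (cov : AffineConnection I M)
    (ξ : (Fin 3 → ℝ) → Π p : M, TangentSpace I p)
    (η : (Fin 3 → ℝ) → Π p : M, TangentSpace I p →L[ℝ] ℝ)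
    (φ : (Fin 3 → ℝ) → Π p : M, TangentSpace I p →L[ℝ] TangentSpace I p) : Prop where
  linear : IsLinearMap ℝ ξ
  sasakian : ∀ τ, τ ⬝ᵥ τ = 1 → IsSasakianStructure g cov (ξ τ) (η τ) (φ τ)
  inner_ξ : ∀ τ τ', τ ⬝ᵥ τ = 1 → τ' ⬝ᵥ τ' = 1 → ∀ p, g.inner p (ξ τ p) (ξ τ' p) = τ ⬝ᵥ τ'
  lie_ξ : ∀ τ τ', τ ⬝ᵥ τ = 1 → τ' ⬝ᵥ τ' = 1 →
    mlieBracket I (ξ τ) (ξ τ') = (2 : ℝ) • ξ (τ ⨯₃ τ')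

end Geometry

/-! ### Homogeneous spaces `G/H` -/

/-- Lets a smooth real Lie group be recognized as smooth enough to have a Lie algebra. -/
instance : ENat.LEInfty (minSmoothness ℝ 3) :=
  ⟨by rw [minSmoothness_of_isRCLikeNormedField]; exact ENat.LEInfty.out⟩

section Homogeneous

variable {d k : ℕ} {G : Type*} [TopologicalSpace G] [ChartedSpace (EuclideanSpace ℝ (Fin d)) G]
  [Group G]

/-- The adjoint representation of `G` on its Lie algebra: the differential at `1` of the
conjugation `x ↦ a x a⁻¹`. -/
noncomputable def Ad (a : G) : GroupLieAlgebra (𝓡 d) G →L[ℝ] GroupLieAlgebra (𝓡 d) G :=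
  mfderiv (𝓡 d) (𝓡 d) (fun x : G => a * x * a⁻¹) 1

/-- `𝔥` is the Lie algebra of the subgroup `H`: it consists of the velocities at `1` of the smooth
curves of `G` that stay in `H`. -/
def IsLieAlgebraOfSubgroup (H : Subgroup G) (𝔥 : Set (GroupLieAlgebra (𝓡 d) G)) : Prop :=
  ∀ X : GroupLieAlgebra (𝓡 d) G, X ∈ 𝔥 ↔ ∃ γ : ℝ → G, ContMDiff 𝓘(ℝ, ℝ) (𝓡 d) ∞ γ ∧
    γ 0 = 1 ∧ (∀ t, γ t ∈ H) ∧ (mfderiv 𝓘(ℝ, ℝ) (𝓡 d) γ 0 (1 : ℝ) : EuclideanSpace ℝ (Fin d)) = X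

/-- `𝔤 = 𝔥 ⊕ 𝔪` is a reductive decomposition: `Ad(H) 𝔪 ⊆ 𝔪`. -/
def IsReductiveDecomposition (H : Subgroup G) (𝔥 𝔪 : Submodule ℝ (GroupLieAlgebra (𝓡 d) G)) :
    Prop :=
  IsCompl 𝔥 𝔪 ∧ ∀ a ∈ H, ∀ X ∈ 𝔪, Ad a X ∈ 𝔪

variable (k) in
/-- The differential at `1` of the projection `π : G → G/H`, with values in the tangent space at
the base point `o = π(1)`. -/
noncomputable def projDeriv (H : Subgroup G) [ChartedSpace (EuclideanSpace ℝ (Fin k)) (G ⧸ H)] :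
    GroupLieAlgebra (𝓡 d) G →L[ℝ] TangentSpace (𝓡 k) ((1 : G) : G ⧸ H) :=
  mfderiv (𝓡 d) (𝓡 k) (fun x : G => (x : G ⧸ H)) 1

variable {H : Subgroup G} [ChartedSpace (EuclideanSpace ℝ (Fin k)) (G ⧸ H)]

/-- The differential at `p` of the translation `τ_a : p ↦ a • p` of `G/H`. -/
noncomputable def translDeriv (a : G) (p : G ⧸ H) :
    TangentSpace (𝓡 k) p →L[ℝ] TangentSpace (𝓡 k) (a • p) :=
  mfderiv (𝓡 k) (𝓡 k) (fun q : G ⧸ H => a • q) p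

/-- The fundamental vector field `X⁺` on `G/H` of an element `X` of the Lie algebra of `G`: its
value at `p` is the image of `X` under the differential at `1` of `a ↦ a • p`. -/
noncomputable def fundamentalField (X : GroupLieAlgebra (𝓡 d) G) (p : G ⧸ H) :
    TangentSpace (𝓡 k) p :=
  (mfderiv (𝓡 d) (𝓡 k) (fun a : G => a • p) 1 X : EuclideanSpace ℝ (Fin k))

/-- A vector field on `G/H` is `G`-invariant. -/
def IsInvariantField (X : Π p : G ⧸ H, TangentSpace (𝓡 k) p) : Prop :=
  ∀ (a : G) (p : G ⧸ H), X (a • p) = translDeriv a p (X p)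

variable [IsManifold (𝓡 k) ∞ (G ⧸ H)]

/-- A connection on `G/H` is `G`-invariant: `τ_a(∇_X Y) = ∇_{τ_a X} (τ_a Y)` for all `a`, where the
field `Y' = τ_a Y` is determined by `Y'(a • q) = (τ_a)_* Y(q)`. -/
def IsInvariantConnection (cov : AffineConnection (𝓡 k) (G ⧸ H)) : Prop :=
  ∀ (a : G) (Y Y' : Π p : G ⧸ H, TangentSpace (𝓡 k) p), IsSmoothField Y → IsSmoothField Y' →
    (∀ q, Y' (a • q) = translDeriv a q (Y q)) →
    ∀ (p : G ⧸ H) (v : TangentSpace (𝓡 k) p),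
      cov Y' (a • p) (translDeriv a p v) = translDeriv a p (cov Y p v)

/-- `g` is the Riemannian metric on `G/H` corresponding to the form `B` on `𝔪`: it is
`G`-invariant and at `o` it is `B`, under the identification `𝔪 ≅ T_o(G/H)`. -/
def IsCorrespondingMetric {𝔪 : Submodule ℝ (GroupLieAlgebra (𝓡 d) G)}
    (B : LinearMap.BilinForm ℝ 𝔪) (g : SmoothMetric (𝓡 k) (G ⧸ H)) : Prop :=
  (∀ (a : G) (p : G ⧸ H) (u v : TangentSpace (𝓡 k) p),
    g.inner (a • p) (translDeriv a p u) (translDeriv a p v) = g.inner p u v) ∧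
  ∀ X Y : 𝔪, g.inner ((1 : G) : G ⧸ H) (projDeriv k H (X : GroupLieAlgebra (𝓡 d) G))
    (projDeriv k H (Y : GroupLieAlgebra (𝓡 d) G)) = B X Y

/-- `α` is the multiplication on `𝔪` corresponding to the invariant connection `cov` via Nomizu's
Theorem: `α(X, Y) = ∇_X Y - [X⁺, Y]` at `o`, for `Y` extended arbitrarily to a vector field,
under the identification `𝔪 ≅ T_o(G/H)`. -/
def IsNomizuMap {𝔪 : Submodule ℝ (GroupLieAlgebra (𝓡 d) G)}
    (cov : AffineConnection (𝓡 k) (G ⧸ H)) (α : 𝔪 →ₗ[ℝ] 𝔪 →ₗ[ℝ] 𝔪) : Prop :=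
  ∀ (X Y : 𝔪) (V : Π p : G ⧸ H, TangentSpace (𝓡 k) p), IsSmoothField V →
    V ((1 : G) : G ⧸ H) = projDeriv k H (Y : GroupLieAlgebra (𝓡 d) G) →
    projDeriv k H (α X Y : GroupLieAlgebra (𝓡 d) G) =
      cov V ((1 : G) : G ⧸ H) (projDeriv k H (X : GroupLieAlgebra (𝓡 d) G)) -
      mlieBracket (𝓡 k) (fundamentalField (X : GroupLieAlgebra (𝓡 d) G)) V ((1 : G) : G ⧸ H)

end Homogeneous

/-!
Everything is reduced to algebra in `𝔪 = sp(1) ⊕ 𝔤₁` by invariance under `G`.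

The algebraic input is that `sp(1)` acts on `𝔤₁^ℂ ≅ ℂ² ⊗ W` through the matrices of `su(2)`, which
satisfy the Clifford relation `XY + YX = -2⟨X, Y⟩`; hence so does its action on `𝔤₁`
(`ThreeSasakianData.xiComb_clifford`). In particular `𝔤₁` is a quaternionic vector space, so that
`dim 𝔤₁ = 4n`, and `(ad ξ)²` is known on each of `sp(1)`, `𝔤₁` and `𝔥`. The resulting value
`κ(ξ_τ, ξ_τ') = -4(n + 2) τ·τ'` of the Killing form (`killingForm_xiComb`) accounts for the constants
in the metric. With `α(X, Y)` defined by the formulas of the theorem (`nomizu`), three identities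
follow from the invariance of `κ` and the Clifford relation: `α(X, ·)` is skew-symmetric
(`metricForm_nomizu_skew`), `α(X, Y) - α(Y, X) = [X, Y]_𝔪` (`nomizu_sub_nomizu`), and the Sasakian
identity holds for `φ(X) = -α(X, ξ)` (`nomizu_sasakian`).

The isotropy representation fixes `sp(1)`: the ideals `sp(1)` and `𝔥` of `𝔤₀` commute, and `H` is
connected (`Ad_eq_self`). Since `Ad(H)` also preserves `𝔥` and the Killing form, it preserves `𝔤₁`,
the orthogonal complement of `𝔤₀`. Thus the decomposition is reductive, the inner product extends to
an invariant metric, and the vectors of `sp(1)` extend to invariant vector fields. Invariant tensor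
fields are smooth, because the projection `G → G/H` has smooth local sections.

The Levi-Civita connection is written down rather than obtained from the Koszul formula. If `v` is
the translate by `a` of the class of `X ∈ 𝔪`, and `V_p` that of the class of `Y`, then `∇_v V` is the
Lie derivative of `V` along the fundamental field of `Ad(a) X` plus the translate of `α(X, Y)`
(`nomizuDeriv`). For an arbitrary choice of representatives `a` this is a covariant derivative; it is
metric because fundamental fields are Killing fields and `α(X, ·)` is skew, and its torsion, computed
with fundamental fields, is `α(X, Y) - α(Y, X) - [X, Y]_𝔪 = 0`. As a Levi-Civita connection is unique
(`IsLeviCivita.cov_eq`), the formula holds for all choices of representatives at once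
(`IsLeviCivita.cov_eq_nomizuDeriv`), and the invariance of the connection and the formula for `α`
can be read off from it.

Lie derivatives along fundamental fields are derivatives of pullbacks by translations
(`hasDerivAt_pullback_family`). They therefore kill invariant fields and commute with invariant
endomorphisms, so that `∇ξ` is given by `α(·, ξ)`, and the Sasakian identity and the brackets
`[ξ_τ, ξ_τ']` reduce to the identities for `α`.
-/

/-! ### The standard basis of `su(2)` -/

theorem mem_su2_iff (A : Matrix (Fin 2) (Fin 2) ℂ) : A ∈ su2 ↔ Aᴴ = -A ∧ A.trace = 0 := Iff.rfl

theorem su2_lie_coe (A B : su2) : ((⁅A, B⁆ : su2) : Matrix (Fin 2) (Fin 2) ℂ) =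
    (A : Matrix (Fin 2) (Fin 2) ℂ) * B - (B : Matrix (Fin 2) (Fin 2) ℂ) * A := rfl

theorem su2Basis_lie_zero_one : ⁅su2Basis 0, su2Basis 1⁆ = (2 : ℝ) • su2Basis 2 := by
  apply Subtype.ext
  rw [su2_lie_coe]
  ext a b; fin_cases a <;> fin_cases b <;>
    simp [su2Basis, su2BasisMatrix] <;>
    apply Complex.ext <;> simp <;> norm_num

theorem su2Basis_lie_one_two : ⁅su2Basis 1, su2Basis 2⁆ = (2 : ℝ) • su2Basis 0 := by
  apply Subtype.ext
  rw [su2_lie_coe]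
  ext a b; fin_cases a <;> fin_cases b <;>
    simp [su2Basis, su2BasisMatrix] <;>
    apply Complex.ext <;> simp <;> norm_num

theorem su2Basis_lie_two_zero : ⁅su2Basis 2, su2Basis 0⁆ = (2 : ℝ) • su2Basis 1 := by
  apply Subtype.ext
  rw [su2_lie_coe]
  ext a b; fin_cases a <;> fin_cases b <;>
    simp [su2Basis, su2BasisMatrix] <;>
    apply Complex.ext <;> simp <;> norm_num

/-- The linear combinations of the standard basis of `su(2)`. -/
noncomputable def su2Comb : (Fin 3 → ℝ) →ₗ[ℝ] su2 := Fintype.linearCombination ℝ su2Basis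

theorem su2Comb_apply (τ : Fin 3 → ℝ) : su2Comb τ = ∑ i, τ i • su2Basis i :=
  Fintype.linearCombination_apply ..

theorem su2Comb_coe (τ : Fin 3 → ℝ) : (su2Comb τ : Matrix (Fin 2) (Fin 2) ℂ) =
    !![τ 0 * Complex.I, -τ 1 - τ 2 * Complex.I; τ 1 - τ 2 * Complex.I, -(τ 0 * Complex.I)] := by
  have h : (su2Comb τ : Matrix (Fin 2) (Fin 2) ℂ) = τ 0 • su2BasisMatrix 0 + τ 1 • su2BasisMatrix 1
      + τ 2 • su2BasisMatrix 2 := by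
    rw [su2Comb_apply, Fin.sum_univ_three]; rfl
  rw [h]
  ext a b; fin_cases a <;> fin_cases b <;> simp [su2BasisMatrix, sub_eq_add_neg]

theorem su2Comb_injective : Function.Injective su2Comb := by
  rw [injective_iff_map_eq_zero]
  intro τ h
  have h' : (su2Comb τ : Matrix (Fin 2) (Fin 2) ℂ) = 0 := by rw [h]; rfl
  rw [su2Comb_coe] at h'
  have h0 := congrArg Complex.im (congrFun (congrFun h' 0) 0)
  have h1 := congrArg Complex.re (congrFun (congrFun h' 1) 0)
  have h2 := congrArg Complex.im (congrFun (congrFun h' 1) 0)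
  simp at h0 h1 h2
  ext i; fin_cases i <;> simp [h0, h1, h2]

theorem su2Comb_surjective : Function.Surjective su2Comb := by
  intro A
  obtain ⟨hA, hT⟩ := (mem_su2_iff A.1).1 A.2
  refine ⟨![(A.1 0 0).im, (A.1 1 0).re, -(A.1 1 0).im], Subtype.ext ?_⟩
  rw [su2Comb_coe]
  have e00 := congrArg Complex.re (congrFun (congrFun hA 0) 0)
  have e01r := congrArg Complex.re (congrFun (congrFun hA 0) 1)
  have e01i := congrArg Complex.im (congrFun (congrFun hA 0) 1)
  have e11 := congrArg Complex.re (congrFun (congrFun hA 1) 1)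
  rw [Matrix.trace_fin_two] at hT
  have t := congrArg Complex.im hT
  simp [Matrix.conjTranspose_apply] at e00 e01r e01i e11 t
  ext a b; fin_cases a <;> fin_cases b <;> apply Complex.ext <;> simp <;> linarith

theorem su2Comb_lie (τ τ' : Fin 3 → ℝ) :
    ⁅su2Comb τ, su2Comb τ'⁆ = (2 : ℝ) • su2Comb (τ ⨯₃ τ') := by
  have h10 : ⁅su2Basis 1, su2Basis 0⁆ = (-2 : ℝ) • su2Basis 2 := by
    rw [← lie_skew, su2Basis_lie_zero_one, neg_smul]
  have h21 : ⁅su2Basis 2, su2Basis 1⁆ = (-2 : ℝ) • su2Basis 0 := by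
    rw [← lie_skew, su2Basis_lie_one_two, neg_smul]
  have h02 : ⁅su2Basis 0, su2Basis 2⁆ = (-2 : ℝ) • su2Basis 1 := by
    rw [← lie_skew, su2Basis_lie_two_zero, neg_smul]
  simp only [su2Comb_apply, Fin.sum_univ_three, add_lie, lie_add, smul_lie, lie_smul, lie_self,
    su2Basis_lie_zero_one, su2Basis_lie_one_two, su2Basis_lie_two_zero, h10, h21, h02,
    cross_apply, Matrix.cons_val_zero, Matrix.cons_val_one, Matrix.cons_val]
  module

theorem su2Comb_mul_add_mul (τ τ' : Fin 3 → ℝ) :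
    (su2Comb τ : Matrix (Fin 2) (Fin 2) ℂ) * su2Comb τ' + su2Comb τ' * su2Comb τ =
      ((-2 * (τ ⬝ᵥ τ') : ℝ) : ℂ) • (1 : Matrix (Fin 2) (Fin 2) ℂ) := by
  rw [su2Comb_coe, su2Comb_coe]
  ext a b; fin_cases a <;> fin_cases b <;>
    simp [dotProduct, Fin.sum_univ_three] <;> ring_nf <;>
    simp <;> ring

namespace ThreeSasakianData

variable {𝔤 : Type*} [LieRing 𝔤] [LieAlgebra ℝ 𝔤] {𝔥 : LieSubalgebra ℝ 𝔤}
  {W : Type*} [AddCommGroup W] [Module ℂ W] [LieRingModule (ℂ ⊗[ℝ] 𝔥) W]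
  [LieModule ℂ (ℂ ⊗[ℝ] 𝔥) W] (D : ThreeSasakianData 𝔤 𝔥 W)

/-! ### The subalgebra `sp(1)` and its action on `𝔤₁` -/

/-- The element `∑ τᵢ ξᵢ` of `sp(1)`. -/
noncomputable def xiComb : (Fin 3 → ℝ) →ₗ[ℝ] 𝔤 :=
  D.sp1.toSubmodule.subtype ∘ₗ (D.su2Equiv : su2 →ₗ[ℝ] D.sp1) ∘ₗ su2Comb

theorem xiComb_eq (τ : Fin 3 → ℝ) : D.xiComb τ = D.su2Equiv (su2Comb τ) := rfl

theorem xiComb_apply (τ : Fin 3 → ℝ) : D.xiComb τ = ∑ i, τ i • D.xi i := by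
  rw [xiComb_eq, su2Comb_apply, Fin.sum_univ_three, Fin.sum_univ_three]
  simp [xi]

theorem xiComb_single (i : Fin 3) : D.xiComb (Pi.single i 1) = D.xi i := by
  rw [xiComb_apply]
  simp [Pi.single_apply]

theorem xiComb_mem (τ : Fin 3 → ℝ) : D.xiComb τ ∈ D.sp1 := (D.su2Equiv (su2Comb τ)).2

theorem xiComb_injective : Function.Injective D.xiComb := fun _ _ h =>
  su2Comb_injective (D.su2Equiv.injective (Subtype.ext h))

theorem exists_xiComb {X : 𝔤} (hX : X ∈ D.sp1) : ∃ τ, D.xiComb τ = X := by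
  obtain ⟨A, hA⟩ := D.su2Equiv.surjective ⟨X, hX⟩
  obtain ⟨τ, rfl⟩ := su2Comb_surjective A
  exact ⟨τ, congrArg Subtype.val hA⟩

theorem xiComb_lie (τ τ' : Fin 3 → ℝ) :
    ⁅D.xiComb τ, D.xiComb τ'⁆ = (2 : ℝ) • D.xiComb (τ ⨯₃ τ') := by
  rw [xiComb_eq, xiComb_eq, ← LieSubalgebra.coe_bracket, ← LieEquiv.map_lie, su2Comb_lie,
    xiComb_eq, map_smul]
  rfl

theorem sp1_le_g0 {X : 𝔤} (hX : X ∈ D.sp1) : X ∈ D.g0 := by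
  rw [← D.sp1_sup_h]; exact Submodule.mem_sup_left hX

theorem h_le_g0 {X : 𝔤} (hX : X ∈ 𝔥) : X ∈ D.g0 := by
  rw [← D.sp1_sup_h]; exact Submodule.mem_sup_right hX

theorem sp1_le_m {X : 𝔤} (hX : X ∈ D.sp1) : X ∈ D.m := Submodule.mem_sup_left hX

theorem g1_le_m {X : 𝔤} (hX : X ∈ D.g1) : X ∈ D.m := Submodule.mem_sup_right hX

theorem lie_sp1_g1 {X Y : 𝔤} (hX : X ∈ D.sp1) (hY : Y ∈ D.g1) : ⁅X, Y⁆ ∈ D.g1 :=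
  D.lie_g0_g1 _ (D.sp1_le_g0 hX) _ hY

theorem lie_g1_sp1 {X Y : 𝔤} (hX : X ∈ D.g1) (hY : Y ∈ D.sp1) : ⁅X, Y⁆ ∈ D.g1 := by
  rw [← lie_skew]; exact neg_mem (D.lie_sp1_g1 hY hX)

/-- The ideals `sp(1)` and `𝔥` of `𝔤₀` commute. -/
theorem lie_sp1_h {X Y : 𝔤} (hX : X ∈ D.sp1) (hY : Y ∈ 𝔥) : ⁅X, Y⁆ = 0 := by
  have h1 : ⁅X, Y⁆ ∈ 𝔥 := D.lie_g0_h _ (D.sp1_le_g0 hX) _ hY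
  have h2 : ⁅X, Y⁆ ∈ D.sp1 := by
    rw [← lie_skew]; exact neg_mem (D.lie_g0_sp1 _ (D.h_le_g0 hY) _ hX)
  exact Submodule.disjoint_def.1 D.sp1_disjoint_h _ h2 h1

theorem lie_h_sp1 {X Y : 𝔤} (hX : X ∈ 𝔥) (hY : Y ∈ D.sp1) : ⁅X, Y⁆ = 0 := by
  rw [← lie_skew, D.lie_sp1_h hY hX, neg_zero]

/-- Complexification is injective. -/
theorem one_tmul_injective {V : Type*} [AddCommGroup V] [Module ℝ V] :
    Function.Injective (fun v : V => (1 : ℂ) ⊗ₜ[ℝ] v) :=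
  Module.FaithfullyFlat.tensorProduct_mk_injective (A := ℝ) (B := ℂ) V

/-- The Clifford relation `XY + YX = -2⟨X, Y⟩` for the action of `sp(1)` on `𝔤₁`: it holds for
the matrices of `su(2)` acting on `ℂ²`. -/
theorem xiComb_clifford (τ τ' : Fin 3 → ℝ) {Y : 𝔤} (hY : Y ∈ D.g1) :
    ⁅D.xiComb τ, ⁅D.xiComb τ', Y⁆⁆ + ⁅D.xiComb τ', ⁅D.xiComb τ, Y⁆⁆ = (-2 * (τ ⬝ᵥ τ')) • Y := by
  have key : ∀ (A B : su2) (Z : D.g1),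
      D.Φ (1 ⊗ₜ[ℝ] (⟨⁅(D.su2Equiv A : 𝔤), ⁅(D.su2Equiv B : 𝔤), (Z : 𝔤)⁆⁆,
        D.lie_sp1_g1 (D.su2Equiv A).2 (D.lie_sp1_g1 (D.su2Equiv B).2 Z.2)⟩ : D.g1)) =
      TensorProduct.map (Matrix.toLin' ((A : Matrix (Fin 2) (Fin 2) ℂ) *
          (B : Matrix (Fin 2) (Fin 2) ℂ))) LinearMap.id
        (D.Φ (1 ⊗ₜ[ℝ] Z)) := by
    intro A B Z
    have h1 := D.Φ_sp1 1 1 A ⟨⁅(D.su2Equiv B : 𝔤), (Z : 𝔤)⁆, D.lie_sp1_g1 (D.su2Equiv B).2 Z.2⟩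
    have h2 := D.Φ_sp1 1 1 B Z
    simp only [mul_one, one_smul] at h1 h2
    rw [h1, h2, Matrix.toLin'_mul, ← LinearMap.comp_apply, ← TensorProduct.map_comp,
      LinearMap.comp_id]
  have h1 := key (su2Comb τ) (su2Comb τ') ⟨Y, hY⟩
  have h2 := key (su2Comb τ') (su2Comb τ) ⟨Y, hY⟩
  have h3 : D.Φ (1 ⊗ₜ[ℝ] (⟨⁅D.xiComb τ, ⁅D.xiComb τ', Y⁆⁆ + ⁅D.xiComb τ', ⁅D.xiComb τ, Y⁆⁆,
      add_mem (D.lie_sp1_g1 (D.xiComb_mem _) (D.lie_sp1_g1 (D.xiComb_mem _) hY))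
        (D.lie_sp1_g1 (D.xiComb_mem _) (D.lie_sp1_g1 (D.xiComb_mem _) hY))⟩ : D.g1)) =
      D.Φ (1 ⊗ₜ[ℝ] ((-2 * (τ ⬝ᵥ τ')) • (⟨Y, hY⟩ : D.g1))) := by
    have e : ∀ (U V : 𝔤) (hU : U ∈ D.g1) (hV : V ∈ D.g1),
      (⟨U + V, add_mem hU hV⟩ : D.g1) = ⟨U, hU⟩ + ⟨V, hV⟩ := fun _ _ _ _ => rfl
    rw [e, TensorProduct.tmul_add, map_add]
    refine (congrArg₂ (· + ·) h1 h2).trans ?_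
    rw [← LinearMap.add_apply, ← TensorProduct.map_add_left, ← map_add, su2Comb_mul_add_mul,
      map_smul, Matrix.toLin'_one, TensorProduct.map_smul_left, TensorProduct.map_id,
      TensorProduct.tmul_smul, LinearMap.smul_apply, LinearMap.id_apply, ← map_smul]
    congr 1
  have h4 := one_tmul_injective (D.Φ.injective h3)
  exact congrArg Subtype.val h4

theorem xiComb_lie_xiComb_self (τ : Fin 3 → ℝ) {Y : 𝔤} (hY : Y ∈ D.g1) :
    ⁅D.xiComb τ, ⁅D.xiComb τ, Y⁆⁆ = -(τ ⬝ᵥ τ) • Y := by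
  have h := D.xiComb_clifford τ τ hY
  rw [← two_smul ℝ] at h
  have h2 : (2 : ℝ) ≠ 0 := two_ne_zero
  apply smul_right_injective _ h2
  simp only [h, smul_smul]; congr 1; ring

/-- `dim W = dim 𝔤₁ / 2`. -/
theorem two_mul_finrank_W : 2 * Module.finrank ℂ W = Module.finrank ℝ D.g1 := by
  have h := D.Φ.finrank_eq
  rw [Module.finrank_baseChange, Module.finrank_tensorProduct] at h
  simp at h
  exact h.symm

/-- The units `ξ₁, ξ₂, ξ₃` make `𝔤₁` a quaternionic vector space, so its real dimension is divisible
by `4`. -/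
theorem four_dvd_finrank_g1 : 4 ∣ Module.finrank ℝ D.g1 := by
  let J : (Fin 3 → ℝ) → Module.End ℝ D.g1 := fun τ =>
    (LieAlgebra.ad ℝ 𝔤 (D.xiComb τ)).restrict (p := D.g1) (q := D.g1)
      fun Y hY => D.lie_sp1_g1 (D.xiComb_mem τ) hY
  have hJ : ∀ τ τ', J τ * J τ' + J τ' * J τ = (-2 * (τ ⬝ᵥ τ')) • (1 : Module.End ℝ D.g1) := by
    intro τ τ'
    ext Y
    exact D.xiComb_clifford τ τ' Y.2
  have hJs : ∀ τ, J τ * J τ = -(τ ⬝ᵥ τ) • (1 : Module.End ℝ D.g1) := by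
    intro τ
    ext Y
    exact D.xiComb_lie_xiComb_self τ Y.2
  let b : QuaternionAlgebra.Basis (Module.End ℝ D.g1) (-1 : ℝ) 0 (-1) :=
    { i := J ![1, 0, 0]
      j := J ![0, 1, 0]
      k := J ![1, 0, 0] * J ![0, 1, 0]
      i_mul_i := by
        rw [hJs]; ext Y; simp
      j_mul_j := by
        rw [hJs]; ext Y; simp
      i_mul_j := rfl
      j_mul_i := by
        have := hJ ![1, 0, 0] ![0, 1, 0]
        simp at this
        rw [zero_smul, zero_sub, eq_neg_iff_add_eq_zero, add_comm]; exact this }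
  let f : Quaternion ℝ →ₐ[ℝ] Module.End ℝ D.g1 := b.liftHom
  let _ : Module (Quaternion ℝ) D.g1 := Module.compHom D.g1 f.toRingHom
  have : IsScalarTower ℝ (Quaternion ℝ) D.g1 := ⟨fun r x Y => by
    change f (r • x) Y = r • f x Y
    rw [map_smul]; rfl⟩
  rw [← Module.finrank_mul_finrank ℝ (Quaternion ℝ) D.g1, Quaternion.finrank_eq_four]
  exact dvd_mul_right _ _

end ThreeSasakianData

namespace ThreeSasakianData

variable {𝔤 : Type*} [LieRing 𝔤] [LieAlgebra ℝ 𝔤] {𝔥 : LieSubalgebra ℝ 𝔤}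
  {W : Type*} [AddCommGroup W] [Module ℂ W] [LieRingModule (ℂ ⊗[ℝ] 𝔥) W]
  [LieModule ℂ (ℂ ⊗[ℝ] 𝔥) W] (D : ThreeSasakianData 𝔤 𝔥 W)

/-! ### The projections onto `sp(1)` and `𝔤₁` -/

theorem isCompl_sp1 : IsCompl D.sp1.toSubmodule (𝔥.toSubmodule ⊔ D.g1) := by
  have h1 : Disjoint (D.sp1.toSubmodule ⊔ 𝔥.toSubmodule) D.g1 := by
    rw [D.sp1_sup_h]; exact D.isCompl.disjoint
  refine ⟨Disjoint.disjoint_sup_right_of_disjoint_sup_left D.sp1_disjoint_h h1, ?_⟩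
  rw [codisjoint_iff, ← sup_assoc, D.sp1_sup_h]
  exact D.isCompl.sup_eq_top

/-- The projection of `𝔤 = 𝔥 ⊕ sp(1) ⊕ 𝔤₁` onto `sp(1)`. -/
noncomputable def projSp1 : 𝔤 →ₗ[ℝ] 𝔤 := D.sp1.toSubmodule.projection _ D.isCompl_sp1

/-- The projection of `𝔤 = 𝔤₀ ⊕ 𝔤₁` onto `𝔤₁`. -/
noncomputable def projG1 : 𝔤 →ₗ[ℝ] 𝔤 := D.g1.projection _ D.isCompl.symm

theorem projSp1_mem (X : 𝔤) : D.projSp1 X ∈ D.sp1 :=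
  Submodule.projection_apply_mem D.isCompl_sp1 X

theorem projG1_mem (X : 𝔤) : D.projG1 X ∈ D.g1 := Submodule.projection_apply_mem D.isCompl.symm X

theorem projSp1_of_sp1 {X : 𝔤} (hX : X ∈ D.sp1) : D.projSp1 X = X :=
  Submodule.projection_apply_of_mem_left D.isCompl_sp1 hX

theorem projSp1_of_g1 {X : 𝔤} (hX : X ∈ D.g1) : D.projSp1 X = 0 :=
  (Submodule.projection_apply_eq_zero_iff D.isCompl_sp1).2 (Submodule.mem_sup_right hX)

theorem projSp1_of_h {X : 𝔤} (hX : X ∈ 𝔥) : D.projSp1 X = 0 :=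
  (Submodule.projection_apply_eq_zero_iff D.isCompl_sp1).2 (Submodule.mem_sup_left hX)

theorem projG1_of_g1 {X : 𝔤} (hX : X ∈ D.g1) : D.projG1 X = X :=
  Submodule.projection_apply_of_mem_left D.isCompl.symm hX

theorem projG1_of_g0 {X : 𝔤} (hX : X ∈ D.g0) : D.projG1 X = 0 :=
  (Submodule.projection_apply_eq_zero_iff D.isCompl.symm).2 hX

theorem projG1_of_sp1 {X : 𝔤} (hX : X ∈ D.sp1) : D.projG1 X = 0 :=
  D.projG1_of_g0 (D.sp1_le_g0 hX)

theorem sub_proj_mem_h (X : 𝔤) : X - D.projSp1 X - D.projG1 X ∈ 𝔥 := by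
  have h0 : X - D.projG1 X ∈ D.g0 := by
    have := Submodule.sub_projection_mem D.isCompl.symm X
    exact this
  rw [← D.sp1_sup_h] at h0
  obtain ⟨Y, hY, Z, hZ, hYZ⟩ := Submodule.mem_sup.1 h0
  have hX : X = Y + Z + D.projG1 X := by rw [hYZ]; abel
  have hs : D.projSp1 X = Y := by
    rw [hX, map_add, map_add, D.projSp1_of_sp1 hY, D.projSp1_of_h hZ,
      D.projSp1_of_g1 (D.projG1_mem X), add_zero, add_zero]
  have : X - D.projSp1 X - D.projG1 X = Z := by
    rw [hs, sub_right_comm, ← hYZ]; abel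
  rw [this]; exact hZ

theorem projM_eq (X : 𝔤) : (D.projM X : 𝔤) = D.projSp1 X + D.projG1 X := by
  have hm : D.projSp1 X + D.projG1 X ∈ D.m :=
    add_mem (D.sp1_le_m (D.projSp1_mem X)) (D.g1_le_m (D.projG1_mem X))
  have e : X = (X - D.projSp1 X - D.projG1 X) + (D.projSp1 X + D.projG1 X) := by abel
  conv_lhs => rw [e, map_add]
  have h1 : D.projM (X - D.projSp1 X - D.projG1 X) = 0 :=
    (Submodule.projectionOnto_apply_eq_zero_iff D.isCompl_h_m.symm).2 (D.sub_proj_mem_h X)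
  have h2 : D.projM (D.projSp1 X + D.projG1 X) = ⟨_, hm⟩ :=
    Submodule.projectionOnto_apply_of_mem_left D.isCompl_h_m.symm hm
  rw [h1, h2, zero_add]

theorem sub_projM_mem_h (X : 𝔤) : X - D.projM X ∈ 𝔥 := by
  rw [projM_eq, ← sub_sub]; exact D.sub_proj_mem_h X

theorem proj_add_of_m {X : 𝔤} (hX : X ∈ D.m) : D.projSp1 X + D.projG1 X = X := by
  rw [← projM_eq]
  exact congrArg Subtype.val (Submodule.projectionOnto_apply_of_mem_left D.isCompl_h_m.symm hX)

theorem finrank_sp1 : Module.finrank ℝ D.sp1 = 3 := by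
  have e : (Fin 3 → ℝ) ≃ₗ[ℝ] D.sp1 := LinearEquiv.ofBijective
    ((D.su2Equiv : su2 →ₗ[ℝ] D.sp1) ∘ₗ su2Comb)
    ⟨D.su2Equiv.injective.comp su2Comb_injective, D.su2Equiv.surjective.comp su2Comb_surjective⟩
  rw [← e.finrank_eq]; simp

theorem exists_projSp1 (X : 𝔤) : ∃ τ, D.xiComb τ = D.projSp1 X := D.exists_xiComb (D.projSp1_mem X)

/-! ### The Killing form -/

theorem killingForm_symm (X Y : 𝔤) : killingForm ℝ 𝔤 X Y = killingForm ℝ 𝔤 Y X :=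
  LieModule.traceForm_comm ℝ 𝔤 𝔤 X Y

theorem killingForm_lie (X Y Z : 𝔤) : killingForm ℝ 𝔤 ⁅X, Y⁆ Z = killingForm ℝ 𝔤 X ⁅Y, Z⁆ :=
  LieModule.traceForm_apply_lie_apply ℝ 𝔤 𝔤 X Y Z

/-- The even and the odd part are orthogonal: the grading involution, which is `1` on `𝔤₀` and `-1`
on `𝔤₁`, is an automorphism, and hence preserves the Killing form. -/
theorem killingForm_g0_g1 {X Y : 𝔤} (hX : X ∈ D.g0) (hY : Y ∈ D.g1) :
    killingForm ℝ 𝔤 X Y = 0 := by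
  let σ : 𝔤 →ₗ[ℝ] 𝔤 := LinearMap.id - (2 : ℝ) • D.projG1
  have hσ0 : ∀ Z ∈ D.g0, σ Z = Z := fun Z hZ => by simp [σ, D.projG1_of_g0 hZ]
  have hσ1 : ∀ Z ∈ D.g1, σ Z = -Z := fun Z hZ => by
    simp only [σ, LinearMap.sub_apply, LinearMap.id_apply, LinearMap.smul_apply,
      D.projG1_of_g1 hZ]
    module
  have hdec : ∀ Z : 𝔤, ∃ A ∈ D.g0, ∃ B ∈ D.g1, Z = A + B := fun Z => by
    have : Z ∈ D.g0 ⊔ D.g1 := by rw [D.isCompl.sup_eq_top]; trivial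
    obtain ⟨A, hA, B, hB, h⟩ := Submodule.mem_sup.1 this
    exact ⟨A, hA, B, hB, h.symm⟩
  have hσσ : ∀ Z, σ (σ Z) = Z := fun Z => by
    obtain ⟨A, hA, B, hB, rfl⟩ := hdec Z
    rw [map_add, map_add, hσ0 A hA, hσ0 A hA, hσ1 B hB, map_neg, hσ1 B hB, neg_neg]
  have hσl : ∀ Z Z', σ ⁅Z, Z'⁆ = ⁅σ Z, σ Z'⁆ := fun Z Z' => by
    obtain ⟨A, hA, B, hB, rfl⟩ := hdec Z
    obtain ⟨A', hA', B', hB', rfl⟩ := hdec Z'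
    have hBA : ⁅B, A'⁆ ∈ D.g1 := by rw [← lie_skew]; exact neg_mem (D.lie_g0_g1 _ hA' _ hB)
    simp only [map_add, add_lie, lie_add, hσ0 A hA, hσ0 A' hA', hσ1 B hB, hσ1 B' hB',
      hσ0 _ (D.lie_g0_g0 _ hA _ hA'), hσ0 _ (D.lie_g1_g1 _ hB _ hB'),
      hσ1 _ (D.lie_g0_g1 _ hA _ hB'), hσ1 _ hBA, neg_lie, lie_neg, neg_neg, neg_add]
  let e : 𝔤 ≃ₗ⁅ℝ⁆ 𝔤 :=
    { LinearEquiv.ofInvolutive σ hσσ with map_lie' := fun {Z Z'} => hσl Z Z' }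
  have h := LieAlgebra.killingForm_of_equiv_apply e X Y
  change killingForm ℝ 𝔤 (σ X) (σ Y) = _ at h
  rw [hσ0 X hX, hσ1 Y hY, map_neg] at h
  linarith

/-- `sp(1)` and `𝔥` are orthogonal, because `sp(1)` is perfect and commutes with `𝔥`. -/
theorem killingForm_sp1_h {X Y : 𝔤} (hX : X ∈ D.sp1) (hY : Y ∈ 𝔥) :
    killingForm ℝ 𝔤 X Y = 0 := by
  have hb : ∀ τ τ', killingForm ℝ 𝔤 (D.xiComb (τ ⨯₃ τ')) Y = 0 := fun τ τ' => by
    have h : killingForm ℝ 𝔤 ⁅D.xiComb τ, D.xiComb τ'⁆ Y = 0 := by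
      rw [killingForm_lie, D.lie_sp1_h (D.xiComb_mem τ') hY, map_zero]
    rw [xiComb_lie, map_smul, LinearMap.smul_apply, smul_eq_mul] at h
    linarith
  obtain ⟨τ, rfl⟩ := D.exists_xiComb hX
  have hτ : τ = τ 0 • (![0, 1, 0] ⨯₃ ![0, 0, 1]) + τ 1 • (![0, 0, 1] ⨯₃ ![1, 0, 0]) +
      τ 2 • (![1, 0, 0] ⨯₃ ![0, 1, 0]) := by
    ext i; fin_cases i <;> simp [cross_apply]
  rw [hτ]
  simp only [map_add, map_smul, LinearMap.add_apply, LinearMap.smul_apply, hb, smul_zero, add_zero]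

theorem killingForm_sp1_left {X : 𝔤} (hX : X ∈ D.sp1) (Y : 𝔤) :
    killingForm ℝ 𝔤 X Y = killingForm ℝ 𝔤 X (D.projSp1 Y) := by
  have e : Y = (Y - D.projSp1 Y - D.projG1 Y) + D.projSp1 Y + D.projG1 Y := by abel
  conv_lhs => rw [e, map_add, map_add, D.killingForm_sp1_h hX (D.sub_proj_mem_h Y),
    D.killingForm_g0_g1 (D.sp1_le_g0 hX) (D.projG1_mem Y), zero_add, add_zero]

/-- `𝔤₁` is the orthogonal complement of `𝔤₀` with respect to the Killing form, which is definite. -/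
theorem mem_g1_iff {X : 𝔤} : X ∈ D.g1 ↔ ∀ Y ∈ D.g0, killingForm ℝ 𝔤 X Y = 0 := by
  refine ⟨fun h Y hY => by rw [killingForm_symm, D.killingForm_g0_g1 hY h], fun h => ?_⟩
  have h0 : X - D.projG1 X ∈ D.g0 := Submodule.sub_projection_mem D.isCompl.symm X
  have h1 : killingForm ℝ 𝔤 (X - D.projG1 X) (X - D.projG1 X) = 0 := by
    rw [map_sub (killingForm ℝ 𝔤), LinearMap.sub_apply, h _ h0, killingForm_symm (D.projG1 X),
      D.killingForm_g0_g1 h0 (D.projG1_mem X), sub_zero]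
  by_contra hX
  refine (D.compact (X - D.projG1 X) fun h2 => hX ?_).ne h1
  rw [sub_eq_zero.1 h2]; exact D.projG1_mem X

/-- An automorphism of `𝔤` which preserves `𝔥` and fixes `sp(1)` preserves `𝔤₁`, which is the
orthogonal complement of `𝔤₀`. -/
theorem map_mem_g1 (e : 𝔤 ≃ₗ⁅ℝ⁆ 𝔤) (hsp : ∀ X ∈ D.sp1, e X = X) (hh : ∀ X ∈ 𝔥, e.symm X ∈ 𝔥)
    {X : 𝔤} (hX : X ∈ D.g1) : e X ∈ D.g1 := by
  rw [mem_g1_iff]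
  intro Y hY
  have hY' : e.symm Y ∈ D.g0 := by
    rw [← D.sp1_sup_h] at hY
    obtain ⟨A, hA, B, hB, rfl⟩ := Submodule.mem_sup.1 hY
    have hA' : e.symm A = A := e.injective
      ((LieEquiv.apply_symm_apply e A).trans (hsp A hA).symm)
    rw [map_add, hA']
    exact add_mem (D.sp1_le_g0 hA) (D.h_le_g0 (hh B hB))
  rw [← LieEquiv.apply_symm_apply e Y, LieAlgebra.killingForm_of_equiv_apply, killingForm_symm]
  exact D.killingForm_g0_g1 hY' hX

section FiniteDimensional

variable [FiniteDimensional ℝ 𝔤]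

theorem finrank_m : Module.finrank ℝ D.m = 3 + Module.finrank ℝ D.g1 := by
  have hd : Disjoint D.sp1.toSubmodule D.g1 :=
    D.isCompl_sp1.disjoint.mono_right le_sup_right
  have h := Submodule.finrank_sup_add_finrank_inf_eq D.sp1.toSubmodule D.g1
  rw [hd.eq_bot, finrank_bot, add_zero] at h
  rw [m, h]
  congr 1
  exact D.finrank_sp1

/-- `(ad q)² = 4 q ⟨q, ·⟩ - 4 |q|²` on `sp(1)`, `-|q|²` on `𝔤₁` and `0` on `𝔥`, which determines its
trace. -/
theorem killingForm_xiComb_self (τ : Fin 3 → ℝ) :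
    killingForm ℝ 𝔤 (D.xiComb τ) (D.xiComb τ) =
      -(8 + (Module.finrank ℝ D.g1 : ℝ)) * (τ ⬝ᵥ τ) := by
  obtain ⟨t, ht⟩ : ∃ t : 𝔤 →ₗ[ℝ] (Fin 3 → ℝ), ∀ X, D.xiComb (t X) = D.projSp1 X := by
    have hinj : LinearMap.ker D.xiComb = ⊥ := LinearMap.ker_eq_bot.2 D.xiComb_injective
    obtain ⟨l, hl⟩ := D.xiComb.exists_leftInverse_of_injective hinj
    refine ⟨l ∘ₗ D.projSp1, fun X => ?_⟩
    obtain ⟨τ', h'⟩ := D.exists_projSp1 X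
    rw [LinearMap.comp_apply, ← h']
    exact congrArg D.xiComb (LinearMap.congr_fun hl τ')
  let φ : 𝔤 →ₗ[ℝ] ℝ := (dotProductBilin ℝ ℝ τ) ∘ₗ t
  have hT : LieAlgebra.ad ℝ 𝔤 (D.xiComb τ) ∘ₗ LieAlgebra.ad ℝ 𝔤 (D.xiComb τ) =
      (4 : ℝ) • φ.smulRight (D.xiComb τ) - (4 * (τ ⬝ᵥ τ)) • D.projSp1 - (τ ⬝ᵥ τ) • D.projG1 := by
    ext X
    have e : X = (X - D.projSp1 X - D.projG1 X) + D.projSp1 X + D.projG1 X := by abel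
    have e1 : ⁅D.xiComb τ, X⁆ = ⁅D.xiComb τ, D.projSp1 X⁆ + ⁅D.xiComb τ, D.projG1 X⁆ := by
      conv_lhs => rw [e, lie_add, lie_add, D.lie_sp1_h (D.xiComb_mem τ) (D.sub_proj_mem_h X),
        zero_add]
    simp only [LinearMap.comp_apply, LieAlgebra.ad_apply, LinearMap.sub_apply,
      LinearMap.smul_apply, LinearMap.smulRight_apply]
    rw [e1, lie_add, D.xiComb_lie_xiComb_self τ (D.projG1_mem X), ← ht X, xiComb_lie, lie_smul,
      xiComb_lie, smul_smul]
    have hc : (τ ⨯₃ (τ ⨯₃ (t X))) = (τ ⬝ᵥ t X) • τ - (τ ⬝ᵥ τ) • t X := by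
      ext i; fin_cases i <;> simp [cross_apply, dotProduct, Fin.sum_univ_three] <;> ring
    rw [hc, map_sub, map_smul, map_smul]
    have hφ : φ X = τ ⬝ᵥ t X := rfl
    rw [hφ]
    module
  rw [killingForm_apply_apply, hT]
  have hsp : LinearMap.trace ℝ 𝔤 D.projSp1 = 3 := by
    have : LinearMap.IsProj D.sp1.toSubmodule D.projSp1 :=
      ⟨D.projSp1_mem, fun X hX => D.projSp1_of_sp1 hX⟩
    rw [this.trace]; exact_mod_cast D.finrank_sp1
  have hg1 : LinearMap.trace ℝ 𝔤 D.projG1 = Module.finrank ℝ D.g1 := by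
    have : LinearMap.IsProj D.g1 D.projG1 :=
      ⟨D.projG1_mem, fun X hX => D.projG1_of_g1 hX⟩
    rw [this.trace]
  have hφτ : φ (D.xiComb τ) = τ ⬝ᵥ τ := by
    have : t (D.xiComb τ) = τ := D.xiComb_injective (by
      rw [ht, D.projSp1_of_sp1 (D.xiComb_mem τ)])
    change τ ⬝ᵥ t (D.xiComb τ) = _
    rw [this]
  rw [map_sub, map_sub, map_smul, map_smul, map_smul, hsp, hg1, LinearMap.trace_smulRight, hφτ]
  simp only [smul_eq_mul]
  ring

theorem killingForm_xiComb (τ τ' : Fin 3 → ℝ) :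
    killingForm ℝ 𝔤 (D.xiComb τ) (D.xiComb τ') =
      -(8 + (Module.finrank ℝ D.g1 : ℝ)) * (τ ⬝ᵥ τ') := by
  have h := D.killingForm_xiComb_self (τ + τ')
  have h1 := D.killingForm_xiComb_self τ
  have h2 := D.killingForm_xiComb_self τ'
  have h3 := killingForm_symm (D.xiComb τ') (D.xiComb τ)
  have h4 := dotProduct_comm τ' τ
  simp only [map_add, LinearMap.add_apply, dotProduct_add, add_dotProduct] at h
  rw [h1, h2, h3, h4] at h
  linarith

end FiniteDimensional

end ThreeSasakianData

namespace ThreeSasakianData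

variable {𝔤 : Type*} [LieRing 𝔤] [LieAlgebra ℝ 𝔤] {𝔥 : LieSubalgebra ℝ 𝔤}
  {W : Type*} [AddCommGroup W] [Module ℂ W] [LieRingModule (ℂ ⊗[ℝ] 𝔥) W]
  [LieModule ℂ (ℂ ⊗[ℝ] 𝔥) W] (D : ThreeSasakianData 𝔤 𝔥 W)

/-! ### The inner product and the multiplication on `𝔪` -/

/-- The bilinear form on `𝔤` which is `-κ / (4 (n + 2))` on `sp(1)`, `-κ / (8 (n + 2))` on `𝔤₁`, zero
between the two, and has kernel `𝔥`: the form of `IsMetricForm`, extended from `𝔪` to `𝔤` so that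
its arguments need no proofs of membership. -/
noncomputable def metricForm (n : ℕ) : LinearMap.BilinForm ℝ 𝔤 :=
  -(1 / (4 * ((n : ℝ) + 2))) • (killingForm ℝ 𝔤).compl₁₂ D.projSp1 D.projSp1 -
    (1 / (8 * ((n : ℝ) + 2))) • (killingForm ℝ 𝔤).compl₁₂ D.projG1 D.projG1

theorem metricForm_apply (n : ℕ) (X Y : 𝔤) : D.metricForm n X Y =
    -(1 / (4 * ((n : ℝ) + 2))) * killingForm ℝ 𝔤 (D.projSp1 X) (D.projSp1 Y) -
      (1 / (8 * ((n : ℝ) + 2))) * killingForm ℝ 𝔤 (D.projG1 X) (D.projG1 Y) := rfl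

theorem metricForm_symm (n : ℕ) (X Y : 𝔤) : D.metricForm n X Y = D.metricForm n Y X := by
  rw [metricForm_apply, metricForm_apply, killingForm_symm (D.projSp1 X),
    killingForm_symm (D.projG1 X)]

theorem killingForm_self_nonpos (D : ThreeSasakianData 𝔤 𝔥 W) (X : 𝔤) : killingForm ℝ 𝔤 X X ≤ 0 := by
  by_cases h : X = 0
  · simp [h]
  · exact (D.compact X h).le

theorem metricForm_pos (n : ℕ) {X : 𝔤} (hX : X ∈ D.m) (h0 : X ≠ 0) : 0 < D.metricForm n X X := by
  have hn : (0 : ℝ) < (n : ℝ) + 2 := by positivity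
  have hc4 : 0 < 1 / (4 * ((n : ℝ) + 2)) := by positivity
  have hc8 : 0 < 1 / (8 * ((n : ℝ) + 2)) := by positivity
  rw [metricForm_apply]
  have h1 := D.killingForm_self_nonpos (D.projSp1 X)
  have h2 := D.killingForm_self_nonpos (D.projG1 X)
  by_cases hs : D.projSp1 X = 0
  · have hg : D.projG1 X ≠ 0 := fun hg => h0 (by
      rw [← D.proj_add_of_m hX, hs, hg, add_zero])
    have := D.compact _ hg
    nlinarith [mul_pos_of_neg_of_neg (neg_neg_of_pos hc8) this]
  · have := D.compact _ hs
    nlinarith [mul_pos_of_neg_of_neg (neg_neg_of_pos hc4) this]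

theorem isMetricForm_iff (n : ℕ) (B : LinearMap.BilinForm ℝ D.m) :
    D.IsMetricForm n B ↔ ∀ X Y : D.m, B X Y = D.metricForm n X Y := by
  constructor
  · intro h X Y
    have e : ∀ Z : D.m, Z = (⟨D.projSp1 Z, D.sp1_le_m (D.projSp1_mem _)⟩ : D.m) +
        ⟨D.projG1 Z, D.g1_le_m (D.projG1_mem _)⟩ := fun Z =>
      Subtype.ext (D.proj_add_of_m Z.2).symm
    have s : ∀ Z : D.m, D.projSp1 Z ∈ D.m := fun Z => D.sp1_le_m (D.projSp1_mem _)
    have g : ∀ Z : D.m, D.projG1 Z ∈ D.m := fun Z => D.g1_le_m (D.projG1_mem _)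
    have hss := h.sp1_sp1 ⟨_, s X⟩ ⟨_, s Y⟩ (D.projSp1_mem X) (D.projSp1_mem Y)
    have hgg := h.g1_g1 ⟨_, g X⟩ ⟨_, g Y⟩ (D.projG1_mem X) (D.projG1_mem Y)
    have hsg := (h.sp1_g1 ⟨_, s X⟩ ⟨_, g Y⟩ (D.projSp1_mem X) (D.projG1_mem Y)).1
    have hgs := (h.sp1_g1 ⟨_, s Y⟩ ⟨_, g X⟩ (D.projSp1_mem Y) (D.projG1_mem X)).2
    rw [metricForm_apply, e X, e Y, map_add, map_add, LinearMap.add_apply, LinearMap.add_apply,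
      hss, hgg, hsg, hgs, ← e X, ← e Y]
    ring
  · intro h
    refine ⟨fun X Y hX hY => ?_, fun X Y hX hY => ?_, fun X Y hX hY => ⟨?_, ?_⟩⟩ <;>
      rw [h, metricForm_apply]
    · rw [D.projSp1_of_sp1 hX, D.projSp1_of_sp1 hY, D.projG1_of_sp1 hX]; simp
    · rw [D.projG1_of_g1 hX, D.projG1_of_g1 hY, D.projSp1_of_g1 hX]; simp
    · rw [D.projG1_of_sp1 hX, D.projSp1_of_g1 hY]; simp
    · rw [D.projG1_of_sp1 hX, D.projSp1_of_g1 hY]; simp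

theorem existsUnique_isMetricForm (n : ℕ) : ∃! B, D.IsMetricForm n B := by
  refine ⟨(D.metricForm n).compl₁₂ D.m.subtype D.m.subtype,
    (D.isMetricForm_iff n _).2 fun _ _ => rfl, fun B hB => ?_⟩
  ext X Y
  exact (D.isMetricForm_iff n B).1 hB X Y

/-- An automorphism which commutes with the projections onto `sp(1)` and `𝔤₁` is an isometry. -/
theorem metricForm_map (n : ℕ) (e : 𝔤 ≃ₗ⁅ℝ⁆ 𝔤) (hs : ∀ X, D.projSp1 (e X) = e (D.projSp1 X))
    (h1 : ∀ X, D.projG1 (e X) = e (D.projG1 X)) (X Y : 𝔤) :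
    D.metricForm n (e X) (e Y) = D.metricForm n X Y := by
  rw [metricForm_apply, metricForm_apply, hs, hs, h1, h1, LieAlgebra.killingForm_of_equiv_apply,
    LieAlgebra.killingForm_of_equiv_apply]

/-- The multiplication `α` on `𝔪` which describes the Levi-Civita connection, extended to `𝔤` by `0`
on `𝔥`: it is `½ [X, Y]_𝔪` on `sp(1) × sp(1)` and on `𝔤₁ × 𝔤₁`, `[X, Y]` on `𝔤₁ × sp(1)` and `0`
on `sp(1) × 𝔤₁`. -/
noncomputable def nomizu : 𝔤 →ₗ[ℝ] 𝔤 →ₗ[ℝ] 𝔤 :=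
  LinearMap.mk₂ ℝ (fun X Y => (1 / 2 : ℝ) • ⁅D.projSp1 X, D.projSp1 Y⁆ +
      (1 / 2 : ℝ) • D.projSp1 ⁅D.projG1 X, D.projG1 Y⁆ + ⁅D.projG1 X, D.projSp1 Y⁆)
    (fun X X' Y => by simp only [map_add, add_lie]; module)
    (fun c X Y => by simp only [map_smul, smul_lie]; module)
    (fun X Y Y' => by simp only [map_add, lie_add]; module)
    (fun c X Y => by simp only [map_smul, lie_smul]; module)

theorem nomizu_apply (X Y : 𝔤) : D.nomizu X Y = (1 / 2 : ℝ) • ⁅D.projSp1 X, D.projSp1 Y⁆ +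
      (1 / 2 : ℝ) • D.projSp1 ⁅D.projG1 X, D.projG1 Y⁆ + ⁅D.projG1 X, D.projSp1 Y⁆ := rfl

theorem projSp1_nomizu (X Y : 𝔤) : D.projSp1 (D.nomizu X Y) =
    (1 / 2 : ℝ) • ⁅D.projSp1 X, D.projSp1 Y⁆ + (1 / 2 : ℝ) • D.projSp1 ⁅D.projG1 X, D.projG1 Y⁆ := by
  rw [nomizu_apply, map_add, D.projSp1_of_g1 (D.lie_g1_sp1 (D.projG1_mem _) (D.projSp1_mem _)),
    add_zero]
  exact D.projSp1_of_sp1 (add_mem (D.sp1.smul_mem _ (D.sp1.lie_mem (D.projSp1_mem _)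
    (D.projSp1_mem _))) (D.sp1.smul_mem _ (D.projSp1_mem _)))

theorem projG1_nomizu (X Y : 𝔤) : D.projG1 (D.nomizu X Y) = ⁅D.projG1 X, D.projSp1 Y⁆ := by
  rw [nomizu_apply, map_add, D.projG1_of_g1 (D.lie_g1_sp1 (D.projG1_mem _) (D.projSp1_mem _)),
    D.projG1_of_sp1 (add_mem (D.sp1.smul_mem _ (D.sp1.lie_mem (D.projSp1_mem _)
    (D.projSp1_mem _))) (D.sp1.smul_mem _ (D.projSp1_mem _))), zero_add]

theorem nomizu_mem (X Y : 𝔤) : D.nomizu X Y ∈ D.m := by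
  refine add_mem (D.sp1_le_m (add_mem (D.sp1.smul_mem _ (D.sp1.lie_mem (D.projSp1_mem _)
    (D.projSp1_mem _))) (D.sp1.smul_mem _ (D.projSp1_mem _)))) (D.g1_le_m ?_)
  exact D.lie_g1_sp1 (D.projG1_mem _) (D.projSp1_mem _)

theorem nomizu_sp1_g1 {X Y : 𝔤} (hX : X ∈ D.sp1) (hY : Y ∈ D.g1) : D.nomizu X Y = 0 := by
  simp [nomizu_apply, D.projG1_of_sp1 hX, D.projSp1_of_g1 hY]

theorem nomizu_sp1_sp1 {X Y : 𝔤} (hX : X ∈ D.sp1) (hY : Y ∈ D.sp1) :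
    D.nomizu X Y = (1 / 2 : ℝ) • ⁅X, Y⁆ := by
  simp [nomizu_apply, D.projG1_of_sp1 hX, D.projSp1_of_sp1 hX, D.projSp1_of_sp1 hY]

theorem nomizu_g1_sp1 {X Y : 𝔤} (hX : X ∈ D.g1) (hY : Y ∈ D.sp1) : D.nomizu X Y = ⁅X, Y⁆ := by
  simp [nomizu_apply, D.projG1_of_g1 hX, D.projSp1_of_g1 hX, D.projSp1_of_sp1 hY,
    D.projG1_of_sp1 hY]

theorem nomizu_g1_g1 {X Y : 𝔤} (hX : X ∈ D.g1) (hY : Y ∈ D.g1) :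
    D.nomizu X Y = (1 / 2 : ℝ) • D.projSp1 ⁅X, Y⁆ := by
  simp [nomizu_apply, D.projG1_of_g1 hX, D.projSp1_of_g1 hX, D.projG1_of_g1 hY,
    D.projSp1_of_g1 hY]

/-- The connection with multiplication `nomizu` has no torsion. -/
theorem nomizu_sub_nomizu {X Y : 𝔤} (hX : X ∈ D.m) (hY : Y ∈ D.m) :
    D.nomizu X Y - D.nomizu Y X = D.projM ⁅X, Y⁆ := by
  have hs1 := D.lie_sp1_g1 (D.projSp1_mem X) (D.projG1_mem Y)
  have h1s := D.lie_g1_sp1 (D.projG1_mem X) (D.projSp1_mem Y)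
  have hss := D.sp1.lie_mem (D.projSp1_mem X) (D.projSp1_mem Y)
  have h11 := D.lie_g1_g1 _ (D.projG1_mem X) _ (D.projG1_mem Y)
  have e : ⁅X, Y⁆ = ⁅D.projSp1 X, D.projSp1 Y⁆ + ⁅D.projSp1 X, D.projG1 Y⁆ +
      ⁅D.projG1 X, D.projSp1 Y⁆ + ⁅D.projG1 X, D.projG1 Y⁆ := by
    conv_lhs => rw [← D.proj_add_of_m hX, ← D.proj_add_of_m hY]
    simp only [add_lie, lie_add]; abel
  rw [projM_eq, e]
  simp only [map_add, D.projSp1_of_sp1 hss, D.projSp1_of_g1 hs1, D.projSp1_of_g1 h1s,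
    D.projG1_of_sp1 hss, D.projG1_of_g1 hs1, D.projG1_of_g1 h1s, D.projG1_of_g0 h11]
  rw [nomizu_apply, nomizu_apply, ← lie_skew (D.projSp1 Y) (D.projSp1 X),
    ← lie_skew (D.projG1 Y) (D.projG1 X), ← lie_skew (D.projG1 Y) (D.projSp1 X), map_neg]
  module

theorem killingForm_projSp1_sp1 (X : 𝔤) {Z : 𝔤} (hZ : Z ∈ D.sp1) :
    killingForm ℝ 𝔤 (D.projSp1 X) Z = killingForm ℝ 𝔤 X Z := by
  rw [killingForm_symm, ← D.killingForm_sp1_left hZ, killingForm_symm]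

theorem metricForm_nomizu (n : ℕ) (X Y Z : 𝔤) :
    D.metricForm n (D.nomizu X Y) Z = -(1 / (8 * ((n : ℝ) + 2))) *
      (killingForm ℝ 𝔤 ⁅D.projSp1 X, D.projSp1 Y⁆ (D.projSp1 Z) +
        killingForm ℝ 𝔤 ⁅D.projG1 X, D.projG1 Y⁆ (D.projSp1 Z) +
        killingForm ℝ 𝔤 ⁅D.projG1 X, D.projSp1 Y⁆ (D.projG1 Z)) := by
  rw [metricForm_apply, projSp1_nomizu, projG1_nomizu, map_add, map_smul, map_smul,
    LinearMap.add_apply, LinearMap.smul_apply, LinearMap.smul_apply,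
    D.killingForm_projSp1_sp1 _ (D.projSp1_mem Z), smul_eq_mul, smul_eq_mul]
  have hn : (n : ℝ) + 2 ≠ 0 := by positivity
  field_simp
  ring

theorem killingForm_lie_skew (X Y Z : 𝔤) :
    killingForm ℝ 𝔤 ⁅X, Y⁆ Z = -killingForm ℝ 𝔤 ⁅X, Z⁆ Y := by
  rw [killingForm_lie, killingForm_lie, ← lie_skew, map_neg]

/-- The connection with multiplication `nomizu` is metric. -/
theorem metricForm_nomizu_skew (n : ℕ) (X Y Z : 𝔤) :
    D.metricForm n (D.nomizu X Y) Z + D.metricForm n Y (D.nomizu X Z) = 0 := by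
  rw [D.metricForm_symm n Y, metricForm_nomizu, metricForm_nomizu,
    killingForm_lie_skew (D.projSp1 X) (D.projSp1 Y), killingForm_lie_skew (D.projG1 X) (D.projG1 Y),
    killingForm_lie_skew (D.projG1 X) (D.projSp1 Y)]
  ring

/-- The endomorphism `X ↦ α(X, q)` is skew-symmetric for `q ∈ sp(1)`. -/
theorem metricForm_nomizu_sp1_skew (n : ℕ) (X Z : 𝔤) {q : 𝔤} (hq : q ∈ D.sp1) :
    D.metricForm n (D.nomizu X q) Z + D.metricForm n X (D.nomizu Z q) = 0 := by
  rw [D.metricForm_symm n X, metricForm_nomizu, metricForm_nomizu, D.projG1_of_sp1 hq,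
    D.projSp1_of_sp1 hq, killingForm_lie (D.projSp1 X), killingForm_lie (D.projG1 X) q,
    killingForm_symm (D.projSp1 X), killingForm_symm (D.projG1 X), ← lie_skew q (D.projSp1 Z),
    ← lie_skew q (D.projG1 Z)]
  simp only [map_neg, LinearMap.neg_apply, lie_zero, map_zero, LinearMap.zero_apply]
  ring

theorem nomizu_xiComb (X : 𝔤) (τ : Fin 3 → ℝ) : D.nomizu X (D.xiComb τ) =
    (1 / 2 : ℝ) • ⁅D.projSp1 X, D.xiComb τ⁆ + ⁅D.projG1 X, D.xiComb τ⁆ := by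
  simp [nomizu_apply, D.projSp1_of_sp1 (D.xiComb_mem τ), D.projG1_of_sp1 (D.xiComb_mem τ)]

/-- The Killing form is nondegenerate on `sp(1)`. -/
theorem eq_of_killingForm_sp1 {X Y : 𝔤} (hX : X ∈ D.sp1) (hY : Y ∈ D.sp1)
    (h : ∀ τ, killingForm ℝ 𝔤 X (D.xiComb τ) = killingForm ℝ 𝔤 Y (D.xiComb τ)) : X = Y := by
  by_contra hne
  obtain ⟨τ, hτ⟩ := D.exists_xiComb (sub_mem hX hY)
  refine (D.compact (X - Y) (sub_ne_zero.2 hne)).ne ?_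
  conv_lhs => rw [← hτ]
  rw [hτ, map_sub (killingForm ℝ 𝔤), LinearMap.sub_apply, ← hτ, h, sub_self]

section FiniteDimensional

variable [FiniteDimensional ℝ 𝔤]

theorem metricForm_xiComb {n : ℕ} (hn : Module.finrank ℝ D.g1 = 4 * n) (τ τ' : Fin 3 → ℝ) :
    D.metricForm n (D.xiComb τ) (D.xiComb τ') = τ ⬝ᵥ τ' := by
  rw [metricForm_apply, D.projSp1_of_sp1 (D.xiComb_mem _), D.projSp1_of_sp1 (D.xiComb_mem _),
    D.projG1_of_sp1 (D.xiComb_mem _), killingForm_xiComb, hn]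
  have : (n : ℝ) + 2 ≠ 0 := by positivity
  simp only [map_zero, LinearMap.zero_apply, mul_zero, sub_zero]
  push_cast
  field_simp
  ring

/-- The part of the Sasakian identity on `𝔤₁ × 𝔤₁`. Both sides lie in `sp(1)`, and their products
with an element of `sp(1)` with respect to the Killing form agree by the Clifford relation. -/
theorem sasakian_g1_g1 {n : ℕ} (hn : Module.finrank ℝ D.g1 = 4 * n) (τ : Fin 3 → ℝ) (X : 𝔤) {Y : 𝔤}
    (hY : Y ∈ D.g1) :
    -((1 / 2 : ℝ) • D.projSp1 ⁅X, ⁅Y, D.xiComb τ⁆⁆) +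
      (1 / 4 : ℝ) • ⁅D.projSp1 ⁅X, Y⁆, D.xiComb τ⁆ =
    (-(1 / (8 * ((n : ℝ) + 2))) * killingForm ℝ 𝔤 X Y) • D.xiComb τ := by
  refine D.eq_of_killingForm_sp1 (add_mem (neg_mem (D.sp1.smul_mem _ (D.projSp1_mem _)))
    (D.sp1.smul_mem _ (D.sp1.lie_mem (D.projSp1_mem _) (D.xiComb_mem _))))
    (D.sp1.smul_mem _ (D.xiComb_mem _)) fun σ => ?_
  have hc := congrArg (killingForm ℝ 𝔤 X) (D.xiComb_clifford τ σ hY)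
  have h1 : killingForm ℝ 𝔤 (D.projSp1 ⁅X, ⁅Y, D.xiComb τ⁆⁆) (D.xiComb σ) =
      killingForm ℝ 𝔤 X ⁅D.xiComb σ, ⁅D.xiComb τ, Y⁆⁆ := by
    rw [D.killingForm_projSp1_sp1 _ (D.xiComb_mem _), killingForm_lie, ← lie_skew,
      ← lie_skew Y, lie_neg, neg_neg]
  have h2 : killingForm ℝ 𝔤 ⁅D.projSp1 ⁅X, Y⁆, D.xiComb τ⁆ (D.xiComb σ) =
      -killingForm ℝ 𝔤 X ⁅D.xiComb τ, ⁅D.xiComb σ, Y⁆⁆ +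
        killingForm ℝ 𝔤 X ⁅D.xiComb σ, ⁅D.xiComb τ, Y⁆⁆ := by
    rw [killingForm_lie, D.killingForm_projSp1_sp1 _ (D.sp1.lie_mem (D.xiComb_mem _)
      (D.xiComb_mem _)), killingForm_lie, ← lie_skew, lie_lie, map_neg, map_sub]
    ring
  simp only [map_add, map_neg, map_smul, LinearMap.add_apply, LinearMap.neg_apply,
    LinearMap.smul_apply, smul_eq_mul] at hc ⊢
  rw [h1, h2, killingForm_xiComb, hn]
  have hn' : (n : ℝ) + 2 ≠ 0 := by positivity
  have hcn : 1 / (8 * ((n : ℝ) + 2)) * (8 + 4 * n) = 1 / 2 := by field_simp; ring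
  push_cast
  linear_combination (-1 / 4) * hc - (τ ⬝ᵥ σ) * killingForm ℝ 𝔤 X Y * hcn

/-- The Sasakian identity `(∇_X φ)(Y) = g(X, Y) ξ - η(Y) X` for the endomorphism
`φ(X) = -α(X, ξ)`. The components of `X` and `Y` in `sp(1)` contribute an identity of cross products
and the Clifford relation; the remaining part is `sasakian_g1_g1`. -/
theorem nomizu_sasakian {n : ℕ} (hn : Module.finrank ℝ D.g1 = 4 * n) (τ : Fin 3 → ℝ) {X Y : 𝔤}
    (hX : X ∈ D.m) :
    D.nomizu X (-D.nomizu Y (D.xiComb τ)) - -D.nomizu (D.nomizu X Y) (D.xiComb τ) =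
      D.metricForm n X Y • D.xiComb τ - D.metricForm n (D.xiComb τ) Y • X := by
  have e : D.metricForm n (D.xiComb τ) Y = D.metricForm n (D.xiComb τ) (D.projSp1 Y) := by
    rw [metricForm_apply, metricForm_apply, D.projSp1_of_sp1 (D.projSp1_mem _),
      D.projG1_of_sp1 (D.xiComb_mem _)]
    simp
  have hXX := D.proj_add_of_m hX
  obtain ⟨x, hx⟩ := D.exists_projSp1 X
  obtain ⟨y, hy⟩ := D.exists_projSp1 Y
  have h11 := D.sasakian_g1_g1 hn τ (D.projG1 X) (D.projG1_mem Y)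
  have hcl := D.xiComb_clifford τ y (D.projG1_mem X)
  have hxy : -(1 / (4 * ((n : ℝ) + 2))) * killingForm ℝ 𝔤 (D.projSp1 X) (D.projSp1 Y) =
      x ⬝ᵥ y := by
    have := D.metricForm_xiComb hn x y
    rw [metricForm_apply, D.projSp1_of_sp1 (D.xiComb_mem _), D.projSp1_of_sp1 (D.xiComb_mem _),
      D.projG1_of_sp1 (D.xiComb_mem _), hx, hy] at this
    rw [← this]; simp
  rw [nomizu_apply D X (-D.nomizu Y (D.xiComb τ)), D.nomizu_xiComb (D.nomizu X Y), projSp1_nomizu,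
    projG1_nomizu, e, metricForm_apply, hxy]
  simp only [map_neg]
  rw [projSp1_nomizu, projG1_nomizu, D.projSp1_of_sp1 (D.xiComb_mem τ),
    D.projG1_of_sp1 (D.xiComb_mem τ), lie_zero, map_zero, smul_zero, add_zero, ← hy,
    D.metricForm_xiComb hn]
  have hX' : (τ ⬝ᵥ y) • X = (τ ⬝ᵥ y) • D.xiComb x + (τ ⬝ᵥ y) • D.projG1 X := by
    rw [hx, ← smul_add, hXX]
  rw [hX', ← hx]
  -- the terms on `sp(1) × sp(1)`
  have hss : -((1 / 4 : ℝ) • ⁅D.xiComb x, ⁅D.xiComb y, D.xiComb τ⁆⁆) +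
      (1 / 4 : ℝ) • ⁅⁅D.xiComb x, D.xiComb y⁆, D.xiComb τ⁆ =
      (x ⬝ᵥ y) • D.xiComb τ - (τ ⬝ᵥ y) • D.xiComb x := by
    simp only [xiComb_lie, lie_smul, smul_lie, smul_smul]
    have hv : -(x ⨯₃ (y ⨯₃ τ)) + (x ⨯₃ y) ⨯₃ τ = (x ⬝ᵥ y) • τ - (τ ⬝ᵥ y) • x := by
      ext i; fin_cases i <;> simp [cross_apply, dotProduct, Fin.sum_univ_three] <;> ring
    have h := congrArg D.xiComb hv
    simp only [map_add, map_neg, map_sub, map_smul] at h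
    rw [← h]
    module
  -- the terms on `𝔤₁ × sp(1)`
  have hs1 : -((1 / 2 : ℝ) • ⁅D.projG1 X, ⁅D.xiComb y, D.xiComb τ⁆⁆) +
      ⁅⁅D.projG1 X, D.xiComb y⁆, D.xiComb τ⁆ = -(τ ⬝ᵥ y) • D.projG1 X := by
    have h2 : ⁅⁅D.projG1 X, D.xiComb y⁆, D.xiComb τ⁆ = ⁅D.xiComb τ, ⁅D.xiComb y, D.projG1 X⁆⁆ := by
      rw [← lie_skew, ← lie_skew (D.projG1 X), lie_neg, neg_neg]
    have h3 : ⁅D.projG1 X, ⁅D.xiComb y, D.xiComb τ⁆⁆ =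
        ⁅D.xiComb τ, ⁅D.xiComb y, D.projG1 X⁆⁆ - ⁅D.xiComb y, ⁅D.xiComb τ, D.projG1 X⁆⁆ := by
      rw [← lie_skew, lie_lie]; abel
    rw [h2, h3]
    have h4 : -(τ ⬝ᵥ y) • D.projG1 X = (1 / 2 : ℝ) • ((-2 * (τ ⬝ᵥ y)) • D.projG1 X) := by module
    rw [h4, ← hcl]
    module
  simp only [lie_neg, map_neg, lie_smul, smul_lie, add_lie] at hss ⊢
  linear_combination (norm := module) h11 + hss + hs1

end FiniteDimensional

end ThreeSasakianData

/-! ### The Lie derivative of a vector field -/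

section EuclideanLieDerivative

open Filter Topology

/-- The coordinate computation behind `hasDerivAt_pullback_family`: the derivative of the pullback
of a vector field along a one-parameter family of maps is a Lie bracket, by the symmetry of second
derivatives. -/
theorem hasDerivAt_of_fderiv_apply_eq {E : Type*} [NormedAddCommGroup E] [NormedSpace ℝ E]
    [CompleteSpace E] {F : ℝ × E → E} {z₀ : E} (hF : ContDiffAt ℝ 2 F (0, z₀))
    (hid : ∀ᶠ z in 𝓝 z₀, F (0, z) = z) {κ η : E → E} (hη : DifferentiableAt ℝ η z₀)
    (hκ : ∀ᶠ z in 𝓝 z₀, κ z = fderiv ℝ F (0, z) (1, 0)) {w : ℝ → E}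
    (hw : ∀ᶠ t in 𝓝 (0 : ℝ), fderiv ℝ F (t, z₀) (0, w t) = η (F (t, z₀))) :
    HasDerivAt w (lieBracket ℝ κ η z₀) 0 := by
  have hsymm := hF.isSymmSndFDerivAt (by simp)
  have hF1 : DifferentiableAt ℝ (fderiv ℝ F) (0, z₀) :=
    (hF.fderiv_right (m := 1) (by norm_num)).differentiableAt one_ne_zero
  have hF0 : DifferentiableAt ℝ F (0, z₀) := hF.differentiableAt two_ne_zero
  -- the derivative in the second variable along `t ↦ (t, z₀)`
  let L : ℝ → E →L[ℝ] E := fun t => (fderiv ℝ F (t, z₀)).comp (ContinuousLinearMap.inr ℝ ℝ E)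
  have hline : HasDerivAt (fun t : ℝ => (t, z₀)) ((1 : ℝ), (0 : E)) 0 :=
    (hasDerivAt_id 0).prodMk (hasDerivAt_const 0 z₀)
  have hL : HasDerivAt L ((fderiv ℝ (fderiv ℝ F) (0, z₀) (1, 0)).comp
      (ContinuousLinearMap.inr ℝ ℝ E)) 0 := by
    have h1 : HasDerivAt (fun t : ℝ => fderiv ℝ F (t, z₀))
        (fderiv ℝ (fderiv ℝ F) (0, z₀) (1, 0)) 0 :=
      hF1.hasFDerivAt.comp_hasDerivAt (0 : ℝ) hline
    simpa using h1.clm_comp (hasDerivAt_const (0 : ℝ) (ContinuousLinearMap.inr ℝ ℝ E))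
  have hL0 : L 0 = ContinuousLinearMap.id ℝ E := by
    have h1 : HasFDerivAt (fun z : E => F (0, z)) (L 0) z₀ :=
      hF0.hasFDerivAt.comp z₀ (hasFDerivAt_prodMk_right (0 : ℝ) z₀)
    have h2 : HasFDerivAt (fun z : E => F (0, z)) (ContinuousLinearMap.id ℝ E) z₀ :=
      (hasFDerivAt_id z₀).congr_of_eventuallyEq hid
    exact h1.unique h2
  have hu : HasDerivAt (fun t => η (F (t, z₀))) (fderiv ℝ η z₀ (fderiv ℝ F (0, z₀) (1, 0))) 0 := by
    have h1 : HasDerivAt (fun t => F (t, z₀)) (fderiv ℝ F (0, z₀) (1, 0)) 0 :=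
      hF0.hasFDerivAt.comp_hasDerivAt (0 : ℝ) hline
    have h2 : HasFDerivAt η (fderiv ℝ η z₀) (F (0, z₀)) := by
      rw [hid.self_of_nhds]; exact hη.hasFDerivAt
    exact h2.comp_hasDerivAt (0 : ℝ) h1
  have hLw : ∀ᶠ t in 𝓝 (0 : ℝ), L t (w t) = η (F (t, z₀)) := by
    filter_upwards [hw] with t ht
    rw [← ht]; rfl
  have hinv : ∀ᶠ t in 𝓝 (0 : ℝ), L t ∈ Set.range ((↑) : (E ≃L[ℝ] E) → E →L[ℝ] E) := by
    have : Set.range ((↑) : (E ≃L[ℝ] E) → E →L[ℝ] E) ∈ 𝓝 (L 0) := by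
      rw [hL0]; exact ContinuousLinearEquiv.nhds (ContinuousLinearEquiv.refl ℝ E)
    exact hL.continuousAt this
  -- `w` is differentiable since `L t` is invertible for small `t`
  have hwd : DifferentiableAt ℝ w 0 := by
    have hI : DifferentiableAt ℝ (ContinuousLinearMap.inverse : (E →L[ℝ] E) → E →L[ℝ] E) (L 0) := by
      rw [hL0]
      exact (contDiffAt_map_inverse (n := 1) (ContinuousLinearEquiv.refl ℝ E)).differentiableAt
        one_ne_zero
    have h1 : DifferentiableAt ℝ (fun t => (L t).inverse (η (F (t, z₀)))) 0 :=
      (hI.comp 0 hL.differentiableAt).clm_apply hu.differentiableAt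
    refine h1.congr_of_eventuallyEq ?_
    filter_upwards [hLw, hinv] with t ht ⟨e, he⟩
    rw [← ht, ← he]
    simp
  have hw0 : w 0 = η z₀ := by
    have := hLw.self_of_nhds
    rw [hL0, hid.self_of_nhds] at this
    exact this
  -- differentiate `L t (w t) = η (F (t, z₀))` at `0`
  have hprod := (hL.clm_apply hwd.hasDerivAt).unique (hu.congr_of_eventuallyEq hLw)
  rw [hL0, hw0] at hprod
  have hκd : fderiv ℝ κ z₀ = ((fderiv ℝ (fderiv ℝ F) (0, z₀)).comp
      (ContinuousLinearMap.inr ℝ ℝ E)).flip (1, 0) := by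
    have h1 : HasFDerivAt (fun z : E => fderiv ℝ F (0, z)) ((fderiv ℝ (fderiv ℝ F) (0, z₀)).comp
        (ContinuousLinearMap.inr ℝ ℝ E)) z₀ :=
      hF1.hasFDerivAt.comp z₀ (hasFDerivAt_prodMk_right (0 : ℝ) z₀)
    have h2 := h1.clm_apply (hasFDerivAt_const ((1 : ℝ), (0 : E)) z₀)
    rw [(h2.congr_of_eventuallyEq hκ).fderiv]
    simp
  have hderiv : deriv w 0 = lieBracket ℝ κ η z₀ := by
    have hs := hsymm (1, 0) (0, η z₀)
    simp only [lieBracket_eq, hκd, hκ.self_of_nhds]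
    simp only [ContinuousLinearMap.comp_apply, ContinuousLinearMap.inr_apply,
      ContinuousLinearMap.id_apply, ContinuousLinearMap.flip_apply] at hprod ⊢
    rw [hs] at hprod
    rw [← hprod]; abel
  rw [← hderiv]
  exact hwd.hasDerivAt

end EuclideanLieDerivative

section ManifoldLieDerivative

open Filter Topology

variable {E : Type*} [NormedAddCommGroup E] [NormedSpace ℝ E]
  {H : Type*} [TopologicalSpace H] {I : ModelWithCorners ℝ E H}
  {M : Type*} [TopologicalSpace M] [ChartedSpace H M]
  {E' : Type*} [NormedAddCommGroup E'] [NormedSpace ℝ E']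
  {H' : Type*} [TopologicalSpace H'] {I' : ModelWithCorners ℝ E' H'}
  {M' : Type*} [TopologicalSpace M'] [ChartedSpace H' M']
  {E'' : Type*} [NormedAddCommGroup E''] [NormedSpace ℝ E'']
  {H'' : Type*} [TopologicalSpace H''] {I'' : ModelWithCorners ℝ E'' H''}
  {M'' : Type*} [TopologicalSpace M''] [ChartedSpace H'' M'']

variable (I I') in
/-- The differential of a map of manifolds at a point, as a map of the model vector spaces. All
tangent spaces are copies of the model space, and forgetting the base points makes it possible to
compare differentials at points which are only propositionally equal. -/
noncomputable def mdiff (f : M → M') (x : M) : E →L[ℝ] E' := mfderiv I I' f x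

theorem mdiff_comp (x : M) {g : M' → M''} {f : M → M'} (hg : MDifferentiableAt I' I'' g (f x))
    (hf : MDifferentiableAt I I' f x) :
    mdiff I I'' (fun y => g (f y)) x = (mdiff I' I'' g (f x)).comp (mdiff I I' f x) :=
  mfderiv_comp x hg hf

theorem mdiff_comp_apply (x : M) {g : M' → M''} {f : M → M'}
    (hg : MDifferentiableAt I' I'' g (f x)) (hf : MDifferentiableAt I I' f x) (v : E) :
    mdiff I I'' (fun y => g (f y)) x v = mdiff I' I'' g (f x) (mdiff I I' f x v) := by
  rw [mdiff_comp x hg hf]; rfl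

theorem mdiff_id (x : M) : mdiff I I (fun y => y) x = ContinuousLinearMap.id ℝ E := mfderiv_id

theorem mdiff_const (x : M) (c : M') : mdiff I I' (fun _ : M => c) x = 0 := mfderiv_const

theorem mdiff_congr {f g : M → M'} {x : M} (h : f =ᶠ[𝓝 x] g) : mdiff I I' f x = mdiff I I' g x :=
  h.mfderiv_eq

theorem mdiff_eq_fderiv (f : E → E') (x : E) : mdiff 𝓘(ℝ, E) 𝓘(ℝ, E') f x = fderiv ℝ f x :=
  mfderiv_eq_fderiv

variable [IsManifold I ∞ M]

theorem mdiff_extChartAt_self (p : M) :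
    mdiff I 𝓘(ℝ, E) (extChartAt I p) p = ContinuousLinearMap.id ℝ E := by
  have h1 := (hasMFDerivAt_extChartAt (I := I) (mem_chart_source H p)).mfderiv
  have h2 := mfderiv_chartAt_eq_tangentCoordChange (I := I) (mem_chart_source H p)
  have h3 : mdiff I 𝓘(ℝ, E) (extChartAt I p) p = tangentCoordChange I p p p := h1.trans h2
  rw [h3]
  ext v
  exact tangentCoordChange_self (mem_extChartAt_source p)

variable [I.Boundaryless]

theorem mdifferentiableAt_extChartAt_symm (p : M) {z : E} (hz : z ∈ (extChartAt I p).target) :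
    MDifferentiableAt 𝓘(ℝ, E) I (extChartAt I p).symm z := by
  have h := mdifferentiableWithinAt_extChartAt_symm hz
  rwa [I.range_eq_univ, mdifferentiableWithinAt_univ] at h

theorem mdiff_extChartAt_symm_comp (p : M) {z : E} (hz : z ∈ (extChartAt I p).target) :
    (mdiff 𝓘(ℝ, E) I (extChartAt I p).symm z).comp
      (mdiff I 𝓘(ℝ, E) (extChartAt I p) ((extChartAt I p).symm z)) =
      ContinuousLinearMap.id ℝ E := by
  have h := mfderivWithin_extChartAt_symm_comp_mfderiv_extChartAt (I := I) hz
  rwa [I.range_eq_univ, mfderivWithin_univ] at h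

theorem mdiff_extChartAt_comp_symm (p : M) {z : E} (hz : z ∈ (extChartAt I p).target) :
    (mdiff I 𝓘(ℝ, E) (extChartAt I p) ((extChartAt I p).symm z)).comp
      (mdiff 𝓘(ℝ, E) I (extChartAt I p).symm z) = ContinuousLinearMap.id ℝ E := by
  have h := mfderiv_extChartAt_comp_mfderivWithin_extChartAt_symm (I := I) hz
  rwa [I.range_eq_univ, mfderivWithin_univ] at h

theorem mpullbackWithin_extChartAt_symm (p : M) (Y : Π q : M, TangentSpace I q) {z : E}
    (hz : z ∈ (extChartAt I p).target) :
    (mpullbackWithin 𝓘(ℝ, E) I (extChartAt I p).symm Y (Set.range I) z : E) =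
      mdiff I 𝓘(ℝ, E) (extChartAt I p) ((extChartAt I p).symm z) (Y ((extChartAt I p).symm z)) := by
  have h : (mdiff 𝓘(ℝ, E) I (extChartAt I p).symm z).inverse =
      mdiff I 𝓘(ℝ, E) (extChartAt I p) ((extChartAt I p).symm z) :=
    ContinuousLinearMap.inverse_eq (mdiff_extChartAt_symm_comp p hz)
      (mdiff_extChartAt_comp_symm p hz)
  rw [← h, I.range_eq_univ, mpullbackWithin_univ]
  rfl

/-- The Lie derivative of a vector field `Y` along the velocity field `K` of a one-parameter family
of maps `A t` with `A 0 = id` is the Lie bracket: if `W t` is the pullback of `Y` by `A t` at a point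
`p`, then `W'(0) = [K, Y]`. The family need not be a flow. -/
theorem hasDerivAt_pullback_family [CompleteSpace E] {A : ℝ → M → M} {p : M}
    (hA : ContMDiff (𝓘(ℝ, ℝ).prod I) I ∞ (fun x : ℝ × M => A x.1 x.2))
    (hA0 : ∀ q, A 0 q = q) {K Y : Π q : M, TangentSpace I q}
    (hK : ∀ q, mdiff 𝓘(ℝ, ℝ) I (fun t => A t q) 0 1 = K q)
    (hY : MDifferentiableAt I I.tangent (fun q => (⟨q, Y q⟩ : TangentBundle I M)) p)
    {W : ℝ → E} (hW : ∀ t, mdiff I I (A t) p (W t) = Y (A t p)) :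
    HasDerivAt W (mlieBracket I K Y p : E) 0 := by
  let φ := extChartAt I p
  let F : ℝ × E → E := fun x => φ (A x.1 (φ.symm x.2))
  have hp : φ.symm (φ p) = p := extChartAt_to_inv p
  have htgt : φ.target ∈ 𝓝 (φ p) := extChartAt_target_mem_nhds p
  have hsrc : φ.source ∈ 𝓝 p := extChartAt_source_mem_nhds p
  have hAt : ∀ t q, MDifferentiableAt I I (A t) q := fun t q =>
    (hA.comp (contMDiff_const.prodMk contMDiff_id)).mdifferentiableAt (by simp)
  have hAq : ∀ t q, MDifferentiableAt 𝓘(ℝ, ℝ) I (fun s => A s q) t := fun t q =>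
    (hA.comp (contMDiff_id.prodMk contMDiff_const)).mdifferentiableAt (by simp)
  have hFs : ContMDiffAt (𝓘(ℝ, ℝ).prod 𝓘(ℝ, E)) 𝓘(ℝ, E) ∞ F (0, φ p) := by
    have h1 : ContMDiffAt (𝓘(ℝ, ℝ).prod 𝓘(ℝ, E)) I ∞ (fun x : ℝ × E => φ.symm x.2) (0, φ p) := by
      have := (contMDiffOn_extChartAt_symm (I := I) (n := ∞) p).contMDiffAt htgt
      exact this.comp (0, φ p) contMDiffAt_snd
    have h2 : ContMDiffAt (𝓘(ℝ, ℝ).prod 𝓘(ℝ, E)) I ∞ (fun x : ℝ × E => A x.1 (φ.symm x.2))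
        (0, φ p) := hA.contMDiffAt.comp (0, φ p) (contMDiffAt_fst.prodMk h1)
    have h3 : ContMDiffAt I 𝓘(ℝ, E) ∞ φ (A 0 (φ.symm (φ p))) := by
      rw [hA0, hp]; exact contMDiffAt_extChartAt
    exact h3.comp (0, φ p) h2
  have hF : ContDiffAt ℝ ∞ F (0, φ p) := by
    rw [← modelWithCornersSelf_prod, chartedSpaceSelf_prod] at hFs
    exact hFs.contDiffAt
  have hFd : ∀ᶠ x in 𝓝 ((0 : ℝ), φ p), DifferentiableAt ℝ F x := by
    have h1 : ContDiffAt ℝ 1 F (0, φ p) := hF.of_le (by norm_cast)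
    filter_upwards [h1.eventually (by simp)] with x hx
    exact hx.differentiableAt one_ne_zero
  have hη := (MDifferentiableWithinAt.differentiableWithinAt_mpullbackWithin_vectorField
    (s := Set.univ) (hY.mdifferentiableWithinAt))
  rw [Set.preimage_univ, Set.univ_inter] at hη
  have hη' : DifferentiableAt ℝ
      (mpullbackWithin 𝓘(ℝ, E) I (extChartAt I p).symm Y (Set.range I) : E → E) (φ p) := by
    rw [I.range_eq_univ] at hη ⊢
    exact differentiableWithinAt_univ.1 hη
  have key : HasDerivAt W (lieBracket ℝ
      (mpullbackWithin 𝓘(ℝ, E) I (extChartAt I p).symm K (Set.range I) : E → E)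
      (mpullbackWithin 𝓘(ℝ, E) I (extChartAt I p).symm Y (Set.range I) : E → E) (φ p)) 0 := by
    refine hasDerivAt_of_fderiv_apply_eq (F := F) (hF.of_le (by norm_cast)) ?_ hη'
      ?_ ?_
    · filter_upwards [htgt] with z hz
      change φ (A 0 (φ.symm z)) = z
      rw [hA0, φ.right_inv hz]
    · have hc : Tendsto (fun z : E => ((0 : ℝ), z)) (𝓝 (φ p)) (𝓝 ((0 : ℝ), φ p)) :=
        (Continuous.prodMk_right (0 : ℝ)).continuousAt
      filter_upwards [htgt, hc.eventually hFd] with z hz hFz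
      rw [mpullbackWithin_extChartAt_symm p K hz]
      have hz' : φ.symm z ∈ (chartAt H p).source := by
        rw [← extChartAt_source (I := I)]; exact φ.map_target hz
      have hq : A 0 (φ.symm z) = φ.symm z := hA0 _
      have h1 : HasDerivAt (fun t : ℝ => F (t, z)) (fderiv ℝ F (0, z) (1, 0)) 0 :=
        HasFDerivAt.comp_hasDerivAt (f := fun t : ℝ => (t, z)) (0 : ℝ) hFz.hasFDerivAt
          ((hasDerivAt_id (0 : ℝ)).prodMk (hasDerivAt_const (0 : ℝ) z))
      have h2 : mdiff 𝓘(ℝ, ℝ) 𝓘(ℝ, E) (fun t : ℝ => F (t, z)) 0 1 =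
          mdiff I 𝓘(ℝ, E) φ (A 0 (φ.symm z)) (mdiff 𝓘(ℝ, ℝ) I (fun t => A t (φ.symm z)) 0 1) :=
        mdiff_comp_apply (g := φ) (f := fun t => A t (φ.symm z)) (0 : ℝ)
          (by rw [hq]; exact mdifferentiableAt_extChartAt hz') (hAq 0 _) 1
      rw [mdiff_eq_fderiv, hK, hq, h1.hasFDerivAt.fderiv] at h2
      rw [← h2]
      simp
    · have hcA : Tendsto (fun t : ℝ => A t p) (𝓝 0) (𝓝 p) := by
        have := (hAq 0 p).continuousAt
        rw [ContinuousAt, hA0] at this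
        exact this
      have hc : Tendsto (fun t : ℝ => (t, φ p)) (𝓝 (0 : ℝ)) (𝓝 ((0 : ℝ), φ p)) :=
        (Continuous.prodMk_left (φ p)).continuousAt
      filter_upwards [hcA.eventually hsrc, hc.eventually hFd] with t ht hFt
      have ht' : A t p ∈ (chartAt H p).source := by
        rw [← extChartAt_source (I := I)]; exact ht
      have e : F (t, φ p) = φ (A t p) := by
        change φ (A t (φ.symm (φ p))) = _
        rw [hp]
      have hsymm : mdiff 𝓘(ℝ, E) I φ.symm (φ p) = ContinuousLinearMap.id ℝ E := by
        have h := mdiff_extChartAt_symm_comp (I := I) p (mem_extChartAt_target p)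
        rw [extChartAt_to_inv, mdiff_extChartAt_self] at h
        exact h
      rw [e, mpullbackWithin_extChartAt_symm p Y (φ.map_source ht), φ.left_inv ht, ← hW]
      have h1 : fderiv ℝ (fun z => F (t, z)) (φ p) (W t) = fderiv ℝ F (t, φ p) (0, W t) := by
        have h : HasFDerivAt (fun z => F (t, z))
            ((fderiv ℝ F (t, φ p)).comp (ContinuousLinearMap.inr ℝ ℝ E)) (φ p) :=
          hFt.hasFDerivAt.comp (φ p) (hasFDerivAt_prodMk_right t (φ p))
        rw [h.fderiv]
        simp
      have hs := mdifferentiableAt_extChartAt_symm (I := I) p (mem_extChartAt_target p)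
      have h2 : mdiff 𝓘(ℝ, E) I (fun z => A t (φ.symm z)) (φ p) = mdiff I I (A t) p := by
        rw [mdiff_comp (g := A t) (f := φ.symm) (φ p) (hAt t _) hs, hsymm, hp]
        rfl
      have h3 : mdiff 𝓘(ℝ, E) 𝓘(ℝ, E) (fun z => F (t, z)) (φ p) (W t) =
          mdiff I 𝓘(ℝ, E) φ (A t (φ.symm (φ p)))
            (mdiff 𝓘(ℝ, E) I (fun z => A t (φ.symm z)) (φ p) (W t)) :=
        mdiff_comp_apply (g := φ) (f := fun z => A t (φ.symm z)) (φ p)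
          (by rw [hp]; exact mdifferentiableAt_extChartAt ht')
          ((hAt t _).comp (φ p) hs) _
      rw [mdiff_eq_fderiv, h1, h2, hp] at h3
      exact h3
  have hbr : (mlieBracket I K Y p : E) = lieBracket ℝ
      (mpullbackWithin 𝓘(ℝ, E) I (extChartAt I p).symm K (Set.range I) : E → E)
      (mpullbackWithin 𝓘(ℝ, E) I (extChartAt I p).symm Y (Set.range I) : E → E) (φ p) := by
    have h1 : (mlieBracket I K Y p : E) = (mdiff I 𝓘(ℝ, E) (extChartAt I p) p).inverse
        (lieBracketWithin ℝ
          (mpullbackWithin 𝓘(ℝ, E) I (extChartAt I p).symm K (Set.range I) : E → E)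
          (mpullbackWithin 𝓘(ℝ, E) I (extChartAt I p).symm Y (Set.range I) : E → E)
          ((extChartAt I p).symm ⁻¹' Set.univ ∩ Set.range I) (φ p)) := rfl
    rw [h1, mdiff_extChartAt_self, ContinuousLinearMap.inverse_id, Set.preimage_univ,
      Set.univ_inter, I.range_eq_univ]
    have h2 : ∀ a b : E → E, lieBracketWithin ℝ a b Set.univ = lieBracket ℝ a b :=
      fun _ _ => lieBracketWithin_univ
    exact congrFun (h2 _ _) _
  rw [hbr]
  exact key

end ManifoldLieDerivative

/-! ### Smooth curves and their velocities -/

section Curves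

open Filter Topology

variable {E : Type*} [NormedAddCommGroup E] [NormedSpace ℝ E]
  {H : Type*} [TopologicalSpace H] {I : ModelWithCorners ℝ E H}
  {M : Type*} [TopologicalSpace M] [ChartedSpace H M]
  {E' : Type*} [NormedAddCommGroup E'] [NormedSpace ℝ E']
  {H' : Type*} [TopologicalSpace H'] {I' : ModelWithCorners ℝ E' H'}
  {M' : Type*} [TopologicalSpace M'] [ChartedSpace H' M']
  {E'' : Type*} [NormedAddCommGroup E''] [NormedSpace ℝ E'']
  {H'' : Type*} [TopologicalSpace H''] {I'' : ModelWithCorners ℝ E'' H''}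
  {M'' : Type*} [TopologicalSpace M''] [ChartedSpace H'' M'']
  {F : Type*} [NormedAddCommGroup F] [NormedSpace ℝ F]
  {K : Type*} [TopologicalSpace K] {J : ModelWithCorners ℝ F K}
  {N : Type*} [TopologicalSpace N] [ChartedSpace K N]

theorem mdiff_comp_prod {f : M × M' → M''} {a : N → M} {b : N → M'} {x : N}
    (hf : MDifferentiableAt (I.prod I') I'' f (a x, b x)) (ha : MDifferentiableAt J I a x)
    (hb : MDifferentiableAt J I' b x) (v : F) :
    mdiff J I'' (fun y => f (a y, b y)) x v =
      mdiff I I'' (fun z => f (z, b x)) (a x) (mdiff J I a x v) +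
        mdiff I' I'' (fun z => f (a x, z)) (b x) (mdiff J I' b x v) := by
  have h1 : mdiff J I'' (fun y => f (a y, b y)) x v =
      mdiff (I.prod I') I'' f (a x, b x) (mdiff J (I.prod I') (fun y => (a y, b y)) x v) :=
    mdiff_comp_apply (g := f) (f := fun y => (a y, b y)) x hf (ha.prodMk hb) v
  have h2 : mdiff J (I.prod I') (fun y => (a y, b y)) x =
      (mdiff J I a x).prod (mdiff J I' b x) := mfderiv_prodMk ha hb
  have h3 : ∀ w : E × E', mdiff (I.prod I') I'' f (a x, b x) w =
      mdiff I I'' (fun z => f (z, b x)) (a x) w.1 + mdiff I' I'' (fun z => f (a x, z)) (b x) w.2 :=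
    fun w => mfderiv_prod_eq_add_apply hf
  rw [h1, h2, h3]
  rfl

/-- A line through an interior point of `U` can be reparametrized so that it stays in `U` and still
has the same velocity at the origin. -/
theorem exists_contDiff_reparam {z : E} {U : Set E} (hU : U ∈ 𝓝 z) (w : E) :
    ∃ s : ℝ → E, ContDiff ℝ ∞ s ∧ s 0 = z ∧ HasDerivAt s w 0 ∧
      ∀ t, s t ∈ U ∧ ∃ r : ℝ, s t = z + r • w := by
  have hline : Continuous fun s : ℝ => z + s • w := by fun_prop
  have hpre : (fun s : ℝ => z + s • w) ⁻¹' U ∈ 𝓝 (0 : ℝ) :=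
    hline.continuousAt (by simpa using hU)
  obtain ⟨ε, hε, hball⟩ := Metric.nhds_basis_closedBall.mem_iff.1 hpre
  refine ⟨fun t => z + (ε * Real.sin (t / ε)) • w, ?_, by simp, ?_, fun t => ⟨hball ?_, _, rfl⟩⟩
  · refine contDiff_const.add (ContDiff.smul (contDiff_const.mul (Real.contDiff_sin.comp ?_))
      contDiff_const)
    exact contDiff_id.div_const _
  · have h1 : HasDerivAt (fun t : ℝ => t / ε) (1 / ε) 0 := (hasDerivAt_id (0 : ℝ)).div_const ε
    have h2 := ((h1.sin.const_mul ε).smul_const w).const_add z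
    simpa [hε.ne'] using h2
  · rw [mem_closedBall_zero_iff, Real.norm_eq_abs, abs_mul, abs_of_pos hε]
    exact mul_le_of_le_one_right hε.le (Real.abs_sin_le_one _)

/-- Every tangent vector of a manifold without boundary is the velocity of a globally defined
smooth curve. -/
theorem exists_contMDiff_curve [IsManifold I ∞ M] [I.Boundaryless] (p : M) (v : E) :
    ∃ c : ℝ → M, ContMDiff 𝓘(ℝ, ℝ) I ∞ c ∧ c 0 = p ∧ mdiff 𝓘(ℝ, ℝ) I c 0 1 = v := by
  set φ := extChartAt I p
  obtain ⟨s, hsm, hs0, hsd, hmem⟩ := exists_contDiff_reparam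
    (extChartAt_target_mem_nhds (I := I) p) v
  have hds : MDifferentiableAt 𝓘(ℝ, E) I φ.symm (s 0) := by
    rw [hs0]; exact mdifferentiableAt_extChartAt_symm p (mem_extChartAt_target p)
  refine ⟨fun t => φ.symm (s t), ?_, by simp only [hs0]; exact extChartAt_to_inv p, ?_⟩
  · exact (contMDiffOn_extChartAt_symm p).comp_contMDiff hsm.contMDiff fun t => (hmem t).1
  · rw [mdiff_comp_apply (g := φ.symm) (f := s) 0 hds hsd.differentiableAt.mdifferentiableAt,
      mdiff_eq_fderiv, hsd.hasFDerivAt.fderiv, hs0]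
    have h := mdiff_extChartAt_symm_comp (I := I) p (mem_extChartAt_target p)
    rw [extChartAt_to_inv, mdiff_extChartAt_self] at h
    have h' : mdiff 𝓘(ℝ, E) I φ.symm (φ p) = ContinuousLinearMap.id ℝ E := h
    rw [h']
    simp

end Curves

/-! ### The adjoint representation -/

section LieGroupAd

variable {d : ℕ} {G : Type*} [TopologicalSpace G] [ChartedSpace (EuclideanSpace ℝ (Fin d)) G]
  [Group G]

theorem Ad_one (X : GroupLieAlgebra (𝓡 d) G) : Ad (1 : G) X = X := by
  have h : (fun x : G => 1 * x * 1⁻¹) = fun x => x := by funext x; simp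
  have h2 : mdiff (𝓡 d) (𝓡 d) (fun x : G => 1 * x * 1⁻¹) (1 : G) = ContinuousLinearMap.id ℝ _ := by
    rw [h]; exact mdiff_id _
  exact congrArg (fun L : EuclideanSpace ℝ (Fin d) →L[ℝ] EuclideanSpace ℝ (Fin d) => L X) h2

variable [LieGroup (𝓡 d) ∞ G]

theorem mdifferentiableAt_mulLeft (a x : G) : MDifferentiableAt (𝓡 d) (𝓡 d) (fun y : G => a * y) x :=
  (contMDiff_mul_left (I := 𝓡 d) (n := ∞)).mdifferentiableAt (by simp)

theorem mdifferentiableAt_mulRight (a x : G) :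
    MDifferentiableAt (𝓡 d) (𝓡 d) (fun y : G => y * a) x :=
  (contMDiff_mul_right (I := 𝓡 d) (n := ∞)).mdifferentiableAt (by simp)

theorem contMDiff_conj (a : G) : ContMDiff (𝓡 d) (𝓡 d) ∞ (fun x : G => a * x * a⁻¹) :=
  (contMDiff_mul_right (I := 𝓡 d) (n := ∞)).comp (contMDiff_mul_left (I := 𝓡 d) (n := ∞))

theorem mdifferentiableAt_conj (a x : G) :
    MDifferentiableAt (𝓡 d) (𝓡 d) (fun y : G => a * y * a⁻¹) x :=
  (contMDiff_conj a).mdifferentiableAt (by simp)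

theorem Ad_mul (a b : G) (X : GroupLieAlgebra (𝓡 d) G) : Ad (a * b) X = Ad a (Ad b X) := by
  have h : (fun x : G => a * b * x * (a * b)⁻¹) = fun x => a * (b * x * b⁻¹) * a⁻¹ := by
    funext x; group
  have h2 : mdiff (𝓡 d) (𝓡 d) (fun x : G => a * b * x * (a * b)⁻¹) (1 : G) X =
      mdiff (𝓡 d) (𝓡 d) (fun x : G => a * x * a⁻¹) (b * 1 * b⁻¹)
        (mdiff (𝓡 d) (𝓡 d) (fun x : G => b * x * b⁻¹) 1 X) := by
    rw [h]
    exact mdiff_comp_apply (g := fun x : G => a * x * a⁻¹) (f := fun x : G => b * x * b⁻¹) (1 : G)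
      (mdifferentiableAt_conj a _) (mdifferentiableAt_conj b _) X
  rw [mul_one, mul_inv_cancel] at h2
  exact h2

theorem Ad_inv_Ad (a : G) (X : GroupLieAlgebra (𝓡 d) G) : Ad a⁻¹ (Ad a X) = X := by
  rw [← Ad_mul, inv_mul_cancel, Ad_one]

theorem Ad_Ad_inv (a : G) (X : GroupLieAlgebra (𝓡 d) G) : Ad a (Ad a⁻¹ X) = X := by
  rw [← Ad_mul, mul_inv_cancel, Ad_one]

/-- Conjugation of curves through the identity is the adjoint representation on velocities. -/
theorem mdiff_conj_curve (a : G) {c : ℝ → G} (hc : ContMDiff 𝓘(ℝ, ℝ) (𝓡 d) ∞ c) (hc0 : c 0 = 1) :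
    mdiff 𝓘(ℝ, ℝ) (𝓡 d) (fun t => a * c t * a⁻¹) 0 1 =
      (Ad a (mdiff 𝓘(ℝ, ℝ) (𝓡 d) c 0 1 : EuclideanSpace ℝ (Fin d)) : EuclideanSpace ℝ (Fin d)) := by
  have h := mdiff_comp_apply (g := fun x : G => a * x * a⁻¹) (f := c) (I := 𝓘(ℝ, ℝ)) (I' := 𝓡 d)
    (I'' := 𝓡 d) (0 : ℝ) (mdifferentiableAt_conj a _) (hc.mdifferentiableAt (by simp)) 1
  rw [hc0] at h
  exact h

/-- The differential of the adjoint representation is the bracket of the Lie algebra. -/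
theorem hasDerivAt_Ad {c : ℝ → G} (hc : ContMDiff 𝓘(ℝ, ℝ) (𝓡 d) ∞ c) (hc0 : c 0 = 1)
    {X : GroupLieAlgebra (𝓡 d) G} (hX : mdiff 𝓘(ℝ, ℝ) (𝓡 d) c 0 1 = X)
    (Y : GroupLieAlgebra (𝓡 d) G) :
    HasDerivAt (F := EuclideanSpace ℝ (Fin d)) (fun t => (Ad (c t) Y : EuclideanSpace ℝ (Fin d)))
      (⁅X, Y⁆ : GroupLieAlgebra (𝓡 d) G) 0 := by
  refine hasDerivAt_pullback_family (I := 𝓡 d) (A := fun t (x : G) => x * c t) (p := (1 : G))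
    (K := mulInvariantVectorField X) (Y := mulInvariantVectorField Y) ?_ ?_ ?_ ?_ ?_
  · exact contMDiff_snd.mul (hc.comp contMDiff_fst)
  · intro q; rw [hc0, mul_one]
  · intro q
    have h := mdiff_comp_apply (g := fun x : G => q * x) (f := c) (I := 𝓘(ℝ, ℝ)) (I' := 𝓡 d)
      (I'' := 𝓡 d) (0 : ℝ) (mdifferentiableAt_mulLeft q _) (hc.mdifferentiableAt (by simp)) 1
    rw [hc0, hX] at h
    exact h
  · have : LieGroup (𝓡 d) (minSmoothness ℝ 3) G := inferInstance
    exact mdifferentiableAt_mulInvariantVectorField Y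
  · -- right translation by `a` after conjugation by `a` is left translation by `a`
    intro t
    have h := mdiff_comp_apply (g := fun x : G => x * c t) (f := fun x : G => c t * x * (c t)⁻¹)
      (I := 𝓡 d) (I' := 𝓡 d) (I'' := 𝓡 d) (1 : G) (mdifferentiableAt_mulRight _ _)
      (mdifferentiableAt_conj _ _) Y
    have e : (fun x : G => c t * x * (c t)⁻¹ * c t) = fun x => c t * x := by funext x; group
    rw [e, mul_one, mul_inv_cancel] at h
    rw [one_mul]
    exact h.symm

/-- The adjoint representation preserves brackets: both sides are the derivative of
`Ad a (Ad (c t) Y) = Ad (a c(t) a⁻¹) (Ad a Y)` for a curve `c` with velocity `X`. -/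
theorem Ad_lie (a : G) (X Y : GroupLieAlgebra (𝓡 d) G) : Ad a ⁅X, Y⁆ = ⁅Ad a X, Ad a Y⁆ := by
  obtain ⟨c, hc, hc0, hcX⟩ := exists_contMDiff_curve (I := 𝓡 d) (1 : G) X
  have h1 := hasDerivAt_Ad hc hc0 hcX Y
  have h2 : HasDerivAt (F := EuclideanSpace ℝ (Fin d))
      (fun t => (Ad (a * c t * a⁻¹) (Ad a Y) : EuclideanSpace ℝ (Fin d)))
      (⁅Ad a X, Ad a Y⁆ : GroupLieAlgebra (𝓡 d) G) 0 := by
    refine hasDerivAt_Ad ((contMDiff_conj a).comp hc) (by simp [hc0]) ?_ (Ad a Y)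
    have := mdiff_conj_curve a hc hc0
    rw [hcX] at this
    exact this
  have h3 : HasDerivAt (F := EuclideanSpace ℝ (Fin d))
      (fun t => (Ad a (Ad (c t) Y) : EuclideanSpace ℝ (Fin d))) (Ad a ⁅X, Y⁆) 0 :=
    HasFDerivAt.comp_hasDerivAt (0 : ℝ)
      (mdiff (𝓡 d) (𝓡 d) (fun x : G => a * x * a⁻¹) 1).hasFDerivAt h1
  have e : (fun t => (Ad (a * c t * a⁻¹) (Ad a Y) : EuclideanSpace ℝ (Fin d))) =
      fun t => (Ad a (Ad (c t) Y) : EuclideanSpace ℝ (Fin d)) := by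
    funext t
    rw [← Ad_mul, ← Ad_mul, inv_mul_cancel_right]
  rw [e] at h2
  exact HasDerivAt.unique (F := EuclideanSpace ℝ (Fin d)) h3 h2

/-- The adjoint representation, by automorphisms of the Lie algebra. -/
noncomputable def AdEquiv (a : G) : GroupLieAlgebra (𝓡 d) G ≃ₗ⁅ℝ⁆ GroupLieAlgebra (𝓡 d) G where
  toFun := Ad a
  invFun := Ad a⁻¹
  map_add' := map_add (Ad a)
  map_smul' := map_smul (Ad a)
  map_lie' := Ad_lie a _ _
  left_inv := Ad_inv_Ad a
  right_inv := Ad_Ad_inv a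

theorem mdiff_inv_curve {c : ℝ → G} (hc : ContMDiff 𝓘(ℝ, ℝ) (𝓡 d) ∞ c) (hc0 : c 0 = 1) :
    mdiff 𝓘(ℝ, ℝ) (𝓡 d) (fun t => (c t)⁻¹) 0 1 = -mdiff 𝓘(ℝ, ℝ) (𝓡 d) c 0 1 := by
  have hci : ContMDiff 𝓘(ℝ, ℝ) (𝓡 d) ∞ (fun t => (c t)⁻¹) := hc.inv
  have h := mdiff_comp_prod (f := fun x : G × G => x.1 * x.2) (a := c) (b := fun t => (c t)⁻¹)
    (I := 𝓡 d) (I' := 𝓡 d) (I'' := 𝓡 d) (J := 𝓘(ℝ, ℝ)) (x := (0 : ℝ))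
    ((contMDiff_mul (𝓡 d) ∞).mdifferentiableAt (by simp)) (hc.mdifferentiableAt (by simp))
    (hci.mdifferentiableAt (by simp)) 1
  have e1 : (fun t => c t * (c t)⁻¹) = fun _ => (1 : G) := by funext t; simp
  simp only [e1, hc0, inv_one, mul_one, one_mul] at h
  rw [mdiff_const, mdiff_id] at h
  exact (neg_eq_of_add_eq_zero_right h.symm).symm

end LieGroupAd

/-! ### Submersions -/

section Submersion

open Filter Topology

universe u

variable {E : Type u} [NormedAddCommGroup E] [NormedSpace ℝ E]
  {H : Type*} [TopologicalSpace H] {I : ModelWithCorners ℝ E H}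
  {M : Type*} [TopologicalSpace M] [ChartedSpace H M]
  {E' : Type*} [NormedAddCommGroup E'] [NormedSpace ℝ E']
  {H' : Type*} [TopologicalSpace H'] {I' : ModelWithCorners ℝ E' H'}
  {M' : Type*} [TopologicalSpace M'] [ChartedSpace H' M']
  {f : M → M'} {x : M}

theorem contMDiffOn_extend_symm_target {e : OpenPartialHomeomorph M H}
    (he : e ∈ IsManifold.maximalAtlas I ∞ M) :
    ContMDiffOn 𝓘(ℝ, E) I ∞ (e.extend I).symm (e.extend I).target := by
  rw [e.extend_target']
  exact contMDiffOn_extend_symm he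

variable [I.Boundaryless]

omit [ChartedSpace H M] in
theorem OpenPartialHomeomorph.extend_target_mem_nhds {e : OpenPartialHomeomorph M H}
    (hx : x ∈ e.source) : (e.extend I).target ∈ 𝓝 (e.extend I x) := by
  rw [← PartialEquiv.image_source_eq_target]
  exact e.extend_image_nhds_mem_nhds_of_boundaryless hx (e.extend_source_mem_nhds hx)

/-- A submersion has smooth local sections through every point of its domain. -/
theorem Manifold.IsSubmersionAt.exists_section (h : IsSubmersionAt I I' ∞ f x) :
    ∃ σ : M' → M, ContMDiffAt I' I ∞ σ (f x) ∧ σ (f x) = x ∧ ∀ᶠ y in 𝓝 (f x), f (σ y) = y := by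
  obtain ⟨F, _, _, h⟩ := h
  set φ := h.domChart.extend I with hφ
  set χ := h.codChart.extend I' with hχ
  have hxφ : x ∈ φ.source := by rw [hφ, OpenPartialHomeomorph.extend_source]; exact h.mem_domChart_source
  have hxχ : f x ∈ χ.source := by rw [hχ, OpenPartialHomeomorph.extend_source]; exact h.mem_codChart_source
  let s : M' → E := fun y => h.equiv.symm (χ y, (h.equiv (φ x)).2)
  have hs0 : s (f x) = φ x := by
    have h1 : χ (f (φ.symm (φ x))) = (h.equiv (φ x)).1 := h.writtenInCharts (φ.map_source hxφ)
    rw [φ.left_inv hxφ] at h1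
    simp only [s, h1]
    exact h.equiv.symm_apply_apply _
  have hχs : ContMDiffAt I' 𝓘(ℝ, E') ∞ χ (f x) :=
    (OpenPartialHomeomorph.contMDiffOn_extend h.codChart_mem_maximalAtlas).contMDiffAt
      (h.codChart.open_source.mem_nhds h.mem_codChart_source)
  have hss : ContMDiffAt I' 𝓘(ℝ, E) ∞ s (f x) := by
    have h1 : ContDiff ℝ ∞ fun w : E' => h.equiv.symm (w, (h.equiv (φ x)).2) :=
      h.equiv.symm.contDiff.comp (contDiff_id.prodMk contDiff_const)
    exact h1.contMDiff.contMDiffAt.comp (f x) hχs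
  have htgt : φ.target ∈ 𝓝 (φ x) := h.domChart.extend_target_mem_nhds h.mem_domChart_source
  refine ⟨fun y => φ.symm (s y), ?_, ?_, ?_⟩
  · have h1 : ContMDiffAt 𝓘(ℝ, E) I ∞ φ.symm (s (f x)) := by
      rw [hs0]
      exact (contMDiffOn_extend_symm_target h.domChart_mem_maximalAtlas).contMDiffAt htgt
    exact h1.comp (f x) hss
  · simp only [hs0]
    exact φ.left_inv hxφ
  · have hc : Tendsto s (𝓝 (f x)) (𝓝 (φ x)) := by
      have := hss.continuousAt
      rwa [ContinuousAt, hs0] at this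
    filter_upwards [hc.eventually htgt,
      h.codChart.open_source.mem_nhds h.mem_codChart_source] with y hy hy'
    have h1 : χ (f (φ.symm (s y))) = (h.equiv (s y)).1 := h.writtenInCharts hy
    have h2 : (h.equiv (s y)).1 = χ y := by simp [s]
    have h3 : f (φ.symm (s y)) ∈ h.codChart.source := by
      have := φ.map_target hy
      rw [hφ, OpenPartialHomeomorph.extend_source] at this
      exact h.source_subset_preimage_source this
    refine χ.injOn ?_ ?_ (h1.trans h2)
    · rw [hχ, OpenPartialHomeomorph.extend_source]; exact h3
    · rw [hχ, OpenPartialHomeomorph.extend_source]; exact hy'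

/-- Around each point of its domain, a submersion has a chart in which its fibres are affine
subspaces. -/
theorem Manifold.IsSubmersionAt.exists_chart (h : IsSubmersionAt I I' ∞ f x) :
    ∃ (φ : PartialEquiv M E) (L : E →L[ℝ] E'), φ.source ∈ 𝓝 x ∧ φ.target ∈ 𝓝 (φ x) ∧
      ContMDiffOn I 𝓘(ℝ, E) ∞ φ φ.source ∧ ContMDiffOn 𝓘(ℝ, E) I ∞ φ.symm φ.target ∧
      (∀ y ∈ φ.source, ∀ y' ∈ φ.source, L (φ y) = L (φ y') ↔ f y = f y') ∧
      ∀ v : E, mdiff I I' f x v = 0 → L (mdiff I 𝓘(ℝ, E) φ x v) = 0 := by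
  have hf : MDifferentiableAt I I' f x := h.contMDiffAt.mdifferentiableAt (by simp)
  obtain ⟨F, _, _, h⟩ := h
  set φ := h.domChart.extend I with hφ
  set χ := h.codChart.extend I' with hχ
  have hφs : φ.source = h.domChart.source := OpenPartialHomeomorph.extend_source _
  have hχs : χ.source = h.codChart.source := OpenPartialHomeomorph.extend_source _
  let L : E →L[ℝ] E' := (ContinuousLinearMap.fst ℝ E' F).comp (h.equiv : E →L[ℝ] E' × F)
  have hL : ∀ y ∈ φ.source, χ (f y) = L (φ y) := fun y hy => by
    have h1 : χ (f (φ.symm (φ y))) = (h.equiv (φ y)).1 := h.writtenInCharts (φ.map_source hy)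
    rwa [φ.left_inv hy] at h1
  have hfs : ∀ y ∈ φ.source, f y ∈ χ.source := fun y hy => by
    rw [hχs]; rw [hφs] at hy; exact h.source_subset_preimage_source hy
  have hnx : φ.source ∈ 𝓝 x := by
    rw [hφs]; exact h.domChart.open_source.mem_nhds h.mem_domChart_source
  have hφc : ContMDiffOn I 𝓘(ℝ, E) ∞ φ φ.source := by
    rw [hφs]; exact OpenPartialHomeomorph.contMDiffOn_extend h.domChart_mem_maximalAtlas
  refine ⟨φ, L, hnx, h.domChart.extend_target_mem_nhds h.mem_domChart_source,
    hφc, contMDiffOn_extend_symm_target h.domChart_mem_maximalAtlas, ?_, ?_⟩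
  · intro y hy y' hy'
    rw [← hL y hy, ← hL y' hy']
    exact ⟨fun e => χ.injOn (hfs y hy) (hfs y' hy') e, fun e => by rw [e]⟩
  · intro v hv
    have hχd : MDifferentiableAt I' 𝓘(ℝ, E') χ (f x) :=
      ((OpenPartialHomeomorph.contMDiffOn_extend h.codChart_mem_maximalAtlas).contMDiffAt
        (h.codChart.open_source.mem_nhds h.mem_codChart_source)).mdifferentiableAt (by simp)
    have hφd : MDifferentiableAt I 𝓘(ℝ, E) φ x := (hφc.contMDiffAt hnx).mdifferentiableAt (by simp)
    have e : (fun y => χ (f y)) =ᶠ[𝓝 x] fun y => L (φ y) := by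
      filter_upwards [hnx] with y hy using hL y hy
    have h1 := mdiff_congr (I := I) (I' := 𝓘(ℝ, E')) e
    have h2 := mdiff_comp_apply (g := χ) (f := f) (I'' := 𝓘(ℝ, E')) x hχd hf v
    have h3 := mdiff_comp_apply (g := L) (f := φ) (I'' := 𝓘(ℝ, E')) x
      L.differentiableAt.mdifferentiableAt hφd v
    rw [h1, h3, mdiff_eq_fderiv, L.fderiv, hv, map_zero] at h2
    exact h2

/-- The kernel of the differential of a submersion consists of velocities of curves in the fibre. -/
theorem Manifold.IsSubmersionAt.exists_curve_velocity (h : IsSubmersionAt I I' ∞ f x) {v : E}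
    (hv : mdiff I I' f x v = 0) :
    ∃ c : ℝ → M, ContMDiff 𝓘(ℝ, ℝ) I ∞ c ∧ c 0 = x ∧ mdiff 𝓘(ℝ, ℝ) I c 0 1 = v ∧
      ∀ t, f (c t) = f x := by
  obtain ⟨φ, L, hs, ht, hφ, hφs, hL, hLv⟩ := h.exists_chart
  have hx : x ∈ φ.source := mem_of_mem_nhds hs
  obtain ⟨s, hsm, hs0, hsd, hmem⟩ := exists_contDiff_reparam ht (mdiff I 𝓘(ℝ, E) φ x v)
  have hφd : MDifferentiableAt I 𝓘(ℝ, E) φ x := (hφ.contMDiffAt hs).mdifferentiableAt (by simp)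
  have hψd : MDifferentiableAt 𝓘(ℝ, E) I φ.symm (φ x) :=
    (hφs.contMDiffAt ht).mdifferentiableAt (by simp)
  refine ⟨fun t => φ.symm (s t), ?_, by simp only [hs0]; exact φ.left_inv hx, ?_, fun t => ?_⟩
  · exact hφs.comp_contMDiff hsm.contMDiff fun t => (hmem t).1
  · have e : (fun y => φ.symm (φ y)) =ᶠ[𝓝 x] fun y => y := by
      filter_upwards [hs] with y hy using φ.left_inv hy
    have h1 := mdiff_comp_apply (g := φ.symm) (f := φ) (I'' := I) x hψd hφd v
    rw [mdiff_congr e, mdiff_id] at h1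
    rw [mdiff_comp_apply (g := φ.symm) (f := s) 0 (by rw [hs0]; exact hψd)
      hsd.differentiableAt.mdifferentiableAt, mdiff_eq_fderiv, hsd.hasFDerivAt.fderiv, hs0]
    simpa using h1.symm
  · obtain ⟨h1, r, hr⟩ := hmem t
    refine (hL _ (φ.map_target h1) _ hx).1 ?_
    rw [φ.right_inv h1, hr, map_add, map_smul, hLv v hv, smul_zero, add_zero]

/-- The fibres of a submersion are locally connected by smooth curves. -/
theorem Manifold.IsSubmersionAt.eventually_exists_curve (h : IsSubmersionAt I I' ∞ f x) :
    ∀ᶠ y in 𝓝 x, f y = f x → ∃ c : ℝ → M, ContMDiff 𝓘(ℝ, ℝ) I ∞ c ∧ c 0 = x ∧ c 1 = y ∧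
      ∀ t, f (c t) = f x := by
  obtain ⟨φ, L, hs, ht, hφ, hφs, hL, -⟩ := h.exists_chart
  have hx : x ∈ φ.source := mem_of_mem_nhds hs
  obtain ⟨ε, hε, hball⟩ := Metric.nhds_basis_ball.mem_iff.1 ht
  have hc : Tendsto φ (𝓝 x) (𝓝 (φ x)) := (hφ.contMDiffAt hs).continuousAt
  filter_upwards [hs, hc.eventually (Metric.ball_mem_nhds _ hε)] with y hy hyb hfy
  let s : ℝ → E := fun t => φ x + Real.smoothTransition t • (φ y - φ x)
  have hsm : ContDiff ℝ ∞ s :=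
    contDiff_const.add (Real.smoothTransition.contDiff.smul contDiff_const)
  have hmem : ∀ t, s t ∈ φ.target := fun t => hball <|
    (convex_ball (φ x) ε).add_smul_sub_mem (Metric.mem_ball_self hε) hyb
      ⟨Real.smoothTransition.nonneg t, Real.smoothTransition.le_one t⟩
  refine ⟨fun t => φ.symm (s t), hφs.comp_contMDiff hsm.contMDiff hmem, ?_, ?_, fun t => ?_⟩
  · simp only [s, Real.smoothTransition.zero, zero_smul, add_zero]; exact φ.left_inv hx
  · simp only [s, Real.smoothTransition.one, one_smul, add_sub_cancel]; exact φ.left_inv hy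
  · refine (hL _ (φ.map_target (hmem t)) _ hx).1 ?_
    rw [φ.right_inv (hmem t), map_add, map_smul, map_sub, (hL y hy x hx).2 hfy, sub_self,
      smul_zero, add_zero]

end Submersion

/-! ### Homogeneous spaces -/

section Isotropy

variable {G : Type*} [Group G] {H : Subgroup G}

theorem smul_base (a : G) : a • ((1 : G) : G ⧸ H) = (a : G ⧸ H) := by
  rw [MulAction.Quotient.smul_coe, smul_eq_mul, mul_one]

theorem mk_eq_base_iff {a : G} : (a : G ⧸ H) = ((1 : G) : G ⧸ H) ↔ a ∈ H := by
  rw [eq_comm, QuotientGroup.eq]; simp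

variable {d : ℕ} [TopologicalSpace G] [ChartedSpace (EuclideanSpace ℝ (Fin d)) G]
  [LieGroup (𝓡 d) ∞ G] {𝔥 : LieSubalgebra ℝ (GroupLieAlgebra (𝓡 d) G)}
  (h𝔥 : IsLieAlgebraOfSubgroup H (𝔥 : Set (GroupLieAlgebra (𝓡 d) G)))

include h𝔥

/-- The adjoint representation of `H` preserves its Lie algebra. -/
theorem Ad_mem_of_mem {a : G} (ha : a ∈ H) {X : GroupLieAlgebra (𝓡 d) G} (hX : X ∈ 𝔥) :
    Ad a X ∈ 𝔥 := by
  obtain ⟨c, hc, hc0, hcH, hcX⟩ := (h𝔥 X).1 hX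
  refine (h𝔥 _).2 ⟨fun t => a * c t * a⁻¹, (contMDiff_conj a).comp hc, by simp [hc0],
    fun t => H.mul_mem (H.mul_mem ha (hcH t)) (H.inv_mem ha), ?_⟩
  have h := mdiff_conj_curve a hc hc0
  have hcX' : mdiff 𝓘(ℝ, ℝ) (𝓡 d) c 0 1 = X := hcX
  rw [hcX'] at h
  exact h

/-- Along a curve in `H`, the adjoint representation does not move a vector which commutes with the
Lie algebra of `H`. -/
theorem Ad_curve_eq {ξ : GroupLieAlgebra (𝓡 d) G} (hξ : ∀ X ∈ 𝔥, ⁅X, ξ⁆ = 0) {c : ℝ → G}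
    (hc : ContMDiff 𝓘(ℝ, ℝ) (𝓡 d) ∞ c) (hc0 : c 0 = 1) (hcH : ∀ t, c t ∈ H) (t : ℝ) :
    Ad (c t) ξ = ξ := by
  -- `c (t + s)` is the product of `c t` and of a curve in `H` through `1`, so the derivative of
  -- `Ad (c s) ξ` at `t` is the image under `Ad (c t)` of a bracket of an element of `𝔥` with `ξ`
  have hd : ∀ t, HasDerivAt (F := EuclideanSpace ℝ (Fin d)) (fun s => Ad (c s) ξ) 0 t := by
    intro t
    let b : ℝ → G := fun s => (c t)⁻¹ * c (t + s)
    have hb : ContMDiff 𝓘(ℝ, ℝ) (𝓡 d) ∞ b := by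
      have h1 : ContMDiff 𝓘(ℝ, ℝ) 𝓘(ℝ, ℝ) ∞ (fun s : ℝ => t + s) :=
        (contDiff_const.add contDiff_id).contMDiff
      exact contMDiff_const.mul (hc.comp h1)
    have hb0 : b 0 = 1 := by simp [b]
    have hbX : (mdiff 𝓘(ℝ, ℝ) (𝓡 d) b 0 1 : EuclideanSpace ℝ (Fin d)) ∈
        (𝔥 : Set (GroupLieAlgebra (𝓡 d) G)) :=
      (h𝔥 _).2 ⟨b, hb, hb0, fun s => H.mul_mem (H.inv_mem (hcH t)) (hcH _), rfl⟩
    have h0 := hasDerivAt_Ad hb hb0 (X := mdiff 𝓘(ℝ, ℝ) (𝓡 d) b 0 1) rfl ξ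
    rw [hξ _ hbX] at h0
    have h1 : HasDerivAt (F := EuclideanSpace ℝ (Fin d)) (fun s => Ad (b s) ξ)
      (0 : EuclideanSpace ℝ (Fin d)) 0 := h0
    have h2 := HasFDerivAt.comp_hasDerivAt (0 : ℝ)
      (mdiff (𝓡 d) (𝓡 d) (fun x : G => c t * x * (c t)⁻¹) 1).hasFDerivAt h1
    have e : (fun s => Ad (c s) ξ : ℝ → EuclideanSpace ℝ (Fin d)) =
        fun s => (Ad (c t) (Ad (b (s - t)) ξ) : EuclideanSpace ℝ (Fin d)) := by
      funext s
      rw [← Ad_mul]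
      simp [b]
    rw [e]
    rw [map_zero] at h2
    rw [← sub_self t] at h2
    exact HasDerivAt.comp_sub_const (F := EuclideanSpace ℝ (Fin d)) t t h2
  have h := is_const_of_deriv_eq_zero (G := EuclideanSpace ℝ (Fin d))
    (f := fun s => Ad (c s) ξ) (fun s => (hd s).differentiableAt) (fun s => (hd s).deriv) t 0
  have h' : Ad (c t) ξ = Ad (c 0) ξ := h
  rw [h', hc0, Ad_one]

end Isotropy

section HomogeneousSpace

open Filter Topology

variable {d k : ℕ} {G : Type*} [TopologicalSpace G] [ChartedSpace (EuclideanSpace ℝ (Fin d)) G]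
  [Group G] {H : Subgroup G} [ChartedSpace (EuclideanSpace ℝ (Fin k)) (G ⧸ H)]

/-- The differential of the translation by `a` at `p`, as an endomorphism of the model space. It is
`translDeriv` with the base points forgotten. -/
noncomputable def translMap (a : G) (p : G ⧸ H) :
    EuclideanSpace ℝ (Fin k) →L[ℝ] EuclideanSpace ℝ (Fin k) :=
  mdiff (𝓡 k) (𝓡 k) (fun q : G ⧸ H => a • q) p

variable (k H) in
/-- The differential at `1` of the projection `G → G ⧸ H`, as a map of the model spaces. It is
`projDeriv` with the base point forgotten. -/
noncomputable def projMap : EuclideanSpace ℝ (Fin d) →L[ℝ] EuclideanSpace ℝ (Fin k) :=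
  mdiff (𝓡 d) (𝓡 k) (fun x : G => (x : G ⧸ H)) 1

/-- The fundamental vector field of `X`, with values in the model space. It is `fundamentalField`
with the base points forgotten. -/
noncomputable def fundVec (X : GroupLieAlgebra (𝓡 d) G) (p : G ⧸ H) : EuclideanSpace ℝ (Fin k) :=
  mdiff (𝓡 d) (𝓡 k) (fun a : G => a • p) 1 X

theorem translMap_one (p : G ⧸ H) (v : EuclideanSpace ℝ (Fin k)) :
    translMap (1 : G) p v = v := by
  rw [translMap]
  simp only [one_smul, mdiff_id]
  rfl

theorem fundVec_base (X : GroupLieAlgebra (𝓡 d) G) :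
    fundVec X ((1 : G) : G ⧸ H) = projMap k H X := by
  rw [fundVec]
  simp only [smul_base]
  rfl

variable (hsub : Manifold.IsSubmersion (𝓡 d) (𝓡 k) ∞ (fun x : G => (x : G ⧸ H)))

include hsub

/-- A map out of `G ⧸ H` is smooth if its composition with the projection is. -/
theorem contMDiffAt_of_comp_mk {F : Type*} [NormedAddCommGroup F] [NormedSpace ℝ F] {K : Type*}
    [TopologicalSpace K] {J : ModelWithCorners ℝ F K} {N : Type*} [TopologicalSpace N]
    [ChartedSpace K N] {f : G ⧸ H → N} {a : G}
    (hf : ContMDiffAt (𝓡 d) J ∞ (fun x : G => f (x : G ⧸ H)) a) :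
    ContMDiffAt (𝓡 k) J ∞ f (a : G ⧸ H) := by
  obtain ⟨σ, hσ, hσa, hσe⟩ := (hsub.isSubmersionAt a).exists_section
  have h1 : ContMDiffAt (𝓡 d) J ∞ (fun x : G => f (x : G ⧸ H)) (σ (a : G ⧸ H)) := by
    rw [hσa]; exact hf
  refine (h1.comp (a : G ⧸ H) hσ).congr_of_eventuallyEq ?_
  filter_upwards [hσe] with y hy
  simp only [Function.comp, hy]

theorem mdifferentiableAt_mk (a : G) :
    MDifferentiableAt (𝓡 d) (𝓡 k) (fun x : G => (x : G ⧸ H)) a :=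
  hsub.contMDiff.mdifferentiableAt (by simp)

theorem projMap_surjective : Function.Surjective (projMap (d := d) (G := G) k H) := by
  intro v
  obtain ⟨σ, hσ, hσa, hσe⟩ := (hsub.isSubmersionAt (1 : G)).exists_section
  have h := mdiff_comp_apply (g := fun x : G => (x : G ⧸ H)) (f := σ) (I'' := 𝓡 k)
    ((1 : G) : G ⧸ H) (mdifferentiableAt_mk hsub _) (hσ.mdifferentiableAt (by simp)) v
  rw [mdiff_congr hσe, mdiff_id, hσa] at h
  exact ⟨_, h.symm⟩

variable [LieGroup (𝓡 d) ∞ G]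

/-- The action of `G` on `G ⧸ H` is smooth: locally, `a • p` is the class of `a * σ(p)`, where `σ` is
a smooth section of the projection. -/
theorem contMDiff_smul_quotient :
    ContMDiff ((𝓡 d).prod (𝓡 k)) (𝓡 k) ∞ (fun x : G × (G ⧸ H) => x.1 • x.2) := by
  rintro ⟨a, p⟩
  obtain ⟨b, rfl⟩ := QuotientGroup.mk_surjective p
  obtain ⟨σ, hσ, hσb, hσe⟩ := (hsub.isSubmersionAt b).exists_section
  have h1 : ContMDiffAt ((𝓡 d).prod (𝓡 k)) (𝓡 d) ∞ (fun x : G × (G ⧸ H) => x.1 * σ x.2)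
      (a, (b : G ⧸ H)) := contMDiffAt_fst.mul (hσ.comp (a, (b : G ⧸ H)) contMDiffAt_snd)
  refine (hsub.contMDiff.contMDiffAt.comp (a, (b : G ⧸ H)) h1).congr_of_eventuallyEq ?_
  filter_upwards [(continuous_snd (X := G)).continuousAt.eventually hσe] with x hx
  simp only [Function.comp]
  rw [← smul_eq_mul, ← MulAction.Quotient.smul_coe, hx]

theorem contMDiff_transl (a : G) : ContMDiff (𝓡 k) (𝓡 k) ∞ (fun q : G ⧸ H => a • q) :=
  (contMDiff_smul_quotient hsub).comp (contMDiff_const.prodMk contMDiff_id)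

theorem mdifferentiableAt_transl (a : G) (p : G ⧸ H) :
    MDifferentiableAt (𝓡 k) (𝓡 k) (fun q : G ⧸ H => a • q) p :=
  (contMDiff_transl hsub a).mdifferentiableAt (by simp)

theorem contMDiff_orbit (p : G ⧸ H) : ContMDiff (𝓡 d) (𝓡 k) ∞ (fun a : G => a • p) :=
  (contMDiff_smul_quotient hsub).comp (contMDiff_id.prodMk contMDiff_const)

theorem mdifferentiableAt_orbit (a : G) (p : G ⧸ H) :
    MDifferentiableAt (𝓡 d) (𝓡 k) (fun a : G => a • p) a :=
  (contMDiff_orbit hsub p).mdifferentiableAt (by simp)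

theorem translMap_mul (a b : G) (p : G ⧸ H) (v : EuclideanSpace ℝ (Fin k)) :
    translMap (a * b) p v = translMap a (b • p) (translMap b p v) := by
  have h := mdiff_comp_apply (g := fun q : G ⧸ H => a • q) (f := fun q : G ⧸ H => b • q)
    (I'' := 𝓡 k) p (mdifferentiableAt_transl hsub a _) (mdifferentiableAt_transl hsub b _) v
  rw [translMap, translMap, translMap, ← h]
  simp only [mul_smul]

theorem translMap_inv_transl (a : G) (p : G ⧸ H) (v : EuclideanSpace ℝ (Fin k)) :
    translMap a⁻¹ (a • p) (translMap a p v) = v := by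
  rw [← translMap_mul hsub, inv_mul_cancel, translMap_one]

theorem translMap_transl_inv (a : G) (p : G ⧸ H) (v : EuclideanSpace ℝ (Fin k)) :
    translMap a p (translMap a⁻¹ (a • p) v) = v := by
  have h := translMap_mul hsub a a⁻¹ (a • p) v
  rw [inv_smul_smul, mul_inv_cancel, translMap_one] at h
  exact h.symm

/-- The isotropy representation of `H` is induced by the adjoint representation. -/
theorem translMap_projMap {a : G} (ha : a ∈ H) (X : GroupLieAlgebra (𝓡 d) G) :
    translMap a ((1 : G) : G ⧸ H) (projMap k H X) = projMap (G := G) k H (Ad a X) := by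
  have h1 := mdiff_comp_apply (g := fun q : G ⧸ H => a • q) (f := fun x : G => (x : G ⧸ H))
    (I := 𝓡 d) (I'' := 𝓡 k) (1 : G) (mdifferentiableAt_transl hsub a _)
    (mdifferentiableAt_mk hsub _) X
  have h2 := mdiff_comp_apply (g := fun x : G => (x : G ⧸ H)) (f := fun x : G => a * x * a⁻¹)
    (I := 𝓡 d) (I'' := 𝓡 k) (1 : G) (mdifferentiableAt_mk hsub _)
    (mdifferentiableAt_conj a _) X
  have e : (fun x : G => ((a * x * a⁻¹ : G) : G ⧸ H)) = fun x : G => a • (x : G ⧸ H) := by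
    funext x
    rw [MulAction.Quotient.smul_coe, smul_eq_mul, QuotientGroup.eq]
    have : (a * x * a⁻¹)⁻¹ * (a * x) = a := by group
    rwa [this]
  rw [e, h1, mul_one, mul_inv_cancel] at h2
  exact h2

/-- Translations carry fundamental vector fields to fundamental vector fields. -/
theorem translMap_fundVec (a : G) (X : GroupLieAlgebra (𝓡 d) G) (p : G ⧸ H) :
    translMap a p (fundVec (k := k) X p) = fundVec (Ad a X) (a • p) := by
  have h1 := mdiff_comp_apply (g := fun q : G ⧸ H => a • q) (f := fun x : G => x • p)
    (I := 𝓡 d) (I'' := 𝓡 k) (1 : G) (mdifferentiableAt_transl hsub a _)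
    (mdifferentiableAt_orbit hsub _ p) X
  have h2 := mdiff_comp_apply (g := fun x : G => x • a • p) (f := fun x : G => a * x * a⁻¹)
    (I := 𝓡 d) (I'' := 𝓡 k) (1 : G) (mdifferentiableAt_orbit hsub _ (a • p))
    (mdifferentiableAt_conj a _) X
  have e : (fun x : G => (a * x * a⁻¹) • a • p) = fun x : G => a • x • p := by
    funext x
    rw [← mul_smul, inv_mul_cancel_right, mul_smul]
  rw [e, h1, mul_one, mul_inv_cancel, one_smul] at h2
  exact h2

theorem fundVec_smul_base (a : G) (X : GroupLieAlgebra (𝓡 d) G) :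
    fundVec X (a • ((1 : G) : G ⧸ H)) = translMap a ((1 : G) : G ⧸ H) (projMap k H (Ad a⁻¹ X)) := by
  rw [← fundVec_base (G := G), translMap_fundVec hsub, Ad_Ad_inv]

variable {𝔥 : LieSubalgebra ℝ (GroupLieAlgebra (𝓡 d) G)}
  (h𝔥 : IsLieAlgebraOfSubgroup H (𝔥 : Set (GroupLieAlgebra (𝓡 d) G)))

include h𝔥

/-- The kernel of the differential of the projection is the Lie algebra of `H`. -/
theorem projMap_eq_zero_iff (X : GroupLieAlgebra (𝓡 d) G) :
    projMap (G := G) k H X = 0 ↔ X ∈ 𝔥 := by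
  refine Iff.trans ?_ (h𝔥 X).symm
  constructor
  · intro hX
    obtain ⟨c, hc, hc0, hcX, hcH⟩ := (hsub.isSubmersionAt (1 : G)).exists_curve_velocity hX
    exact ⟨c, hc, hc0, fun t => mk_eq_base_iff.1 (hcH t), hcX⟩
  · rintro ⟨c, hc, hc0, hcH, hcX⟩
    have h := mdiff_comp_apply (g := fun x : G => (x : G ⧸ H)) (f := c) (I := 𝓘(ℝ, ℝ))
      (I'' := 𝓡 k) (0 : ℝ) (mdifferentiableAt_mk hsub _) (hc.mdifferentiableAt (by simp)) 1
    have e : (fun t => (c t : G ⧸ H)) = fun _ => ((1 : G) : G ⧸ H) := by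
      funext t; exact mk_eq_base_iff.2 (hcH t)
    have hcX' : mdiff 𝓘(ℝ, ℝ) (𝓡 d) c 0 1 = X := hcX
    rw [e, mdiff_const, hcX', hc0] at h
    exact h.symm

/-- If `H` is connected, it fixes the vectors which commute with its Lie algebra: the stabilizer of
such a vector contains a neighbourhood of `1` in `H`, as the fibre `H` of the projection is locally
connected by smooth curves. -/
theorem Ad_eq_self (hconn : IsConnected (H : Set G)) {ξ : GroupLieAlgebra (𝓡 d) G}
    (hξ : ∀ X ∈ 𝔥, ⁅X, ξ⁆ = 0) {a : G} (ha : a ∈ H) : Ad a ξ = ξ := by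
  have : IsTopologicalGroup G := topologicalGroup_of_lieGroup (𝓡 d) ∞
  have : ConnectedSpace H := isConnected_iff_connectedSpace.1 hconn
  let S : Subgroup H :=
    { carrier := {b | Ad (b : G) ξ = ξ}
      one_mem' := Ad_one ξ
      mul_mem' := fun {b c} hb hc => by
        change Ad ((b : G) * c) ξ = ξ
        rw [Ad_mul]
        rw [Set.mem_ofPred_eq] at hb hc
        rw [hc, hb]
      inv_mem' := fun {b} hb => by
        change Ad (b : G)⁻¹ ξ = ξ
        rw [Set.mem_ofPred_eq] at hb
        conv_lhs => rw [← hb]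
        exact Ad_inv_Ad _ ξ }
  have hS : (S : Set H) ∈ 𝓝 (1 : H) := by
    have h1 := (hsub.isSubmersionAt (1 : G)).eventually_exists_curve
    filter_upwards [continuous_subtype_val.continuousAt.eventually h1] with b hb
    obtain ⟨c, hc, hc0, hc1, hcH⟩ := hb (mk_eq_base_iff.2 b.2)
    have h2 := Ad_curve_eq h𝔥 hξ hc hc0 (fun t => mk_eq_base_iff.1 (hcH t)) 1
    rw [hc1] at h2
    exact h2
  have hopen := S.isOpen_of_mem_nhds hS
  have huniv := IsClopen.eq_univ ⟨S.isClosed_of_isOpen hopen, hopen⟩ ⟨1, S.one_mem⟩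
  have : (⟨a, ha⟩ : H) ∈ (S : Set H) := by rw [huniv]; trivial
  exact this

end HomogeneousSpace

/-! ### Smoothness of invariant tensor fields -/

section InvariantTensors

open Filter Topology

variable {d k : ℕ} {G : Type*} [TopologicalSpace G] [ChartedSpace (EuclideanSpace ℝ (Fin d)) G]
  [Group G] [LieGroup (𝓡 d) ∞ G] {H : Subgroup G}
  [ChartedSpace (EuclideanSpace ℝ (Fin k)) (G ⧸ H)] [IsManifold (𝓡 k) ∞ (G ⧸ H)]
  (hsub : Manifold.IsSubmersion (𝓡 d) (𝓡 k) ∞ (fun x : G => (x : G ⧸ H)))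

include hsub

/-- The differential of the translation by `a` at the base point is a smooth function of `a`, in the
coordinates of the tangent bundle. -/
theorem contMDiffAt_translMap_base (a₀ : G) :
    ContMDiffAt (𝓡 d) 𝓘(ℝ, EuclideanSpace ℝ (Fin k) →L[ℝ] EuclideanSpace ℝ (Fin k)) ∞
      (inTangentCoordinates (𝓡 k) (𝓡 k) (fun _ : G => ((1 : G) : G ⧸ H)) (fun a => (a : G ⧸ H))
        (fun a => translMap a ((1 : G) : G ⧸ H)) a₀) a₀ := by
  have : IsManifold (𝓡 k) 1 (G ⧸ H) := .of_le (n := ∞) (by norm_cast)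
  have h := ContMDiffAt.mfderiv (I := 𝓡 k) (I' := 𝓡 k) (J := 𝓡 d) (n := ∞) (m := ∞) (x₀ := a₀)
    (fun (a : G) (q : G ⧸ H) => a • q) (fun _ => ((1 : G) : G ⧸ H))
    (contMDiff_smul_quotient hsub).contMDiffAt contMDiffAt_const (by norm_cast)
  simp only [smul_base] at h
  exact h

/-- The differential of the translation by `a⁻¹` at `a • o` is a smooth function of `a`, in the
coordinates of the tangent bundle. -/
theorem contMDiffAt_translMap_inv (a₀ : G) :
    ContMDiffAt (𝓡 d) 𝓘(ℝ, EuclideanSpace ℝ (Fin k) →L[ℝ] EuclideanSpace ℝ (Fin k)) ∞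
      (inTangentCoordinates (𝓡 k) (𝓡 k) (fun a : G => (a : G ⧸ H)) (fun _ => ((1 : G) : G ⧸ H))
        (fun a => translMap a⁻¹ (a : G ⧸ H)) a₀) a₀ := by
  have : IsManifold (𝓡 k) 1 (G ⧸ H) := .of_le (n := ∞) (by norm_cast)
  have h1 : ContMDiff ((𝓡 d).prod (𝓡 k)) (𝓡 k) ∞ (fun x : G × (G ⧸ H) => x.1⁻¹ • x.2) :=
    (contMDiff_smul_quotient hsub).comp (contMDiff_fst.inv.prodMk contMDiff_snd)
  have h := ContMDiffAt.mfderiv (I := 𝓡 k) (I' := 𝓡 k) (J := 𝓡 d) (n := ∞) (m := ∞) (x₀ := a₀)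
    (fun (a : G) (q : G ⧸ H) => a⁻¹ • q) (fun a => (a : G ⧸ H)) h1.contMDiffAt
    hsub.contMDiff.contMDiffAt (by norm_cast)
  have e : ∀ a : G, a⁻¹ • (a : G ⧸ H) = ((1 : G) : G ⧸ H) := fun a => by
    rw [← smul_base, inv_smul_smul]
  simp only [e] at h
  exact h

theorem contMDiff_fundamentalField (X : GroupLieAlgebra (𝓡 d) G) :
    IsSmoothField (fundamentalField X : Π p : G ⧸ H, TangentSpace (𝓡 k) p) := by
  have : IsManifold (𝓡 k) 1 (G ⧸ H) := .of_le (n := ∞) (by norm_cast)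
  have : IsManifold (𝓡 d) 1 G := .of_le (n := ∞) (by norm_cast)
  intro p
  have h1 : ContMDiff ((𝓡 k).prod (𝓡 d)) (𝓡 k) ∞ (fun x : (G ⧸ H) × G => x.2 • x.1) :=
    (contMDiff_smul_quotient hsub).comp (contMDiff_snd.prodMk contMDiff_fst)
  have h := ContMDiffAt.mfderiv (I := 𝓡 d) (I' := 𝓡 k) (J := 𝓡 k) (n := ∞) (m := ∞) (x₀ := p)
    (fun (q : G ⧸ H) (a : G) => a • q) (fun _ => (1 : G)) h1.contMDiffAt
    contMDiffAt_const (by norm_cast)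
  simp only [one_smul] at h
  exact ContMDiffAt.clm_apply_of_inCoordinates (IM := 𝓡 k) (IB₁ := 𝓡 d) (IB₂ := 𝓡 k) (m₀ := p)
    (E₁ := fun a : G => TangentSpace (𝓡 d) a) (E₂ := fun q : G ⧸ H => TangentSpace (𝓡 k) q)
    (b₁ := fun _ => 1) (b₂ := fun q => q)
    (ϕ := fun q => (mdiff (𝓡 d) (𝓡 k) (fun a : G => a • q) 1 :)) (v := fun _ => X)
    h contMDiffAt_const contMDiffAt_id

/-- An invariant vector field is smooth. -/
theorem isSmoothField_of_invariant {V : Π p : G ⧸ H, TangentSpace (𝓡 k) p}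
    (hV : IsInvariantField V) : IsSmoothField V := by
  intro p
  obtain ⟨a, rfl⟩ := QuotientGroup.mk_surjective p
  refine contMDiffAt_of_comp_mk hsub ?_
  have h := ContMDiffAt.clm_apply_of_inCoordinates (IM := 𝓡 d) (IB₁ := 𝓡 k) (IB₂ := 𝓡 k)
    (m₀ := a) (E₁ := fun q : G ⧸ H => TangentSpace (𝓡 k) q) (E₂ := fun q : G ⧸ H => TangentSpace (𝓡 k) q)
    (b₁ := fun _ : G => ((1 : G) : G ⧸ H)) (b₂ := fun a : G => (a : G ⧸ H))
    (ϕ := fun a => (translMap (k := k) a ((1 : G) : G ⧸ H) :)) (v := fun _ => V ((1 : G) : G ⧸ H))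
    (contMDiffAt_translMap_base hsub a) contMDiffAt_const hsub.contMDiff.contMDiffAt
  have e : (fun b : G => (⟨(b : G ⧸ H), translMap b ((1 : G) : G ⧸ H) (V ((1 : G) : G ⧸ H))⟩ :
      TangentBundle (𝓡 k) (G ⧸ H))) = fun b : G => ⟨(b : G ⧸ H), V (b : G ⧸ H)⟩ := by
    funext b
    have h1 : (V (b • ((1 : G) : G ⧸ H)) : EuclideanSpace ℝ (Fin k)) =
      translMap b ((1 : G) : G ⧸ H) (V ((1 : G) : G ⧸ H)) := hV b _
    rw [smul_base] at h1
    rw [← h1]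
  rw [← e]
  exact h

/-- The trivialization of the tangent bundle at `a₀ • o` followed by the translation by `a⁻¹`. -/
theorem contMDiffAt_translMap_symmL (a₀ : G) :
    ContMDiffAt (𝓡 d) 𝓘(ℝ, EuclideanSpace ℝ (Fin k) →L[ℝ] EuclideanSpace ℝ (Fin k)) ∞
      (fun a : G => (translMap a⁻¹ (a : G ⧸ H)).comp
        ((trivializationAt (EuclideanSpace ℝ (Fin k)) (fun q : G ⧸ H => TangentSpace (𝓡 k) q)
          (a₀ : G ⧸ H)).symmL ℝ (a : G ⧸ H) : EuclideanSpace ℝ (Fin k) →L[ℝ] _)) a₀ := by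
  have h := contMDiffAt_translMap_inv hsub a₀
  let C : EuclideanSpace ℝ (Fin k) →L[ℝ] EuclideanSpace ℝ (Fin k) :=
    (trivializationAt (EuclideanSpace ℝ (Fin k)) (fun q : G ⧸ H => TangentSpace (𝓡 k) q)
      ((1 : G) : G ⧸ H)).symmL ℝ ((1 : G) : G ⧸ H)
  have h2 := (contMDiffAt_const (c := C)).clm_comp h
  refine h2.congr_of_eventuallyEq (Eventually.of_forall fun a => ?_)
  ext v : 1
  simp only [inTangentCoordinates, ContinuousLinearMap.inCoordinates]
  exact ((trivializationAt (EuclideanSpace ℝ (Fin k)) (fun q : G ⧸ H => TangentSpace (𝓡 k) q)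
      ((1 : G) : G ⧸ H)).symmL_continuousLinearMapAt
      (FiberBundle.mem_baseSet_trivializationAt' _) _).symm

/-- An invariant field of endomorphisms of the tangent spaces is smooth. -/
theorem contMDiff_endomorphism_of_invariant
    {φ : G ⧸ H → EuclideanSpace ℝ (Fin k) →L[ℝ] EuclideanSpace ℝ (Fin k)}
    (hφ : ∀ (a : G) (p : G ⧸ H) (v : EuclideanSpace ℝ (Fin k)),
      φ (a • p) (translMap a p v) = translMap a p (φ p v)) :
    ContMDiff (𝓡 k) ((𝓡 k).prod 𝓘(ℝ, EuclideanSpace ℝ (Fin k) →L[ℝ] EuclideanSpace ℝ (Fin k))) ∞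
      (fun p => TotalSpace.mk' (EuclideanSpace ℝ (Fin k) →L[ℝ] EuclideanSpace ℝ (Fin k))
        (E := fun p : G ⧸ H => TangentSpace (𝓡 k) p →L[ℝ] TangentSpace (𝓡 k) p) p (φ p)) := by
  intro p
  obtain ⟨a₀, rfl⟩ := QuotientGroup.mk_surjective p
  refine contMDiffAt_of_comp_mk hsub ?_
  rw [contMDiffAt_hom_bundle]
  refine ⟨hsub.contMDiff.contMDiffAt, ?_⟩
  let e := trivializationAt (EuclideanSpace ℝ (Fin k)) (fun q : G ⧸ H => TangentSpace (𝓡 k) q)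
      ((1 : G) : G ⧸ H)
  let C : EuclideanSpace ℝ (Fin k) →L[ℝ] EuclideanSpace ℝ (Fin k) :=
    e.continuousLinearMapAt ℝ ((1 : G) : G ⧸ H)
  have h := (contMDiffAt_translMap_base hsub a₀).clm_comp
    ((contMDiffAt_const (c := C.comp (φ ((1 : G) : G ⧸ H)))).clm_comp
      (contMDiffAt_translMap_symmL hsub a₀))
  refine h.congr_of_eventuallyEq (Eventually.of_forall fun a => ?_)
  have key : φ (a : G ⧸ H) = (translMap a ((1 : G) : G ⧸ H)).comp
      ((φ ((1 : G) : G ⧸ H)).comp (translMap a⁻¹ (a : G ⧸ H))) := by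
    ext1 w
    rw [ContinuousLinearMap.comp_apply, ContinuousLinearMap.comp_apply, ← hφ, ← smul_base a,
      translMap_transl_inv hsub]
  have hC : (e.symmL ℝ ((1 : G) : G ⧸ H) :
      EuclideanSpace ℝ (Fin k) →L[ℝ] EuclideanSpace ℝ (Fin k)).comp C =
      ContinuousLinearMap.id ℝ _ := by
    ext1 w
    exact e.symmL_continuousLinearMapAt (FiberBundle.mem_baseSet_trivializationAt' _) w
  let A : EuclideanSpace ℝ (Fin k) →L[ℝ] EuclideanSpace ℝ (Fin k) :=
    (trivializationAt (EuclideanSpace ℝ (Fin k)) (fun q : G ⧸ H => TangentSpace (𝓡 k) q)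
      (a₀ : G ⧸ H)).continuousLinearMapAt ℝ (a : G ⧸ H)
  let B : EuclideanSpace ℝ (Fin k) →L[ℝ] EuclideanSpace ℝ (Fin k) :=
    (trivializationAt (EuclideanSpace ℝ (Fin k)) (fun q : G ⧸ H => TangentSpace (𝓡 k) q)
      (a₀ : G ⧸ H)).symmL ℝ (a : G ⧸ H)
  let S : EuclideanSpace ℝ (Fin k) →L[ℝ] EuclideanSpace ℝ (Fin k) := e.symmL ℝ ((1 : G) : G ⧸ H)
  change A.comp ((φ (a : G ⧸ H)).comp B) =
    (A.comp ((translMap a ((1 : G) : G ⧸ H)).comp S)).comp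
      ((C.comp (φ ((1 : G) : G ⧸ H))).comp ((translMap a⁻¹ (a : G ⧸ H)).comp B))
  have hSC : ∀ w, S (C w) = w := fun w =>
    congrArg (fun L : EuclideanSpace ℝ (Fin k) →L[ℝ] EuclideanSpace ℝ (Fin k) => L w) hC
  rw [key]
  ext1 w
  simp only [ContinuousLinearMap.comp_apply, hSC]

/-- An invariant field of bilinear forms on the tangent spaces is smooth. -/
theorem contMDiff_bilinear_of_invariant
    {g : G ⧸ H → EuclideanSpace ℝ (Fin k) →L[ℝ] EuclideanSpace ℝ (Fin k) →L[ℝ] ℝ}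
    (hg : ∀ (a : G) (p : G ⧸ H) (v w : EuclideanSpace ℝ (Fin k)),
      g (a • p) (translMap a p v) (translMap a p w) = g p v w) :
    ContMDiff (𝓡 k) ((𝓡 k).prod 𝓘(ℝ, EuclideanSpace ℝ (Fin k) →L[ℝ]
        EuclideanSpace ℝ (Fin k) →L[ℝ] ℝ)) ∞
      (fun p => TotalSpace.mk' (EuclideanSpace ℝ (Fin k) →L[ℝ] EuclideanSpace ℝ (Fin k) →L[ℝ] ℝ)
        (E := fun p : G ⧸ H => TangentSpace (𝓡 k) p →L[ℝ] TangentSpace (𝓡 k) p →L[ℝ] ℝ)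
        p (g p)) := by
  intro p
  obtain ⟨a₀, rfl⟩ := QuotientGroup.mk_surjective p
  refine contMDiffAt_of_comp_mk hsub ?_
  rw [contMDiffAt_hom_bundle]
  refine ⟨hsub.contMDiff.contMDiffAt, ?_⟩
  have hR := contMDiffAt_translMap_symmL hsub a₀
  have h1 := (contMDiffAt_const (c := g ((1 : G) : G ⧸ H))).clm_comp hR
  have h2 := (((ContinuousLinearMap.compL ℝ (EuclideanSpace ℝ (Fin k))
    (EuclideanSpace ℝ (Fin k)) ℝ).flip.contDiff (n := ∞)).contMDiff.contMDiffAt.comp a₀ hR).clm_comp h1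
  refine h2.congr_of_eventuallyEq ?_
  have hb : ∀ᶠ a : G in 𝓝 a₀, (a : G ⧸ H) ∈ (trivializationAt (EuclideanSpace ℝ (Fin k))
      (fun q : G ⧸ H => TangentSpace (𝓡 k) q) (a₀ : G ⧸ H)).baseSet :=
    hsub.contMDiff.continuous.continuousAt.eventually
      ((trivializationAt (EuclideanSpace ℝ (Fin k)) (fun q : G ⧸ H => TangentSpace (𝓡 k) q)
        (a₀ : G ⧸ H)).open_baseSet.mem_nhds (FiberBundle.mem_baseSet_trivializationAt' _))
  filter_upwards [hb] with a ha
  ext v w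
  refine (inCoordinates_apply_eq₂ ha ha (Set.mem_univ _)).trans ?_
  have key : ∀ v w, g (a : G ⧸ H) v w = g ((1 : G) : G ⧸ H) (translMap a⁻¹ (a : G ⧸ H) v)
      (translMap a⁻¹ (a : G ⧸ H) w) := by
    intro v w
    have h := hg a ((1 : G) : G ⧸ H) (translMap a⁻¹ (a • ((1 : G) : G ⧸ H)) v)
      (translMap a⁻¹ (a • ((1 : G) : G ⧸ H)) w)
    rwa [translMap_transl_inv hsub, translMap_transl_inv hsub, smul_base] at h
  have ht : ∀ c : ℝ, (trivializationAt ℝ (Bundle.Trivial (G ⧸ H) ℝ) (a₀ : G ⧸ H)).linearMapAt ℝ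
      (a : G ⧸ H) c = c := fun c => by simp
  have hs : ∀ v : EuclideanSpace ℝ (Fin k),
      (trivializationAt (EuclideanSpace ℝ (Fin k)) (fun q : G ⧸ H => TangentSpace (𝓡 k) q)
        (a₀ : G ⧸ H)).symm (a : G ⧸ H) v =
      (trivializationAt (EuclideanSpace ℝ (Fin k)) (fun q : G ⧸ H => TangentSpace (𝓡 k) q)
        (a₀ : G ⧸ H)).symmL ℝ (a : G ⧸ H) v := fun v => (Trivialization.symmL_apply _ ha v).symm
  rw [hs v, hs w]
  exact (ht _).trans ((key _ _).trans rfl)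

end InvariantTensors

/-! ### The Levi-Civita connection -/

section LeviCivita

variable {E : Type*} [NormedAddCommGroup E] [NormedSpace ℝ E] {H : Type*} [TopologicalSpace H] {I : ModelWithCorners ℝ E H}
  {M : Type*} [TopologicalSpace M] [ChartedSpace H M] [IsManifold I ∞ M]

theorem mdifferentiableAt_inner (g : SmoothMetric I M) {p : M} {Y Z : Π q : M, TangentSpace I q}
    (hY : MDifferentiableAt I I.tangent (fun q => (⟨q, Y q⟩ : TangentBundle I M)) p)
    (hZ : MDifferentiableAt I I.tangent (fun q => (⟨q, Z q⟩ : TangentBundle I M)) p) :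
    MDifferentiableAt I 𝓘(ℝ, ℝ) (fun q => g.inner q (Y q) (Z q)) p := by
  have h : MDifferentiableAt I (I.prod 𝓘(ℝ, ℝ))
      (fun q => TotalSpace.mk' ℝ (E := Bundle.Trivial M ℝ) q (g.inner q (Y q) (Z q))) p :=
    MDifferentiableAt.clm_bundle_apply₂ (F₁ := E) (F₂ := E)
      (g.contMDiff.mdifferentiableAt (by simp)) hY hZ
  rw [mdifferentiableAt_totalSpace] at h
  exact h.2

variable [FiniteDimensional ℝ E] [CompleteSpace E]

/-- The Levi-Civita connection is unique: the difference of two such connections is a tensor `D`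
such that `g(D(x, y), z)` is symmetric in `x, y` and skew in `y, z`. -/
theorem IsLeviCivita.cov_eq {g : SmoothMetric I M} {cov cov' : AffineConnection I M}
    (h : IsLeviCivita g cov) (h' : IsLeviCivita g cov') {V : Π q : M, TangentSpace I q} {p : M}
    (hV : MDifferentiableAt I I.tangent (fun q => (⟨q, V q⟩ : TangentBundle I M)) p) :
    cov V p = cov' V p := by
  have : IsManifold I 1 M := .of_le (n := ∞) (by norm_cast)
  have : IsManifold I 2 M := .of_le (n := ∞) (by norm_cast)
  let D := IsCovariantDerivativeOn.difference cov.isCovariantDerivativeOnUniv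
    cov'.isCovariantDerivativeOnUniv p
  have hD : ∀ {V : Π q : M, TangentSpace I q},
      MDifferentiableAt I I.tangent (fun q => (⟨q, V q⟩ : TangentBundle I M)) p →
      D (V p) = cov V p - cov' V p := fun hV =>
    IsCovariantDerivativeOn.difference_apply cov.isCovariantDerivativeOnUniv
      cov'.isCovariantDerivativeOnUniv (Set.mem_univ p) hV
  have hext : ∀ v : TangentSpace I p, ∃ V : Π q : M, TangentSpace I q,
      MDifferentiableAt I I.tangent (fun q => (⟨q, V q⟩ : TangentBundle I M)) p ∧ V p = v :=
    fun v => ⟨FiberBundle.extend E v, FiberBundle.mdifferentiableAt_extend .., by simp⟩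
  have hsymm : ∀ x y, D x y = D y x := by
    intro x y
    obtain ⟨X, hX, rfl⟩ := hext x
    obtain ⟨Y, hY, rfl⟩ := hext y
    have h1 := (CovariantDerivative.torsion_eq_zero_iff cov).1 h.2 hX hY
    have h2 := (CovariantDerivative.torsion_eq_zero_iff cov').1 h'.2 hX hY
    rw [hD hX, hD hY, sub_apply, sub_apply]
    have h3 := h1.trans h2.symm
    rw [sub_eq_sub_iff_sub_eq_sub] at h3
    exact h3.symm
  have hskew : ∀ x y z, g.inner p (D y x) z = -g.inner p (D z x) y := by
    intro x y z
    obtain ⟨Y, hY, rfl⟩ := hext y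
    obtain ⟨Z, hZ, rfl⟩ := hext z
    have h1 := h.1 p Y Z hY hZ x
    have h2 := h'.1 p Y Z hY hZ x
    rw [h1] at h2
    rw [hD hY, hD hZ, sub_apply, sub_apply, map_sub,
      map_sub, sub_apply, sub_apply,
      g.symm p (cov Z p x), g.symm p (cov' Z p x)]
    linarith
  have hzero : ∀ x y, D y x = 0 := by
    intro x y
    by_contra hne
    have key : ∀ x y z, g.inner p (D y x) z = 0 := by
      intro x y z
      have e1 := hskew x y z
      have e2 := hskew z x y
      have e3 := hskew y z x
      rw [hsymm x z] at e2
      rw [hsymm z y, hsymm x y] at e3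
      linarith
    exact (g.pos p _ hne).ne' (key x y _)
  refine sub_eq_zero.1 ?_
  rw [← hD hV]
  ext1 x
  exact hzero x _

end LeviCivita

/-! ### Invariant tensor fields and fundamental vector fields -/

section LieDerivatives

variable {d k : ℕ} {G : Type*} [TopologicalSpace G] [ChartedSpace (EuclideanSpace ℝ (Fin d)) G]
  [Group G] [LieGroup (𝓡 d) ∞ G] {H : Subgroup G}
  [ChartedSpace (EuclideanSpace ℝ (Fin k)) (G ⧸ H)]
  (hsub : Manifold.IsSubmersion (𝓡 d) (𝓡 k) ∞ (fun x : G => (x : G ⧸ H)))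

include hsub

theorem mdiff_curve_smul {c : ℝ → G} (hc : ContMDiff 𝓘(ℝ, ℝ) (𝓡 d) ∞ c) (hc0 : c 0 = 1)
    {X : GroupLieAlgebra (𝓡 d) G} (hX : mdiff 𝓘(ℝ, ℝ) (𝓡 d) c 0 1 = X) (p : G ⧸ H) :
    mdiff 𝓘(ℝ, ℝ) (𝓡 k) (fun t => c t • p) 0 1 = fundVec X p := by
  have h := mdiff_comp_apply (g := fun a : G => a • p) (f := c) (I := 𝓘(ℝ, ℝ)) (I' := 𝓡 d)
    (I'' := 𝓡 k) (0 : ℝ) (mdifferentiableAt_orbit hsub _ _) (hc.mdifferentiableAt (by simp)) 1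
  rw [hX, hc0] at h
  exact h

variable [IsManifold (𝓡 k) ∞ (G ⧸ H)]

/-- The Lie derivative of a vector field along a fundamental vector field. -/
theorem hasDerivAt_translMap_field {c : ℝ → G} (hc : ContMDiff 𝓘(ℝ, ℝ) (𝓡 d) ∞ c)
    (hc0 : c 0 = 1) {X : GroupLieAlgebra (𝓡 d) G} (hX : mdiff 𝓘(ℝ, ℝ) (𝓡 d) c 0 1 = X)
    {Y : Π q : G ⧸ H, TangentSpace (𝓡 k) q} {p : G ⧸ H}
    (hY : MDifferentiableAt (𝓡 k) (𝓡 k).tangent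
      (fun q => (⟨q, Y q⟩ : TangentBundle (𝓡 k) (G ⧸ H))) p) :
    HasDerivAt (F := EuclideanSpace ℝ (Fin k))
      (fun t => translMap (c t)⁻¹ (c t • p) (Y (c t • p) : EuclideanSpace ℝ (Fin k)))
      (mlieBracket (𝓡 k) (fundamentalField X) Y p) 0 := by
  refine hasDerivAt_pullback_family (I := 𝓡 k) (A := fun t (q : G ⧸ H) => c t • q) ?_ ?_ ?_ hY ?_
  · exact (contMDiff_smul_quotient hsub).comp ((hc.comp contMDiff_fst).prodMk contMDiff_snd)
  · intro q; rw [hc0, one_smul]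
  · exact fun q => mdiff_curve_smul hsub hc hc0 hX q
  · exact fun t => translMap_transl_inv hsub _ _ _

/-- The bracket of fundamental vector fields is the negative of the bracket of the Lie algebra,
because `G` acts from the left. -/
theorem mlieBracket_fundamentalField (X Z : GroupLieAlgebra (𝓡 d) G) (p : G ⧸ H) :
    (mlieBracket (𝓡 k) (fundamentalField X) (fundamentalField Z) p : EuclideanSpace ℝ (Fin k)) =
      -fundVec ⁅X, Z⁆ p := by
  obtain ⟨c, hc, hc0, hcX⟩ := exists_contMDiff_curve (I := 𝓡 d) (1 : G) X
  have h1 := hasDerivAt_translMap_field (k := k) (H := H) hsub hc hc0 hcX (p := p)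
    ((contMDiff_fundamentalField hsub Z).mdifferentiableAt (by simp))
  have hci : mdiff 𝓘(ℝ, ℝ) (𝓡 d) (fun t => (c t)⁻¹) 0 1 = (-X : GroupLieAlgebra (𝓡 d) G) := by
    rw [mdiff_inv_curve hc hc0, hcX]; rfl
  have h2 := hasDerivAt_Ad hc.inv (by simp [hc0]) hci Z
  have h3 := HasFDerivAt.comp_hasDerivAt (0 : ℝ)
    (mdiff (𝓡 d) (𝓡 k) (fun a : G => a • p) 1).hasFDerivAt h2
  have e : (fun t => translMap (c t)⁻¹ (c t • p)
      (fundamentalField Z (c t • p) : EuclideanSpace ℝ (Fin k))) =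
      fun t => fundVec (Ad (c t)⁻¹ Z) p := by
    funext t
    have := translMap_fundVec (k := k) hsub (c t)⁻¹ Z (c t • p)
    rw [inv_smul_smul] at this
    exact this
  rw [e] at h1
  have h4 := HasDerivAt.unique (F := EuclideanSpace ℝ (Fin k)) h1 h3
  refine h4.trans ?_
  rw [neg_lie]
  exact map_neg (mdiff (𝓡 d) (𝓡 k) (fun a : G => a • p) 1) _

/-- Fundamental vector fields commute with invariant vector fields. -/
theorem mlieBracket_fundamentalField_invariant (X : GroupLieAlgebra (𝓡 d) G)
    {V : Π q : G ⧸ H, TangentSpace (𝓡 k) q} (hV : IsInvariantField V) (p : G ⧸ H) :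
    mlieBracket (𝓡 k) (fundamentalField X) V p = 0 := by
  obtain ⟨c, hc, hc0, hcX⟩ := exists_contMDiff_curve (I := 𝓡 d) (1 : G) X
  have h1 := hasDerivAt_translMap_field (k := k) (H := H) hsub hc hc0 hcX (p := p)
    ((isSmoothField_of_invariant hsub hV).mdifferentiableAt (by simp))
  have e : (fun t => translMap (c t)⁻¹ (c t • p) (V (c t • p) : EuclideanSpace ℝ (Fin k))) =
      fun _ => (V p : EuclideanSpace ℝ (Fin k)) := by
    funext t
    have h2 : (V (c t • p) : EuclideanSpace ℝ (Fin k)) = translMap (c t) p (V p) := hV _ _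
    exact (congrArg _ h2).trans (translMap_inv_transl hsub _ _ _)
  rw [e] at h1
  exact HasDerivAt.unique (F := EuclideanSpace ℝ (Fin k)) h1 (hasDerivAt_const _ _)

/-- Fundamental vector fields are infinitesimal symmetries of an invariant field of
endomorphisms. -/
theorem mlieBracket_fundamentalField_endomorphism (X : GroupLieAlgebra (𝓡 d) G)
    {φ : G ⧸ H → EuclideanSpace ℝ (Fin k) →L[ℝ] EuclideanSpace ℝ (Fin k)}
    (hφ : ∀ (a : G) (p : G ⧸ H) (v : EuclideanSpace ℝ (Fin k)),
      φ (a • p) (translMap a p v) = translMap a p (φ p v))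
    {Y : Π q : G ⧸ H, TangentSpace (𝓡 k) q} (p : G ⧸ H)
    (hY : MDifferentiableAt (𝓡 k) (𝓡 k).tangent
      (fun q => (⟨q, Y q⟩ : TangentBundle (𝓡 k) (G ⧸ H))) p)
    (hφY : MDifferentiableAt (𝓡 k) (𝓡 k).tangent
      (fun q => (⟨q, φ q (Y q)⟩ : TangentBundle (𝓡 k) (G ⧸ H))) p) :
    (mlieBracket (𝓡 k) (fundamentalField X) (fun q => φ q (Y q)) p : EuclideanSpace ℝ (Fin k)) =
      φ p (mlieBracket (𝓡 k) (fundamentalField X) Y p) := by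
  obtain ⟨c, hc, hc0, hcX⟩ := exists_contMDiff_curve (I := 𝓡 d) (1 : G) X
  have h1 := hasDerivAt_translMap_field (k := k) (H := H) hsub hc hc0 hcX hφY
  have h2 := HasFDerivAt.comp_hasDerivAt (0 : ℝ) (φ p).hasFDerivAt
    (hasDerivAt_translMap_field (k := k) (H := H) hsub hc hc0 hcX hY)
  have e : (fun t => translMap (c t)⁻¹ (c t • p) (φ (c t • p) (Y (c t • p)))) =
      fun t => φ p (translMap (c t)⁻¹ (c t • p) (Y (c t • p))) := by
    funext t
    have h3 := hφ (c t)⁻¹ (c t • p) (Y (c t • p))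
    rw [inv_smul_smul] at h3
    exact h3.symm
  have h1' : HasDerivAt (F := EuclideanSpace ℝ (Fin k)) (fun t => translMap (c t)⁻¹ (c t • p)
    (φ (c t • p) (Y (c t • p)))) _ 0 := h1
  rw [e] at h1'
  exact HasDerivAt.unique (F := EuclideanSpace ℝ (Fin k)) h1' h2

/-- Fundamental vector fields are Killing fields of an invariant metric. -/
theorem mvfderiv_inner_fundamentalField (X : GroupLieAlgebra (𝓡 d) G)
    {g : SmoothMetric (𝓡 k) (G ⧸ H)}
    (hg : ∀ (a : G) (p : G ⧸ H) (u v : TangentSpace (𝓡 k) p),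
      g.inner (a • p) (translDeriv a p u) (translDeriv a p v) = g.inner p u v)
    {Y Z : Π q : G ⧸ H, TangentSpace (𝓡 k) q} (p : G ⧸ H)
    (hY : MDifferentiableAt (𝓡 k) (𝓡 k).tangent
      (fun q => (⟨q, Y q⟩ : TangentBundle (𝓡 k) (G ⧸ H))) p)
    (hZ : MDifferentiableAt (𝓡 k) (𝓡 k).tangent
      (fun q => (⟨q, Z q⟩ : TangentBundle (𝓡 k) (G ⧸ H))) p) :
    mvfderiv (𝓡 k) (fun q => g.inner q (Y q) (Z q)) p (fundamentalField X p) =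
      g.inner p (mlieBracket (𝓡 k) (fundamentalField X) Y p) (Z p) +
        g.inner p (Y p) (mlieBracket (𝓡 k) (fundamentalField X) Z p) := by
  obtain ⟨c, hc, hc0, hcX⟩ := exists_contMDiff_curve (I := 𝓡 d) (1 : G) X
  let b : EuclideanSpace ℝ (Fin k) →L[ℝ] EuclideanSpace ℝ (Fin k) →L[ℝ] ℝ := g.inner p
  have h1 := hasDerivAt_translMap_field (k := k) (H := H) hsub hc hc0 hcX hY
  have h2 := hasDerivAt_translMap_field (k := k) (H := H) hsub hc hc0 hcX hZ
  have h3 := (HasFDerivAt.comp_hasDerivAt (0 : ℝ) b.hasFDerivAt h1).clm_apply h2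
  let f : G ⧸ H → ℝ := fun q => g.inner q (Y q) (Z q)
  have e : (fun t => b (translMap (c t)⁻¹ (c t • p) (Y (c t • p)))
      (translMap (c t)⁻¹ (c t • p) (Z (c t • p)))) = fun t => f (c t • p) := by
    funext t
    let gE : G ⧸ H → EuclideanSpace ℝ (Fin k) →L[ℝ] EuclideanSpace ℝ (Fin k) →L[ℝ] ℝ :=
      fun q => g.inner q
    have hgE : ∀ (a : G) (q : G ⧸ H) (u v : EuclideanSpace ℝ (Fin k)),
      gE (a • q) (translMap a q u) (translMap a q v) = gE q u v := hg
    have h4 := hgE (c t)⁻¹ (c t • p) (Y (c t • p)) (Z (c t • p))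
    rw [inv_smul_smul] at h4
    exact h4
  have hc' : MDifferentiableAt 𝓘(ℝ, ℝ) (𝓡 k) (fun t => c t • p) 0 := by
    have : ContMDiff 𝓘(ℝ, ℝ) (𝓡 k) ∞ (fun t => c t • p) := (contMDiff_orbit hsub p).comp hc
    exact this.mdifferentiableAt (by simp)
  have hp : c 0 • p = p := by rw [hc0, one_smul]
  have h5 := mdiff_comp_apply (g := f) (f := fun t => c t • p) (I := 𝓘(ℝ, ℝ)) (I' := 𝓡 k)
    (I'' := 𝓘(ℝ, ℝ)) (0 : ℝ) (by rw [hp]; exact mdifferentiableAt_inner g hY hZ) hc' 1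
  rw [mdiff_curve_smul hsub hc hc0 hcX, hp, mdiff_eq_fderiv, fderiv_apply_one_eq_deriv, ← e] at h5
  have h6 := h5.symm.trans h3.deriv
  refine Eq.trans h6 ?_
  have hW : ∀ V : G ⧸ H → EuclideanSpace ℝ (Fin k),
      translMap (c 0)⁻¹ (c 0 • p) (V (c 0 • p)) = V p := fun V => by
    rw [hc0, inv_one, one_smul, translMap_one]
  exact congrArg₂ (· + ·) (congrArg (b _) (hW Z))
    (congrArg (fun u : EuclideanSpace ℝ (Fin k) => b u
      (mlieBracket (𝓡 k) (fundamentalField X) Z p)) (hW Y))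

end LieDerivatives

/-! ### The invariant connection with a given multiplication -/

section NomizuConnection

theorem out_smul_base {G : Type*} [Group G] {H : Subgroup G} (p : G ⧸ H) :
    p.out • ((1 : G) : G ⧸ H) = p :=
  (smul_base _).trans (QuotientGroup.out_eq' p)

variable {d k : ℕ} {G : Type*} [TopologicalSpace G] [ChartedSpace (EuclideanSpace ℝ (Fin d)) G]
  [Group G] {H : Subgroup G} [ChartedSpace (EuclideanSpace ℝ (Fin k)) (G ⧸ H)]

theorem fundamentalField_add (X Y : GroupLieAlgebra (𝓡 d) G) :
    (fundamentalField (X + Y) : Π p : G ⧸ H, TangentSpace (𝓡 k) p) =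
      fundamentalField X + fundamentalField Y := by
  funext p
  exact map_add (mdiff (𝓡 d) (𝓡 k) (fun a : G => a • p) 1) X Y

theorem fundamentalField_smul (c : ℝ) (X : GroupLieAlgebra (𝓡 d) G) :
    (fundamentalField (c • X) : Π p : G ⧸ H, TangentSpace (𝓡 k) p) = c • fundamentalField X := by
  funext p
  exact map_smul (mdiff (𝓡 d) (𝓡 k) (fun a : G => a • p) 1) c X

variable (k H) in
/-- The linear map from the Lie algebra of `G` onto the tangent space at `a • o`: the differential
at `1` of `x ↦ a • π(x)`. -/
noncomputable def translProj (a : G) : GroupLieAlgebra (𝓡 d) G →ₗ[ℝ] EuclideanSpace ℝ (Fin k) :=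
  (translMap (k := k) a ((1 : G) : G ⧸ H)).toLinearMap ∘ₗ (projMap (d := d) (G := G) k H).toLinearMap

theorem translProj_apply (a : G) (X : GroupLieAlgebra (𝓡 d) G) :
    translProj k H a X = translMap a ((1 : G) : G ⧸ H) (projMap k H X) := rfl

theorem translProj_one (X : GroupLieAlgebra (𝓡 d) G) : translProj k H 1 X = projMap k H X := by
  rw [translProj_apply, translMap_one]

theorem IsInvariantField.eq_translProj {V : G ⧸ H → EuclideanSpace ℝ (Fin k)}
    (hV : IsInvariantField (k := k) V) {ξ : GroupLieAlgebra (𝓡 d) G}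
    (hVo : V ((1 : G) : G ⧸ H) = projMap k H ξ) {a : G} {p : G ⧸ H}
    (ha : a • ((1 : G) : G ⧸ H) = p) : V p = translProj k H a ξ := by
  subst ha
  exact (hV a _).trans (congrArg (translMap a ((1 : G) : G ⧸ H)) hVo)

variable [LieGroup (𝓡 d) ∞ G]
  (hsub : Manifold.IsSubmersion (𝓡 d) (𝓡 k) ∞ (fun x : G => (x : G ⧸ H)))

include hsub in
theorem fundVec_Ad_eq_translProj {a : G} {p : G ⧸ H} (ha : a • ((1 : G) : G ⧸ H) = p)
    (X : GroupLieAlgebra (𝓡 d) G) : fundVec (Ad a X) p = translProj k H a X := by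
  rw [← ha, fundVec_smul_base hsub, Ad_inv_Ad, translProj_apply]

include hsub in
theorem translProj_mul (a b : G) (X : GroupLieAlgebra (𝓡 d) G) : translProj k H (a * b) X =
    translMap a (b • ((1 : G) : G ⧸ H)) (translProj k H b X) := by
  rw [translProj_apply, translProj_apply, translMap_mul hsub]

include hsub in
theorem translProj_lift {L : EuclideanSpace ℝ (Fin k) →ₗ[ℝ] GroupLieAlgebra (𝓡 d) G}
    (hL : ∀ v, translProj k H (1 : G) (L v) = v) {a : G} {p : G ⧸ H}
    (ha : a • ((1 : G) : G ⧸ H) = p) (v : EuclideanSpace ℝ (Fin k)) :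
    translProj k H a (L (translMap a⁻¹ p v)) = v := by
  subst ha
  rw [translProj_apply, ← translProj_one, hL, translMap_transl_inv hsub]

variable [IsManifold (𝓡 k) ∞ (G ⧸ H)]

/-- The Lie derivative at `p` of a vector field along the fundamental field of `X`, as a linear
function of `X`. -/
noncomputable def lieFundamental (V : G ⧸ H → EuclideanSpace ℝ (Fin k)) (p : G ⧸ H) :
    GroupLieAlgebra (𝓡 d) G →ₗ[ℝ] EuclideanSpace ℝ (Fin k) where
  toFun X := mlieBracket (𝓡 k) (fundamentalField X) V p
  map_add' X Y := by
    have : IsManifold (𝓡 k) 1 (G ⧸ H) := .of_le (n := ∞) (by norm_cast)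
    rw [fundamentalField_add]
    exact mlieBracket_add_left ((contMDiff_fundamentalField hsub X).mdifferentiableAt (by simp))
      ((contMDiff_fundamentalField hsub Y).mdifferentiableAt (by simp))
  map_smul' c X := by
    have : IsManifold (𝓡 k) 1 (G ⧸ H) := .of_le (n := ∞) (by norm_cast)
    rw [fundamentalField_smul]
    exact mlieBracket_const_smul_left
      ((contMDiff_fundamentalField hsub X).mdifferentiableAt (by simp))

theorem lieFundamental_add {V W : G ⧸ H → EuclideanSpace ℝ (Fin k)} {p : G ⧸ H}
    (hV : MDifferentiableAt (𝓡 k) (𝓡 k).tangent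
      (fun q => (⟨q, V q⟩ : TangentBundle (𝓡 k) (G ⧸ H))) p)
    (hW : MDifferentiableAt (𝓡 k) (𝓡 k).tangent
      (fun q => (⟨q, W q⟩ : TangentBundle (𝓡 k) (G ⧸ H))) p) (X : GroupLieAlgebra (𝓡 d) G) :
    lieFundamental hsub (V + W) p X = lieFundamental hsub V p X + lieFundamental hsub W p X := by
  have : IsManifold (𝓡 k) 1 (G ⧸ H) := .of_le (n := ∞) (by norm_cast)
  exact mlieBracket_add_right hV hW

theorem lieFundamental_smul {V : G ⧸ H → EuclideanSpace ℝ (Fin k)} {f : G ⧸ H → ℝ} {p : G ⧸ H}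
    (hV : MDifferentiableAt (𝓡 k) (𝓡 k).tangent
      (fun q => (⟨q, V q⟩ : TangentBundle (𝓡 k) (G ⧸ H))) p)
    (hf : MDifferentiableAt (𝓡 k) 𝓘(ℝ, ℝ) f p) (X : GroupLieAlgebra (𝓡 d) G) :
    lieFundamental hsub (fun q => f q • V q) p X =
      mdiff (𝓡 k) 𝓘(ℝ, ℝ) f p (fundVec X p) • V p + f p • lieFundamental hsub V p X := by
  have : IsManifold (𝓡 k) 1 (G ⧸ H) := .of_le (n := ∞) (by norm_cast)
  exact mlieBracket_smul_right hf hV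

/-- The covariant derivative at `p = a • o` of the connection with multiplication `α`. A tangent
vector `v` at `p` is written as the translate by `a` of the projection of `X = L (a⁻¹ v) ∈ 𝔤`;
then `∇_v V` is the sum of the Lie derivative of `V` along the fundamental field of `Ad a X`, whose
value at `p` is `v`, and of the translate of `α(X, Y)`, where `Y` represents `V_p` in the same
way. -/
noncomputable def nomizuDeriv (L : EuclideanSpace ℝ (Fin k) →ₗ[ℝ] GroupLieAlgebra (𝓡 d) G)
    (α : GroupLieAlgebra (𝓡 d) G →ₗ[ℝ] GroupLieAlgebra (𝓡 d) G →ₗ[ℝ] GroupLieAlgebra (𝓡 d) G)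
    (a : G) (V : G ⧸ H → EuclideanSpace ℝ (Fin k)) (p : G ⧸ H) :
    EuclideanSpace ℝ (Fin k) →ₗ[ℝ] EuclideanSpace ℝ (Fin k) :=
  (lieFundamental hsub V p ∘ₗ (Ad a).toLinearMap +
    translProj k H a ∘ₗ α.flip (L (translMap a⁻¹ p (V p)))) ∘ₗ L ∘ₗ
      (translMap (k := k) a⁻¹ p).toLinearMap

variable {L : EuclideanSpace ℝ (Fin k) →ₗ[ℝ] GroupLieAlgebra (𝓡 d) G}
  {α : GroupLieAlgebra (𝓡 d) G →ₗ[ℝ] GroupLieAlgebra (𝓡 d) G →ₗ[ℝ] GroupLieAlgebra (𝓡 d) G}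

theorem nomizuDeriv_apply (a : G) (V : G ⧸ H → EuclideanSpace ℝ (Fin k)) (p : G ⧸ H)
    (v : EuclideanSpace ℝ (Fin k)) : nomizuDeriv hsub L α a V p v =
      lieFundamental hsub V p (Ad a (L (translMap a⁻¹ p v))) +
        translProj k H a (α (L (translMap a⁻¹ p v)) (L (translMap a⁻¹ p (V p)))) := rfl

theorem nomizuDeriv_add {a : G} {V W : G ⧸ H → EuclideanSpace ℝ (Fin k)} {p : G ⧸ H}
    (hV : MDifferentiableAt (𝓡 k) (𝓡 k).tangent
      (fun q => (⟨q, V q⟩ : TangentBundle (𝓡 k) (G ⧸ H))) p)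
    (hW : MDifferentiableAt (𝓡 k) (𝓡 k).tangent
      (fun q => (⟨q, W q⟩ : TangentBundle (𝓡 k) (G ⧸ H))) p) (v : EuclideanSpace ℝ (Fin k)) :
    nomizuDeriv hsub L α a (V + W) p v =
      nomizuDeriv hsub L α a V p v + nomizuDeriv hsub L α a W p v := by
  rw [nomizuDeriv_apply, nomizuDeriv_apply, nomizuDeriv_apply, lieFundamental_add hsub hV hW]
  simp only [Pi.add_apply, map_add]
  abel

theorem nomizuDeriv_smul (hL : ∀ v, translProj k H (1 : G) (L v) = v) {a : G}
    {V : G ⧸ H → EuclideanSpace ℝ (Fin k)} {f : G ⧸ H → ℝ} {p : G ⧸ H}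
    (ha : a • ((1 : G) : G ⧸ H) = p)
    (hV : MDifferentiableAt (𝓡 k) (𝓡 k).tangent
      (fun q => (⟨q, V q⟩ : TangentBundle (𝓡 k) (G ⧸ H))) p)
    (hf : MDifferentiableAt (𝓡 k) 𝓘(ℝ, ℝ) f p) (v : EuclideanSpace ℝ (Fin k)) :
    nomizuDeriv hsub L α a (fun q => f q • V q) p v =
      f p • nomizuDeriv hsub L α a V p v + mdiff (𝓡 k) 𝓘(ℝ, ℝ) f p v • V p := by
  have h := lieFundamental_smul hsub hV hf (Ad a (L (translMap a⁻¹ p v)))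
  rw [fundVec_Ad_eq_translProj hsub ha, translProj_lift hsub hL ha] at h
  rw [nomizuDeriv_apply, nomizuDeriv_apply, h]
  simp only [map_smul]
  module

/-- The connection on `G ⧸ H` with multiplication `α`, computed with a section `s` of the
projection. The section is an arbitrary choice of representatives and need not be continuous: a
covariant derivative is only required to satisfy pointwise conditions. -/
noncomputable def nomizuConnection (hL : ∀ v, translProj k H (1 : G) (L v) = v) (s : G ⧸ H → G)
    (hs : ∀ p, s p • ((1 : G) : G ⧸ H) = p)
    (α : GroupLieAlgebra (𝓡 d) G →ₗ[ℝ] GroupLieAlgebra (𝓡 d) G →ₗ[ℝ] GroupLieAlgebra (𝓡 d) G) :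
    AffineConnection (𝓡 k) (G ⧸ H) where
  toFun V p := LinearMap.toContinuousLinearMap (𝕜 := ℝ) (E := EuclideanSpace ℝ (Fin k))
    (F' := EuclideanSpace ℝ (Fin k)) (nomizuDeriv hsub L α (s p) V p)
  isCovariantDerivativeOnUniv :=
    { add := fun hV hW _ => ContinuousLinearMap.ext (nomizuDeriv_add hsub hV hW)
      leibniz := fun {_ _ p} hV hf _ =>
        ContinuousLinearMap.ext (nomizuDeriv_smul hsub hL (hs p) hV hf) }

theorem lieFundamental_fundVec (X Y : GroupLieAlgebra (𝓡 d) G) (p : G ⧸ H) :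
    lieFundamental hsub (fundVec Y) p X = -fundVec ⁅X, Y⁆ p :=
  mlieBracket_fundamentalField hsub X Y p

theorem nomizuDeriv_fundVec (hL : ∀ v, translProj k H (1 : G) (L v) = v) {a : G} {p : G ⧸ H}
    (ha : a • ((1 : G) : G ⧸ H) = p) (u v : EuclideanSpace ℝ (Fin k)) :
    nomizuDeriv hsub L α a (fundVec (Ad a (L (translMap a⁻¹ p v)))) p u =
      translProj k H a (α (L (translMap a⁻¹ p u)) (L (translMap a⁻¹ p v)) -
        ⁅L (translMap a⁻¹ p u), L (translMap a⁻¹ p v)⁆) := by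
  rw [nomizuDeriv_apply, lieFundamental_fundVec, ← Ad_lie, fundVec_Ad_eq_translProj hsub ha,
    fundVec_Ad_eq_translProj hsub ha, translProj_lift hsub hL ha, map_sub, neg_add_eq_sub]

/-- The torsion vanishes if `α(X, Y) - α(Y, X) = [X, Y]_𝔪`. As it is a tensor, it may be computed with
fundamental vector fields. -/
theorem torsion_nomizuConnection (hL : ∀ v, translProj k H (1 : G) (L v) = v) {s : G ⧸ H → G}
    (hs : ∀ p, s p • ((1 : G) : G ⧸ H) = p)
    (hα : ∀ u v, translProj k H (1 : G) (α (L u) (L v) - α (L v) (L u)) =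
      translProj k H (1 : G) ⁅L u, L v⁆) :
    (nomizuConnection hsub hL s hs α).torsion = 0 := by
  have : IsManifold (𝓡 k) 1 (G ⧸ H) := .of_le (n := ∞) (by norm_cast)
  have : IsManifold (𝓡 k) 2 (G ⧸ H) := .of_le (n := ∞) (by norm_cast)
  funext p
  have key : ∀ u v : EuclideanSpace ℝ (Fin k),
      ((nomizuConnection hsub hL s hs α).torsion p : EuclideanSpace ℝ (Fin k) →L[ℝ]
        EuclideanSpace ℝ (Fin k) →L[ℝ] EuclideanSpace ℝ (Fin k)) u v = 0 := by
    intro u v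
    set X : GroupLieAlgebra (𝓡 d) G := L (translMap (s p)⁻¹ p u) with hXdef
    set Y : GroupLieAlgebra (𝓡 d) G := L (translMap (s p)⁻¹ p v) with hYdef
    have hX : fundVec (Ad (s p) X) p = u :=
      (fundVec_Ad_eq_translProj hsub (hs p) _).trans (translProj_lift hsub hL (hs p) u)
    have hY : fundVec (Ad (s p) Y) p = v :=
      (fundVec_Ad_eq_translProj hsub (hs p) _).trans (translProj_lift hsub hL (hs p) v)
    have h := (nomizuConnection hsub hL s hs α).torsion_apply (x := p)
      ((contMDiff_fundamentalField hsub (Ad (s p) X)).mdifferentiableAt (by simp))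
      ((contMDiff_fundamentalField hsub (Ad (s p) Y)).mdifferentiableAt (by simp))
    have h' : ((nomizuConnection hsub hL s hs α).torsion p : EuclideanSpace ℝ (Fin k) →L[ℝ]
        EuclideanSpace ℝ (Fin k) →L[ℝ] EuclideanSpace ℝ (Fin k)) (fundVec (Ad (s p) X) p)
        (fundVec (Ad (s p) Y) p) =
      nomizuDeriv hsub L α (s p) (fundVec (Ad (s p) Y)) p (fundVec (Ad (s p) X) p) -
        nomizuDeriv hsub L α (s p) (fundVec (Ad (s p) X)) p (fundVec (Ad (s p) Y) p) -
        lieFundamental hsub (fundVec (Ad (s p) Y)) p (Ad (s p) X) := h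
    rw [hX, hY, nomizuDeriv_fundVec hsub hL (hs p), nomizuDeriv_fundVec hsub hL (hs p),
      lieFundamental_fundVec, ← Ad_lie, fundVec_Ad_eq_translProj hsub (hs p), ← hXdef,
      ← hYdef] at h'
    have h4 := hα (translMap (s p)⁻¹ p u) (translMap (s p)⁻¹ p v)
    rw [translProj_one, translProj_one] at h4
    have h5 : translProj k H (s p) (α X Y - α Y X) = translProj k H (s p) ⁅X, Y⁆ :=
      congrArg (translMap (s p) ((1 : G) : G ⧸ H)) h4
    refine Eq.trans (α := EuclideanSpace ℝ (Fin k)) h' ?_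
    rw [← lie_skew Y X]
    simp only [map_sub, map_neg] at h5 ⊢
    rw [← h5]
    abel
  exact ContinuousLinearMap.ext fun u => ContinuousLinearMap.ext fun v => key u v

/-- The connection is metric if the endomorphisms `α(X, ·)` are skew-symmetric, since fundamental
vector fields are Killing fields. -/
theorem isMetricConnection_nomizuConnection (hL : ∀ v, translProj k H (1 : G) (L v) = v)
    {s : G ⧸ H → G} (hs : ∀ p, s p • ((1 : G) : G ⧸ H) = p) {g : SmoothMetric (𝓡 k) (G ⧸ H)}
    {B : LinearMap.BilinForm ℝ (GroupLieAlgebra (𝓡 d) G)}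
    (hg : ∀ (a : G) (p : G ⧸ H) (u v : TangentSpace (𝓡 k) p),
      g.inner (a • p) (translDeriv a p u) (translDeriv a p v) = g.inner p u v)
    (hgB : ∀ X Y : GroupLieAlgebra (𝓡 d) G,
      g.inner ((1 : G) : G ⧸ H) (projDeriv k H X) (projDeriv k H Y) = B X Y)
    (hα : ∀ X Y Z, B (α X Y) Z + B Y (α X Z) = 0) :
    IsMetricConnection g (nomizuConnection hsub hL s hs α) := by
  intro p
  let b : EuclideanSpace ℝ (Fin k) →L[ℝ] EuclideanSpace ℝ (Fin k) →L[ℝ] ℝ := g.inner p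
  have hgE : ∀ X Y, b (translProj k H (s p) X) (translProj k H (s p) Y) = B X Y := by
    intro X Y
    let gE : G ⧸ H → EuclideanSpace ℝ (Fin k) →L[ℝ] EuclideanSpace ℝ (Fin k) →L[ℝ] ℝ :=
      fun q => g.inner q
    have h : gE (s p • ((1 : G) : G ⧸ H)) (translProj k H (s p) X) (translProj k H (s p) Y) =
      B X Y := (hg (s p) ((1 : G) : G ⧸ H) (projMap k H X) (projMap k H Y)).trans (hgB X Y)
    rwa [hs] at h
  have key : ∀ (Y Z : G ⧸ H → EuclideanSpace ℝ (Fin k)) (v : EuclideanSpace ℝ (Fin k)),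
      MDifferentiableAt (𝓡 k) (𝓡 k).tangent
        (fun q => (⟨q, Y q⟩ : TangentBundle (𝓡 k) (G ⧸ H))) p →
      MDifferentiableAt (𝓡 k) (𝓡 k).tangent
        (fun q => (⟨q, Z q⟩ : TangentBundle (𝓡 k) (G ⧸ H))) p →
      mdiff (𝓡 k) 𝓘(ℝ, ℝ) (fun q => g.inner q (Y q) (Z q)) p v =
        b (nomizuDeriv hsub L α (s p) Y p v) (Z p) +
          b (Y p) (nomizuDeriv hsub L α (s p) Z p v) := by
    intro Y Z v hY hZ
    let X : GroupLieAlgebra (𝓡 d) G := L (translMap (s p)⁻¹ p v)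
    have h : mdiff (𝓡 k) 𝓘(ℝ, ℝ) (fun q => g.inner q (Y q) (Z q)) p (fundVec (Ad (s p) X) p) =
        b (lieFundamental hsub Y p (Ad (s p) X)) (Z p) +
          b (Y p) (lieFundamental hsub Z p (Ad (s p) X)) :=
      mvfderiv_inner_fundamentalField hsub (Ad (s p) X) hg p hY hZ
    rw [fundVec_Ad_eq_translProj hsub (hs p), translProj_lift hsub hL (hs p)] at h
    have h2 := hα X (L (translMap (s p)⁻¹ p (Y p))) (L (translMap (s p)⁻¹ p (Z p)))
    rw [← hgE, ← hgE, translProj_lift hsub hL (hs p), translProj_lift hsub hL (hs p)] at h2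
    rw [h, nomizuDeriv_apply, nomizuDeriv_apply, map_add, map_add, add_apply]
    linear_combination -h2
  exact fun Y Z hY hZ v => key Y Z v hY hZ

section

variable (hL : ∀ v, translProj k H (1 : G) (L v) = v) {g : SmoothMetric (𝓡 k) (G ⧸ H)}
  {B : LinearMap.BilinForm ℝ (GroupLieAlgebra (𝓡 d) G)}
  (hg : ∀ (a : G) (p : G ⧸ H) (u v : TangentSpace (𝓡 k) p),
    g.inner (a • p) (translDeriv a p u) (translDeriv a p v) = g.inner p u v)
  (hgB : ∀ X Y : GroupLieAlgebra (𝓡 d) G,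
    g.inner ((1 : G) : G ⧸ H) (projDeriv k H X) (projDeriv k H Y) = B X Y)
  (hα : ∀ X Y Z, B (α X Y) Z + B Y (α X Z) = 0)
  (hα' : ∀ u v, translProj k H (1 : G) (α (L u) (L v) - α (L v) (L u)) =
    translProj k H (1 : G) ⁅L u, L v⁆)

include hsub hL hg hgB hα hα'

theorem isLeviCivita_nomizuConnection {s : G ⧸ H → G}
    (hs : ∀ p, s p • ((1 : G) : G ⧸ H) = p) : IsLeviCivita g (nomizuConnection hsub hL s hs α) :=
  ⟨isMetricConnection_nomizuConnection hsub hL hs hg hgB hα,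
    torsion_nomizuConnection hsub hL hs hα'⟩

theorem exists_isLeviCivita : ∃ cov : AffineConnection (𝓡 k) (G ⧸ H), IsLeviCivita g cov :=
  ⟨_, isLeviCivita_nomizuConnection hsub hL hg hgB hα hα' out_smul_base⟩

/-- The formula for the Levi-Civita connection at `p = a • o` holds for each choice of `a`, since
the connection is unique. -/
theorem IsLeviCivita.cov_eq_nomizuDeriv {cov : AffineConnection (𝓡 k) (G ⧸ H)}
    (hcov : IsLeviCivita g cov) {V : G ⧸ H → EuclideanSpace ℝ (Fin k)} {p : G ⧸ H}
    (hV : MDifferentiableAt (𝓡 k) (𝓡 k).tangent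
      (fun q => (⟨q, V q⟩ : TangentBundle (𝓡 k) (G ⧸ H))) p) {a : G}
    (ha : a • ((1 : G) : G ⧸ H) = p) (v : EuclideanSpace ℝ (Fin k)) :
    cov V p v = nomizuDeriv hsub L α a V p v := by
  classical
  -- a choice of representatives which takes the value `a` at `p`
  have hs : ∀ q, (Function.update (fun q : G ⧸ H => q.out) p a) q • ((1 : G) : G ⧸ H) = q := by
    intro q
    by_cases h : q = p
    · rw [h, Function.update_self, ha]
    · rw [Function.update_of_ne h]; exact out_smul_base q
  have h := hcov.cov_eq (isLeviCivita_nomizuConnection hsub hL hg hgB hα hα' hs) hV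
  have h1 : cov V p v = nomizuDeriv hsub L α (Function.update (fun q : G ⧸ H => q.out) p a p) V p v :=
    congrArg (fun A : EuclideanSpace ℝ (Fin k) →L[ℝ] EuclideanSpace ℝ (Fin k) => A v) h
  rwa [Function.update_self] at h1

/-- The Levi-Civita connection in terms of elements `X` and `Y` of the range of the lift `L` which
represent the two tangent vectors. -/
theorem IsLeviCivita.cov_translProj {cov : AffineConnection (𝓡 k) (G ⧸ H)}
    (hcov : IsLeviCivita g cov) {V : G ⧸ H → EuclideanSpace ℝ (Fin k)} {p : G ⧸ H}
    (hV : MDifferentiableAt (𝓡 k) (𝓡 k).tangent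
      (fun q => (⟨q, V q⟩ : TangentBundle (𝓡 k) (G ⧸ H))) p) {a : G}
    (ha : a • ((1 : G) : G ⧸ H) = p) {X Y : GroupLieAlgebra (𝓡 d) G}
    (hX : L (translProj (d := d) k H (1 : G) X) = X) (hY : L (translProj (d := d) k H (1 : G) Y) = Y)
    (hVp : V p = translProj k H a Y) :
    cov V p (translProj (d := d) k H a X : EuclideanSpace ℝ (Fin k)) =
      lieFundamental hsub V p (Ad a X) + translProj k H a (α X Y) := by
  have e : ∀ Z, translMap a⁻¹ p (translProj k H a Z) = translProj (d := d) k H (1 : G) Z := by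
    intro Z
    rw [← ha, translProj_apply, translMap_inv_transl hsub, translProj_one]
  have h : cov V p (translProj (d := d) k H a X : EuclideanSpace ℝ (Fin k)) = nomizuDeriv hsub L α a V p (translProj k H a X) :=
    hcov.cov_eq_nomizuDeriv hsub hL hg hgB hα hα' hV ha _
  rw [nomizuDeriv_apply, hVp, e, e, hX, hY] at h
  exact h

end

end NomizuConnection

/-! ### The isotropy representation -/

namespace ThreeSasakianData

variable {d k : ℕ} {G : Type*} [TopologicalSpace G] [ChartedSpace (EuclideanSpace ℝ (Fin d)) G]
  [Group G] [LieGroup (𝓡 d) ∞ G] {H : Subgroup G}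
  [ChartedSpace (EuclideanSpace ℝ (Fin k)) (G ⧸ H)]
  {𝔥 : LieSubalgebra ℝ (GroupLieAlgebra (𝓡 d) G)}
  {W : Type*} [AddCommGroup W] [Module ℂ W] [LieRingModule (ℂ ⊗[ℝ] 𝔥) W]
  [LieModule ℂ (ℂ ⊗[ℝ] 𝔥) W]
  (D : ThreeSasakianData (GroupLieAlgebra (𝓡 d) G) 𝔥 W)
  (hsub : Manifold.IsSubmersion (𝓡 d) (𝓡 k) ∞ (fun x : G => (x : G ⧸ H)))
  (h𝔥 : IsLieAlgebraOfSubgroup H (𝔥 : Set (GroupLieAlgebra (𝓡 d) G)))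
  (hconn : IsConnected (H : Set G))

section Isotropy

include hsub h𝔥 hconn

theorem Ad_sp1 {a : G} (ha : a ∈ H) {X : GroupLieAlgebra (𝓡 d) G} (hX : X ∈ D.sp1) : Ad a X = X :=
  Ad_eq_self hsub h𝔥 hconn (fun _ hY => D.lie_h_sp1 hY hX) ha

theorem Ad_mem_g1 {a : G} (ha : a ∈ H) {X : GroupLieAlgebra (𝓡 d) G} (hX : X ∈ D.g1) :
    Ad a X ∈ D.g1 :=
  D.map_mem_g1 (AdEquiv a) (fun _ hY => D.Ad_sp1 hsub h𝔥 hconn ha hY)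
    (fun _ hY => Ad_mem_of_mem h𝔥 (H.inv_mem ha) hY) hX

theorem projSp1_Ad {a : G} (ha : a ∈ H) (X : GroupLieAlgebra (𝓡 d) G) :
    D.projSp1 (Ad a X) = Ad a (D.projSp1 X) := by
  have e : X = D.projSp1 X + D.projG1 X + (X - D.projSp1 X - D.projG1 X) := by abel
  have hs := D.projSp1_mem X
  conv_lhs => rw [e, map_add, map_add, map_add, map_add, D.Ad_sp1 hsub h𝔥 hconn ha hs,
    D.projSp1_of_sp1 hs, D.projSp1_of_g1 (D.Ad_mem_g1 hsub h𝔥 hconn ha (D.projG1_mem X)),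
    D.projSp1_of_h (Ad_mem_of_mem h𝔥 ha (D.sub_proj_mem_h X)), add_zero, add_zero]
  rw [D.Ad_sp1 hsub h𝔥 hconn ha hs]

theorem projG1_Ad {a : G} (ha : a ∈ H) (X : GroupLieAlgebra (𝓡 d) G) :
    D.projG1 (Ad a X) = Ad a (D.projG1 X) := by
  have e : X = D.projSp1 X + D.projG1 X + (X - D.projSp1 X - D.projG1 X) := by abel
  have hs := D.projSp1_mem X
  have hg := D.Ad_mem_g1 hsub h𝔥 hconn ha (D.projG1_mem X)
  have hh : Ad a (X - D.projSp1 X - D.projG1 X) ∈ D.g0 := D.sp1_sup_h ▸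
    Submodule.mem_sup_right (Ad_mem_of_mem h𝔥 ha (D.sub_proj_mem_h X))
  conv_lhs => rw [e, map_add, map_add, map_add, map_add, D.Ad_sp1 hsub h𝔥 hconn ha hs,
    D.projG1_of_sp1 hs, D.projG1_of_g1 hg, D.projG1_of_g0 hh, add_zero, zero_add]

theorem isReductiveDecomposition : IsReductiveDecomposition H 𝔥.toSubmodule D.m := by
  refine ⟨D.isCompl_h_m, fun a ha X hX => ?_⟩
  rw [← D.proj_add_of_m hX, map_add, D.Ad_sp1 hsub h𝔥 hconn ha (D.projSp1_mem X)]
  exact add_mem (D.sp1_le_m (D.projSp1_mem X))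
    (D.g1_le_m (D.Ad_mem_g1 hsub h𝔥 hconn ha (D.projG1_mem X)))

theorem metricForm_Ad (n : ℕ) {a : G} (ha : a ∈ H) (X Y : GroupLieAlgebra (𝓡 d) G) :
    D.metricForm n (Ad a X) (Ad a Y) = D.metricForm n X Y :=
  D.metricForm_map n (AdEquiv a) (fun X => D.projSp1_Ad hsub h𝔥 hconn ha X)
    (fun X => D.projG1_Ad hsub h𝔥 hconn ha X) X Y

end Isotropy

section Lift

include hsub h𝔥

theorem translProj_one_eq_zero_iff (X : GroupLieAlgebra (𝓡 d) G) :
    translProj k H (1 : G) X = 0 ↔ X ∈ 𝔥 := by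
  rw [translProj_one]; exact projMap_eq_zero_iff hsub h𝔥 X

/-- The identification of `𝔪` with the tangent space at the base point. -/
noncomputable def tangentEquiv : D.m ≃ₗ[ℝ] EuclideanSpace ℝ (Fin k) :=
  LinearEquiv.ofBijective (translProj k H (1 : G) ∘ₗ D.m.subtype) (by
    constructor
    · rw [← LinearMap.ker_eq_bot, LinearMap.ker_eq_bot']
      intro X hX
      have h : (X : GroupLieAlgebra (𝓡 d) G) ∈ 𝔥 := (translProj_one_eq_zero_iff hsub h𝔥 _).1 hX
      exact Subtype.ext (Submodule.disjoint_def.1 D.isCompl_h_m.disjoint _ h X.2)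
    · intro v
      obtain ⟨X, hX⟩ : ∃ X : GroupLieAlgebra (𝓡 d) G, projMap k H X = v :=
        projMap_surjective hsub v
      refine ⟨D.projM X, ?_⟩
      have h1 := (translProj_one_eq_zero_iff (k := k) hsub h𝔥 _).2 (D.sub_projM_mem_h X)
      rw [map_sub, sub_eq_zero, translProj_one X] at h1
      exact h1.symm.trans hX)

/-- The linear lift of tangent vectors at the base point to elements of `𝔪`. -/
noncomputable def lift : EuclideanSpace ℝ (Fin k) →ₗ[ℝ] GroupLieAlgebra (𝓡 d) G :=
  D.m.subtype ∘ₗ (D.tangentEquiv hsub h𝔥).symm.toLinearMap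

theorem lift_mem (v : EuclideanSpace ℝ (Fin k)) : D.lift hsub h𝔥 v ∈ D.m :=
  ((D.tangentEquiv hsub h𝔥).symm v).2

theorem translProj_lift_one (v : EuclideanSpace ℝ (Fin k)) :
    translProj k H (1 : G) (D.lift hsub h𝔥 v) = v :=
  (D.tangentEquiv hsub h𝔥).apply_symm_apply v

theorem lift_translProj {X : GroupLieAlgebra (𝓡 d) G} (hX : X ∈ D.m) :
    D.lift hsub h𝔥 (translProj k H (1 : G) X) = X :=
  congrArg Subtype.val ((D.tangentEquiv hsub h𝔥).symm_apply_apply ⟨X, hX⟩)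

theorem translProj_projM (X : GroupLieAlgebra (𝓡 d) G) :
    translProj k H (1 : G) (D.projM X : GroupLieAlgebra (𝓡 d) G) = translProj k H (1 : G) X := by
  rw [eq_comm, ← sub_eq_zero, ← map_sub, translProj_one_eq_zero_iff hsub h𝔥]
  exact D.sub_projM_mem_h X

theorem translProj_nomizu_sub (u v : EuclideanSpace ℝ (Fin k)) :
    translProj k H (1 : G) (D.nomizu (D.lift hsub h𝔥 u) (D.lift hsub h𝔥 v) -
      D.nomizu (D.lift hsub h𝔥 v) (D.lift hsub h𝔥 u)) =
    translProj k H (1 : G) ⁅D.lift hsub h𝔥 u, D.lift hsub h𝔥 v⁆ := by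
  rw [D.nomizu_sub_nomizu (D.lift_mem hsub h𝔥 u) (D.lift_mem hsub h𝔥 v),
    D.translProj_projM hsub h𝔥]

theorem finrank_m_eq : Module.finrank ℝ D.m = k := by
  rw [(D.tangentEquiv hsub h𝔥).finrank_eq, finrank_euclideanSpace_fin]

theorem metricForm_eq_of_translProj_eq (n : ℕ) {X X' Y Y' : GroupLieAlgebra (𝓡 d) G}
    (hX : translProj k H (1 : G) X = translProj k H 1 X')
    (hY : translProj k H (1 : G) Y = translProj k H 1 Y') :
    D.metricForm n X Y = D.metricForm n X' Y' := by
  have e : ∀ {Z Z' : GroupLieAlgebra (𝓡 d) G}, translProj k H (1 : G) Z = translProj k H 1 Z' →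
      D.projSp1 Z = D.projSp1 Z' ∧ D.projG1 Z = D.projG1 Z' := by
    intro Z Z' h
    rw [← sub_eq_zero, ← map_sub, translProj_one_eq_zero_iff hsub h𝔥] at h
    have hg : Z - Z' ∈ D.g0 := D.sp1_sup_h ▸ Submodule.mem_sup_right h
    exact ⟨by rw [← sub_eq_zero, ← map_sub, D.projSp1_of_h h],
      by rw [← sub_eq_zero, ← map_sub, D.projG1_of_g0 hg]⟩
  rw [metricForm_apply, metricForm_apply, (e hX).1, (e hX).2, (e hY).1, (e hY).2]

end Lift

end ThreeSasakianData

/-! ### Invariant metrics and invariant vector fields -/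

/-- The unit ball of a positive definite form on a finite-dimensional space is bounded. -/
theorem isVonNBounded_of_pos {V : Type*} [NormedAddCommGroup V] [NormedSpace ℝ V]
    [FiniteDimensional ℝ V] (b : V →L[ℝ] V →L[ℝ] ℝ) (hb : ∀ v, v ≠ 0 → 0 < b v v) :
    Bornology.IsVonNBounded ℝ {v | b v v < 1} := by
  rw [NormedSpace.isVonNBounded_iff, isBounded_iff_forall_norm_le]
  have hcont : Continuous fun v => b v v := b.continuous.clm_apply continuous_id
  by_cases hne : (Metric.sphere (0 : V) 1).Nonempty
  · have : ProperSpace V := FiniteDimensional.proper ℝ V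
    obtain ⟨x, hx, hmin⟩ := (isCompact_sphere (0 : V) 1).exists_isMinOn hne hcont.continuousOn
    have hx1 : ‖x‖ = 1 := by simpa using hx
    have hx0 : 0 < b x x := hb x (by rintro rfl; simp at hx1)
    refine ⟨1 + (b x x)⁻¹, fun v hv => ?_⟩
    rw [Set.mem_ofPred_eq] at hv
    by_cases hv0 : v = 0
    · rw [hv0, norm_zero]; positivity
    have hn : 0 < ‖v‖ := norm_pos_iff.2 hv0
    have h1 : b x x ≤ b (‖v‖⁻¹ • v) (‖v‖⁻¹ • v) :=
      hmin (by simp [norm_smul, hn.ne'])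
    rw [map_smul, map_smul, smul_apply, smul_eq_mul, smul_eq_mul] at h1
    have h2 : b x x * ‖v‖ ^ 2 < 1 := by
      refine lt_of_le_of_lt ?_ hv
      calc b x x * ‖v‖ ^ 2 ≤ ‖v‖⁻¹ * (‖v‖⁻¹ * b v v) * ‖v‖ ^ 2 := by gcongr
        _ = b v v := by field_simp
    have h3 : ‖v‖ ^ 2 < (b x x)⁻¹ := by
      rw [lt_inv_comm₀ (by positivity) hx0]
      rw [← one_div, lt_div_iff₀ (by positivity)]
      exact h2
    nlinarith [sq_nonneg (‖v‖ - 1)]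
  · refine ⟨0, fun v _ => ?_⟩
    by_contra h
    have hn : 0 < ‖v‖ := not_le.1 h
    exact hne ⟨‖v‖⁻¹ • v, by simp [norm_smul, hn.ne']⟩

section Invariant

variable {d k : ℕ} {G : Type*} [TopologicalSpace G] [ChartedSpace (EuclideanSpace ℝ (Fin d)) G]
  [Group G] [LieGroup (𝓡 d) ∞ G] {H : Subgroup G}
  [ChartedSpace (EuclideanSpace ℝ (Fin k)) (G ⧸ H)]
  (hsub : Manifold.IsSubmersion (𝓡 d) (𝓡 k) ∞ (fun x : G => (x : G ⧸ H)))

theorem inv_mul_mem_of_smul_base_eq {G : Type*} [Group G] {H : Subgroup G} {a b : G}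
    (h : a • ((1 : G) : G ⧸ H) = b • ((1 : G) : G ⧸ H)) : b⁻¹ * a ∈ H := by
  rw [smul_base, smul_base] at h
  exact QuotientGroup.eq.1 h.symm

include hsub

/-- Changing the representative `a` of the point `a • o` amounts to applying the isotropy
representation. -/
theorem translMap_inv_translProj {a b : G} {p : G ⧸ H} (ha : a • ((1 : G) : G ⧸ H) = p)
    (hb : b • ((1 : G) : G ⧸ H) = p) (X : GroupLieAlgebra (𝓡 d) G) :
    translMap b⁻¹ p (translProj k H a X) = translProj k H (1 : G) (Ad (b⁻¹ * a) X) := by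
  rw [translProj_one, ← translMap_projMap hsub (inv_mul_mem_of_smul_base_eq (ha.trans hb.symm)),
    translMap_mul hsub, ha, translProj_apply]

theorem translProj_eq_of_Ad_eq {ξ : GroupLieAlgebra (𝓡 d) G} (hξ : ∀ a ∈ H, Ad a ξ = ξ) {a b : G}
    (h : a • ((1 : G) : G ⧸ H) = b • ((1 : G) : G ⧸ H)) :
    translProj k H a ξ = translProj k H b ξ := by
  have h1 := translMap_inv_translProj hsub h rfl ξ
  rw [hξ _ (inv_mul_mem_of_smul_base_eq h), translProj_one] at h1
  rw [translProj_apply b, ← h1, translMap_transl_inv hsub]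

/-- A vector fixed by the isotropy representation extends to a unique invariant vector field. -/
theorem existsUnique_isInvariantField {ξ : GroupLieAlgebra (𝓡 d) G} (hξ : ∀ a ∈ H, Ad a ξ = ξ) :
    ∃! V : Π p : G ⧸ H, TangentSpace (𝓡 k) p,
      IsInvariantField V ∧ V ((1 : G) : G ⧸ H) = projDeriv k H ξ := by
  refine ⟨fun p => (translProj k H p.out ξ : EuclideanSpace ℝ (Fin k)), ⟨fun a p => ?_, ?_⟩, ?_⟩
  · have h : translProj k H (a • p).out ξ = translMap a p (translProj k H p.out ξ) := by
      have h1 := translProj_mul (k := k) hsub a p.out ξ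
      rw [out_smul_base] at h1
      rw [← h1]
      exact translProj_eq_of_Ad_eq hsub hξ (by rw [out_smul_base, mul_smul, out_smul_base])
    exact h
  · have h : translProj k H (Quotient.out ((1 : G) : G ⧸ H)) ξ = projMap k H ξ := by
      rw [← translProj_one]
      exact translProj_eq_of_Ad_eq hsub hξ (by rw [out_smul_base, one_smul])
    exact h
  · rintro V ⟨hV, hV0⟩
    funext p
    have h : ∀ q, q = p.out • ((1 : G) : G ⧸ H) →
        (V q : EuclideanSpace ℝ (Fin k)) = translProj k H p.out ξ := by
      rintro q rfl
      exact (hV p.out _).trans (congrArg (translMap p.out ((1 : G) : G ⧸ H)) hV0)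
    exact h p (out_smul_base p).symm

end Invariant

namespace ThreeSasakianData

variable {d k : ℕ} {G : Type*} [TopologicalSpace G] [ChartedSpace (EuclideanSpace ℝ (Fin d)) G]
  [Group G] [LieGroup (𝓡 d) ∞ G] {H : Subgroup G}
  [ChartedSpace (EuclideanSpace ℝ (Fin k)) (G ⧸ H)]
  {𝔥 : LieSubalgebra ℝ (GroupLieAlgebra (𝓡 d) G)}
  {W : Type*} [AddCommGroup W] [Module ℂ W] [LieRingModule (ℂ ⊗[ℝ] 𝔥) W]
  [LieModule ℂ (ℂ ⊗[ℝ] 𝔥) W]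
  (D : ThreeSasakianData (GroupLieAlgebra (𝓡 d) G) 𝔥 W)
  (hsub : Manifold.IsSubmersion (𝓡 d) (𝓡 k) ∞ (fun x : G => (x : G ⧸ H)))
  (h𝔥 : IsLieAlgebraOfSubgroup H (𝔥 : Set (GroupLieAlgebra (𝓡 d) G)))
  (hconn : IsConnected (H : Set G))

/-- The inner product at `p` of the invariant metric: both vectors are translated to the base point
by the inverse of a representative of `p` and lifted to `𝔪`. -/
noncomputable def metricInner (n : ℕ) (p : G ⧸ H) :
    EuclideanSpace ℝ (Fin k) →L[ℝ] EuclideanSpace ℝ (Fin k) →L[ℝ] ℝ :=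
  ((D.metricForm n).compl₁₂
    (D.lift hsub h𝔥 ∘ₗ (translMap (k := k) p.out⁻¹ p).toLinearMap)
    (D.lift hsub h𝔥 ∘ₗ (translMap (k := k) p.out⁻¹ p).toLinearMap)).toContinuousBilinearMap

theorem metricInner_apply (n : ℕ) (p : G ⧸ H) (u v : EuclideanSpace ℝ (Fin k)) :
    D.metricInner hsub h𝔥 n p u v = D.metricForm n (D.lift hsub h𝔥 (translMap p.out⁻¹ p u))
      (D.lift hsub h𝔥 (translMap p.out⁻¹ p v)) := rfl

include hconn in
theorem metricInner_translProj (n : ℕ) {a : G} {p : G ⧸ H} (ha : a • ((1 : G) : G ⧸ H) = p)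
    (X Y : GroupLieAlgebra (𝓡 d) G) :
    D.metricInner hsub h𝔥 n p (translProj k H a X) (translProj k H a Y) = D.metricForm n X Y := by
  rw [metricInner_apply, translMap_inv_translProj hsub ha (out_smul_base p),
    translMap_inv_translProj hsub ha (out_smul_base p)]
  rw [D.metricForm_eq_of_translProj_eq hsub h𝔥 n (D.translProj_lift_one hsub h𝔥 _)
    (D.translProj_lift_one hsub h𝔥 _)]
  exact D.metricForm_Ad hsub h𝔥 hconn n
    (inv_mul_mem_of_smul_base_eq (ha.trans (out_smul_base p).symm)) X Y

include hsub h𝔥 in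
theorem exists_translProj_eq {a : G} {p : G ⧸ H} (ha : a • ((1 : G) : G ⧸ H) = p)
    (v : EuclideanSpace ℝ (Fin k)) : ∃ X ∈ D.m, translProj k H a X = v :=
  ⟨_, D.lift_mem hsub h𝔥 _, translProj_lift hsub (D.translProj_lift_one hsub h𝔥) ha v⟩

include hconn in
theorem metricInner_translMap (n : ℕ) (a : G) (p : G ⧸ H) (u v : EuclideanSpace ℝ (Fin k)) :
    D.metricInner hsub h𝔥 n (a • p) (translMap a p u) (translMap a p v) =
      D.metricInner hsub h𝔥 n p u v := by
  obtain ⟨X, -, rfl⟩ := D.exists_translProj_eq hsub h𝔥 (out_smul_base p) u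
  obtain ⟨Y, -, rfl⟩ := D.exists_translProj_eq hsub h𝔥 (out_smul_base p) v
  have e : ∀ Z : GroupLieAlgebra (𝓡 d) G,
      translMap a p (translProj k H p.out Z) = translProj k H (a * p.out) Z := by
    intro Z
    have h1 := translProj_mul (k := k) hsub a p.out Z
    rw [out_smul_base] at h1
    exact h1.symm
  rw [e, e, D.metricInner_translProj hsub h𝔥 hconn n (out_smul_base p),
    D.metricInner_translProj hsub h𝔥 hconn n (by rw [mul_smul, out_smul_base])]

theorem metricInner_pos (n : ℕ) (p : G ⧸ H) {v : EuclideanSpace ℝ (Fin k)} (hv : v ≠ 0) :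
    0 < D.metricInner hsub h𝔥 n p v v := by
  rw [metricInner_apply]
  refine D.metricForm_pos n (D.lift_mem hsub h𝔥 _) fun h => hv ?_
  rw [← translProj_lift hsub (D.translProj_lift_one hsub h𝔥) (out_smul_base p) v, h, map_zero]

variable [IsManifold (𝓡 k) ∞ (G ⧸ H)]

/-- The invariant Riemannian metric on `G ⧸ H`. -/
noncomputable def invariantMetric (n : ℕ) : SmoothMetric (𝓡 k) (G ⧸ H) where
  inner p := D.metricInner hsub h𝔥 n p
  symm _ _ _ := D.metricForm_symm n _ _
  pos p _ hv := D.metricInner_pos hsub h𝔥 n p hv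
  isVonNBounded p := isVonNBounded_of_pos (D.metricInner hsub h𝔥 n p)
    fun _ hv => D.metricInner_pos hsub h𝔥 n p hv
  contMDiff := contMDiff_bilinear_of_invariant hsub (D.metricInner_translMap hsub h𝔥 hconn n)

variable {n : ℕ} {B : LinearMap.BilinForm ℝ D.m} (hB : D.IsMetricForm n B)
  {g : SmoothMetric (𝓡 k) (G ⧸ H)}

include hsub h𝔥 hB

theorem inner_projDeriv (hg : IsCorrespondingMetric B g) (X Y : GroupLieAlgebra (𝓡 d) G) :
    g.inner ((1 : G) : G ⧸ H) (projDeriv k H X) (projDeriv k H Y) = D.metricForm n X Y := by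
  have e : ∀ Z : GroupLieAlgebra (𝓡 d) G, projDeriv k H Z =
      projDeriv k H (D.projM Z : GroupLieAlgebra (𝓡 d) G) := by
    intro Z
    have h := (D.translProj_projM hsub h𝔥 Z).symm
    rw [translProj_one, translProj_one] at h
    exact h
  rw [D.metricForm_eq_of_translProj_eq hsub h𝔥 n (D.translProj_projM hsub h𝔥 X).symm
    (D.translProj_projM hsub h𝔥 Y).symm, e X, e Y, hg.2,
    (D.isMetricForm_iff n B).1 hB]

theorem inner_translProj (hg : IsCorrespondingMetric B g) {a : G} {p : G ⧸ H}
    (ha : a • ((1 : G) : G ⧸ H) = p) (X Y : GroupLieAlgebra (𝓡 d) G) :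
    (g.inner p : EuclideanSpace ℝ (Fin k) →L[ℝ] EuclideanSpace ℝ (Fin k) →L[ℝ] ℝ)
      (translProj k H a X) (translProj k H a Y) = D.metricForm n X Y := by
  subst ha
  exact (hg.1 a _ (projMap k H X) (projMap k H Y)).trans (D.inner_projDeriv hsub h𝔥 hB hg X Y)

include hconn in
theorem existsUnique_isCorrespondingMetric :
    ∃! g : SmoothMetric (𝓡 k) (G ⧸ H), IsCorrespondingMetric B g := by
  refine ⟨D.invariantMetric hsub h𝔥 hconn n,
    ⟨D.metricInner_translMap hsub h𝔥 hconn n, fun X Y => ?_⟩, fun g hg => ?_⟩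
  · have h := D.metricInner_translProj hsub h𝔥 hconn n (one_smul G ((1 : G) : G ⧸ H)) X Y
    rw [translProj_one, translProj_one, ← (D.isMetricForm_iff n B).1 hB] at h
    exact h
  · have h : g.inner = (D.invariantMetric hsub h𝔥 hconn n).inner := by
      funext p
      have h1 : (g.inner p : EuclideanSpace ℝ (Fin k) →L[ℝ] EuclideanSpace ℝ (Fin k) →L[ℝ] ℝ) =
          D.metricInner hsub h𝔥 n p := by
        ext1 u
        ext1 v
        obtain ⟨X, -, rfl⟩ := D.exists_translProj_eq hsub h𝔥 (out_smul_base p) u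
        obtain ⟨Y, -, rfl⟩ := D.exists_translProj_eq hsub h𝔥 (out_smul_base p) v
        exact (D.inner_translProj hsub h𝔥 hB hg (out_smul_base p) X Y).trans
          (D.metricInner_translProj hsub h𝔥 hconn n (out_smul_base p) X Y).symm
      exact h1
    cases g
    simp only [invariantMetric] at h ⊢
    congr

end ThreeSasakianData

/-! ### The Levi-Civita connection of the invariant metric -/

section Translation

variable {d k : ℕ} {G : Type*} [TopologicalSpace G] [ChartedSpace (EuclideanSpace ℝ (Fin d)) G]
  [Group G] [LieGroup (𝓡 d) ∞ G] {H : Subgroup G}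
  [ChartedSpace (EuclideanSpace ℝ (Fin k)) (G ⧸ H)] [IsManifold (𝓡 k) ∞ (G ⧸ H)]
  (hsub : Manifold.IsSubmersion (𝓡 d) (𝓡 k) ∞ (fun x : G => (x : G ⧸ H)))

/-- Translations carry Lie derivatives along fundamental fields to such Lie derivatives. -/
theorem lieFundamental_translMap (a : G) {Y Y' : G ⧸ H → EuclideanSpace ℝ (Fin k)} {p : G ⧸ H}
    (hY : MDifferentiableAt (𝓡 k) (𝓡 k).tangent
      (fun q => (⟨q, Y q⟩ : TangentBundle (𝓡 k) (G ⧸ H))) p)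
    (hY' : MDifferentiableAt (𝓡 k) (𝓡 k).tangent
      (fun q => (⟨q, Y' q⟩ : TangentBundle (𝓡 k) (G ⧸ H))) (a • p))
    (h : ∀ q, Y' (a • q) = translMap a q (Y q)) (X : GroupLieAlgebra (𝓡 d) G) :
    lieFundamental hsub Y' (a • p) (Ad a X) = translMap a p (lieFundamental hsub Y p X) := by
  obtain ⟨c, hc, hc0, hcX⟩ := exists_contMDiff_curve (I := 𝓡 d) (1 : G) X
  have h1 := hasDerivAt_translMap_field (k := k) (H := H) hsub hc hc0 hcX hY
  have hcX' := mdiff_conj_curve a hc hc0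
  rw [hcX] at hcX'
  have h2 := hasDerivAt_translMap_field (k := k) (H := H) hsub ((contMDiff_conj a).comp hc)
    (by simp [hc0]) hcX' hY'
  have h3 := HasFDerivAt.comp_hasDerivAt (0 : ℝ) (translMap (k := k) a p).hasFDerivAt h1
  have e : (fun t => translMap (a * c t * a⁻¹)⁻¹ ((a * c t * a⁻¹) • a • p)
      (Y' ((a * c t * a⁻¹) • a • p))) =
      fun t => translMap a p (translMap (c t)⁻¹ (c t • p) (Y (c t • p))) := by
    funext t
    have e1 : (a * c t * a⁻¹) • a • p = a • c t • p := by
      rw [← mul_smul, inv_mul_cancel_right, mul_smul]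
    have e2 : (a * c t * a⁻¹)⁻¹ * a = a * (c t)⁻¹ := by group
    have e3 := translMap_mul hsub a (c t)⁻¹ (c t • p) (Y (c t • p))
    rw [inv_smul_smul] at e3
    rw [e1, h, ← translMap_mul hsub, e2, e3]
  have h2' : HasDerivAt (F := EuclideanSpace ℝ (Fin k))
    (fun t => translMap (a * c t * a⁻¹)⁻¹ ((a * c t * a⁻¹) • a • p)
      (Y' ((a * c t * a⁻¹) • a • p))) _ 0 := h2
  rw [e] at h2'
  exact HasDerivAt.unique (F := EuclideanSpace ℝ (Fin k)) h2' h3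

end Translation

namespace ThreeSasakianData

variable {d k : ℕ} {G : Type*} [TopologicalSpace G] [ChartedSpace (EuclideanSpace ℝ (Fin d)) G]
  [Group G] [LieGroup (𝓡 d) ∞ G] {H : Subgroup G}
  [ChartedSpace (EuclideanSpace ℝ (Fin k)) (G ⧸ H)] [IsManifold (𝓡 k) ∞ (G ⧸ H)]
  {𝔥 : LieSubalgebra ℝ (GroupLieAlgebra (𝓡 d) G)}
  {W : Type*} [AddCommGroup W] [Module ℂ W] [LieRingModule (ℂ ⊗[ℝ] 𝔥) W]
  [LieModule ℂ (ℂ ⊗[ℝ] 𝔥) W]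
  (D : ThreeSasakianData (GroupLieAlgebra (𝓡 d) G) 𝔥 W)
  (hsub : Manifold.IsSubmersion (𝓡 d) (𝓡 k) ∞ (fun x : G => (x : G ⧸ H)))
  (h𝔥 : IsLieAlgebraOfSubgroup H (𝔥 : Set (GroupLieAlgebra (𝓡 d) G)))

section Connection

include hsub h𝔥

variable {n : ℕ} {B : LinearMap.BilinForm ℝ D.m} (hB : D.IsMetricForm n B)
  {g : SmoothMetric (𝓡 k) (G ⧸ H)} (hg : IsCorrespondingMetric B g)

include hB hg

theorem exists_isLeviCivita : ∃ cov : AffineConnection (𝓡 k) (G ⧸ H), IsLeviCivita g cov :=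
  _root_.exists_isLeviCivita hsub (D.translProj_lift_one hsub h𝔥) hg.1
    (D.inner_projDeriv hsub h𝔥 hB hg) (D.metricForm_nomizu_skew n) (D.translProj_nomizu_sub hsub h𝔥)

variable {cov : AffineConnection (𝓡 k) (G ⧸ H)} (hcov : IsLeviCivita g cov)

include hcov

/-- The Levi-Civita connection is the invariant connection with multiplication `nomizu`. -/
theorem leviCivita_apply {V : G ⧸ H → EuclideanSpace ℝ (Fin k)} {p : G ⧸ H}
    (hV : MDifferentiableAt (𝓡 k) (𝓡 k).tangent
      (fun q => (⟨q, V q⟩ : TangentBundle (𝓡 k) (G ⧸ H))) p) {a : G}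
    (ha : a • ((1 : G) : G ⧸ H) = p) {X Y : GroupLieAlgebra (𝓡 d) G} (hX : X ∈ D.m) (hY : Y ∈ D.m)
    (hVp : V p = translProj k H a Y) :
    cov V p (translProj (d := d) k H a X : EuclideanSpace ℝ (Fin k)) =
      lieFundamental hsub V p (Ad a X) + translProj k H a (D.nomizu X Y) :=
  hcov.cov_translProj hsub (D.translProj_lift_one hsub h𝔥) hg.1
    (D.inner_projDeriv hsub h𝔥 hB hg) (D.metricForm_nomizu_skew n) (D.translProj_nomizu_sub hsub h𝔥)
    hV ha (D.lift_translProj hsub h𝔥 hX) (D.lift_translProj hsub h𝔥 hY) hVp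

/-- The Levi-Civita connection is invariant, since the representative `a p.out` may be used at
`a • p`. -/
theorem isInvariantConnection : IsInvariantConnection cov := by
  have key : ∀ (a : G) (Y Y' : G ⧸ H → EuclideanSpace ℝ (Fin k)), IsSmoothField (I := 𝓡 k) Y →
      IsSmoothField (I := 𝓡 k) Y' → (∀ q, Y' (a • q) = translMap a q (Y q)) →
      ∀ (p : G ⧸ H) (v : EuclideanSpace ℝ (Fin k)),
        (cov Y' (a • p) (translMap a p v) : EuclideanSpace ℝ (Fin k)) =
          translMap a p (cov Y p v) := by
    intro a Y Y' hY hY' h p v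
    have ha : (a * p.out) • ((1 : G) : G ⧸ H) = a • p := by rw [mul_smul, out_smul_base]
    obtain ⟨X, hX, rfl⟩ := D.exists_translProj_eq hsub h𝔥 (out_smul_base p) v
    obtain ⟨Z, hZ, hYp⟩ := D.exists_translProj_eq hsub h𝔥 (out_smul_base p) (Y p)
    have e : ∀ Z : GroupLieAlgebra (𝓡 d) G,
        translMap a p (translProj k H p.out Z) = translProj k H (a * p.out) Z := by
      intro Z
      have h1 := translProj_mul (k := k) hsub a p.out Z
      rw [out_smul_base] at h1
      exact h1.symm
    have h1 := D.leviCivita_apply hsub h𝔥 hB hg hcov (hY.mdifferentiableAt (by simp))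
      (out_smul_base p) hX hZ hYp.symm
    have h2 := D.leviCivita_apply hsub h𝔥 hB hg hcov (hY'.mdifferentiableAt (by simp)) ha hX hZ
      (by rw [h, ← hYp, e])
    rw [e]
    refine Eq.trans (α := EuclideanSpace ℝ (Fin k)) h2 ?_
    refine Eq.trans ?_ (congrArg (translMap a p) h1).symm
    rw [map_add, e, Ad_mul, lieFundamental_translMap hsub a (hY.mdifferentiableAt (by simp))
      (hY'.mdifferentiableAt (by simp)) h]
  exact key

end Connection

/-- The restriction of `nomizu` to `𝔪`. -/
noncomputable def nomizuM : D.m →ₗ[ℝ] D.m →ₗ[ℝ] D.m :=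
  LinearMap.mk₂ ℝ (fun X Y => ⟨D.nomizu X Y, D.nomizu_mem X Y⟩)
    (fun X X' Y => Subtype.ext (by simp)) (fun c X Y => Subtype.ext (by simp))
    (fun X Y Y' => Subtype.ext (by simp)) (fun c X Y => Subtype.ext (by simp))

theorem coe_nomizuM (X Y : D.m) : (D.nomizuM X Y : GroupLieAlgebra (𝓡 d) G) = D.nomizu X Y := rfl

section NomizuMap

variable {n : ℕ} {B : LinearMap.BilinForm ℝ D.m} (hB : D.IsMetricForm n B)
  {g : SmoothMetric (𝓡 k) (G ⧸ H)} (hg : IsCorrespondingMetric B g)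
  {cov : AffineConnection (𝓡 k) (G ⧸ H)} (hcov : IsLeviCivita g cov)

include hsub h𝔥 hB hg hcov

/-- The multiplication of the Levi-Civita connection is determined by its values on fundamental
vector fields. -/
theorem isNomizuMap_iff (α : D.m →ₗ[ℝ] D.m →ₗ[ℝ] D.m) : IsNomizuMap cov α ↔ α = D.nomizuM := by
  have key : ∀ (X Y : GroupLieAlgebra (𝓡 d) G) (_ : X ∈ D.m) (_ : Y ∈ D.m)
      (V : G ⧸ H → EuclideanSpace ℝ (Fin k)), IsSmoothField (I := 𝓡 k) V →
      V ((1 : G) : G ⧸ H) = projMap k H Y →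
      (cov V ((1 : G) : G ⧸ H) (projMap (d := d) (G := G) k H X) : EuclideanSpace ℝ (Fin k)) =
        lieFundamental hsub V ((1 : G) : G ⧸ H) X + projMap (G := G) k H (D.nomizu X Y) := by
    intro X Y hX hY V hV hVo
    have h := D.leviCivita_apply hsub h𝔥 hB hg hcov (hV.mdifferentiableAt (by simp))
      (one_smul G ((1 : G) : G ⧸ H)) hX hY (by rw [hVo, translProj_one])
    rwa [translProj_one, translProj_one, Ad_one] at h
  constructor
  · intro hα
    refine LinearMap.ext fun X => LinearMap.ext fun Y => ?_
    have hV : IsSmoothField (fundamentalField (Y : GroupLieAlgebra (𝓡 d) G) :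
      Π p : G ⧸ H, TangentSpace (𝓡 k) p) := contMDiff_fundamentalField hsub _
    have h1 := hα X Y _ hV (fundVec_base _)
    have h2 := key X Y X.2 Y.2 _ hV (fundVec_base _)
    have h3 : translProj k H (1 : G) (α X Y : GroupLieAlgebra (𝓡 d) G) =
        translProj k H (1 : G) (D.nomizu X Y) := by
      rw [translProj_one, translProj_one]
      exact h1.trans (sub_eq_of_eq_add' h2)
    have h4 := congrArg (D.lift hsub h𝔥) h3
    rw [D.lift_translProj hsub h𝔥 (α X Y).2, D.lift_translProj hsub h𝔥 (D.nomizu_mem _ _)] at h4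
    exact Subtype.ext h4
  · rintro rfl X Y V hV hVo
    exact (sub_eq_of_eq_add' (key X Y X.2 Y.2 V hV hVo)).symm

end NomizuMap

theorem nomizuM_sp1_g1 {X Y : D.m} (hX : (X : GroupLieAlgebra (𝓡 d) G) ∈ D.sp1)
    (hY : (Y : GroupLieAlgebra (𝓡 d) G) ∈ D.g1) : D.nomizuM X Y = 0 :=
  Subtype.ext (D.nomizu_sp1_g1 hX hY)

theorem nomizuM_sp1_sp1 {X Y : D.m} (hX : (X : GroupLieAlgebra (𝓡 d) G) ∈ D.sp1)
    (hY : (Y : GroupLieAlgebra (𝓡 d) G) ∈ D.sp1) : D.nomizuM X Y =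
      (1 / 2 : ℝ) • D.projM ⁅(X : GroupLieAlgebra (𝓡 d) G), (Y : GroupLieAlgebra (𝓡 d) G)⁆ := by
  refine Subtype.ext ?_
  have h := D.sp1.lie_mem hX hY
  rw [coe_nomizuM, D.nomizu_sp1_sp1 hX hY, Submodule.coe_smul, projM_eq, D.projSp1_of_sp1 h,
    D.projG1_of_sp1 h, add_zero]

theorem nomizuM_g1_g1 {X Y : D.m} (hX : (X : GroupLieAlgebra (𝓡 d) G) ∈ D.g1)
    (hY : (Y : GroupLieAlgebra (𝓡 d) G) ∈ D.g1) : D.nomizuM X Y =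
      (1 / 2 : ℝ) • D.projM ⁅(X : GroupLieAlgebra (𝓡 d) G), (Y : GroupLieAlgebra (𝓡 d) G)⁆ := by
  refine Subtype.ext ?_
  rw [coe_nomizuM, D.nomizu_g1_g1 hX hY, Submodule.coe_smul, projM_eq,
    D.projG1_of_g0 (D.lie_g1_g1 _ hX _ hY), add_zero]

theorem nomizuM_g1_sp1 {X Y : D.m} (hX : (X : GroupLieAlgebra (𝓡 d) G) ∈ D.g1)
    (hY : (Y : GroupLieAlgebra (𝓡 d) G) ∈ D.sp1) : D.nomizuM X Y =
      D.projM ⁅(X : GroupLieAlgebra (𝓡 d) G), (Y : GroupLieAlgebra (𝓡 d) G)⁆ := by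
  refine Subtype.ext ?_
  have h := D.lie_g1_sp1 hX hY
  rw [coe_nomizuM, D.nomizu_g1_sp1 hX hY, projM_eq, D.projSp1_of_g1 h, D.projG1_of_g1 h, zero_add]

end ThreeSasakianData

/-! ### The Sasakian structures -/

namespace ThreeSasakianData

variable {d k : ℕ} {G : Type*} [TopologicalSpace G] [ChartedSpace (EuclideanSpace ℝ (Fin d)) G]
  [Group G] [LieGroup (𝓡 d) ∞ G] {H : Subgroup G}
  [ChartedSpace (EuclideanSpace ℝ (Fin k)) (G ⧸ H)] [IsManifold (𝓡 k) ∞ (G ⧸ H)]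
  {𝔥 : LieSubalgebra ℝ (GroupLieAlgebra (𝓡 d) G)}
  {W : Type*} [AddCommGroup W] [Module ℂ W] [LieRingModule (ℂ ⊗[ℝ] 𝔥) W]
  [LieModule ℂ (ℂ ⊗[ℝ] 𝔥) W]
  (D : ThreeSasakianData (GroupLieAlgebra (𝓡 d) G) 𝔥 W)
  (hsub : Manifold.IsSubmersion (𝓡 d) (𝓡 k) ∞ (fun x : G => (x : G ⧸ H)))
  (h𝔥 : IsLieAlgebraOfSubgroup H (𝔥 : Set (GroupLieAlgebra (𝓡 d) G)))

variable {n : ℕ} {B : LinearMap.BilinForm ℝ D.m} (hB : D.IsMetricForm n B)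
  {g : SmoothMetric (𝓡 k) (G ⧸ H)} (hg : IsCorrespondingMetric B g)

include hsub h𝔥 hB hg

theorem cov_invariantField_translMap {cov : AffineConnection (𝓡 k) (G ⧸ H)}
    (hcov : IsLeviCivita g cov) {V : G ⧸ H → EuclideanSpace ℝ (Fin k)}
    (hV : IsInvariantField (k := k) V) (a : G) (p : G ⧸ H) (v : EuclideanSpace ℝ (Fin k)) :
    (cov V (a • p) (translMap a p v) : EuclideanSpace ℝ (Fin k)) = translMap a p (cov V p v) :=
  D.isInvariantConnection hsub h𝔥 hB hg hcov a V V (isSmoothField_of_invariant hsub hV)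
    (isSmoothField_of_invariant hsub hV) (hV a) p v

theorem inner_invariantField (hn : Module.finrank ℝ D.g1 = 4 * n) {τ τ' : Fin 3 → ℝ}
    {V V' : G ⧸ H → EuclideanSpace ℝ (Fin k)} (hV : IsInvariantField (k := k) V)
    (hVo : V ((1 : G) : G ⧸ H) = projMap k H (D.xiComb τ)) (hV' : IsInvariantField (k := k) V')
    (hVo' : V' ((1 : G) : G ⧸ H) = projMap k H (D.xiComb τ')) (p : G ⧸ H) :
    g.inner p (V p) (V' p) = τ ⬝ᵥ τ' := by
  have : FiniteDimensional ℝ (GroupLieAlgebra (𝓡 d) G) :=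
    inferInstanceAs (FiniteDimensional ℝ (EuclideanSpace ℝ (Fin d)))
  rw [hV.eq_translProj hVo (out_smul_base p), hV'.eq_translProj hVo' (out_smul_base p),
    ← D.metricForm_xiComb hn]
  exact D.inner_translProj hsub h𝔥 hB hg (out_smul_base p) _ _

variable {cov : AffineConnection (𝓡 k) (G ⧸ H)} (hcov : IsLeviCivita g cov)
  {τ : Fin 3 → ℝ} {V : G ⧸ H → EuclideanSpace ℝ (Fin k)} (hV : IsInvariantField (k := k) V)

include hcov hV

theorem contMDiff_cov_invariantField : ContMDiff (𝓡 k)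
    ((𝓡 k).prod 𝓘(ℝ, EuclideanSpace ℝ (Fin k) →L[ℝ] EuclideanSpace ℝ (Fin k))) ∞
    (fun p => TotalSpace.mk' (EuclideanSpace ℝ (Fin k) →L[ℝ] EuclideanSpace ℝ (Fin k))
      (E := fun p : G ⧸ H => TangentSpace (𝓡 k) p →L[ℝ] TangentSpace (𝓡 k) p) p (-cov V p)) := by
  let φ : G ⧸ H → EuclideanSpace ℝ (Fin k) →L[ℝ] EuclideanSpace ℝ (Fin k) := fun p => -cov V p
  refine contMDiff_endomorphism_of_invariant hsub (φ := φ) fun a p v => ?_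
  have h := D.cov_invariantField_translMap hsub h𝔥 hB hg hcov hV a p v
  exact (congrArg Neg.neg h).trans (map_neg (translMap a p) _).symm

variable (hVo : V ((1 : G) : G ⧸ H) = projMap k H (D.xiComb τ))

include hVo

/-- The covariant derivative of the invariant vector field given by an element of `sp(1)`. -/
theorem cov_invariantField {a : G} {p : G ⧸ H} (ha : a • ((1 : G) : G ⧸ H) = p)
    {X : GroupLieAlgebra (𝓡 d) G} (hX : X ∈ D.m) :
    cov V p (translProj (d := d) k H a X : EuclideanSpace ℝ (Fin k)) =
      translProj k H a (D.nomizu X (D.xiComb τ)) := by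
  have h := D.leviCivita_apply hsub h𝔥 hB hg hcov
    ((isSmoothField_of_invariant hsub hV).mdifferentiableAt (by simp)) ha hX
    (D.sp1_le_m (D.xiComb_mem τ)) (hV.eq_translProj hVo ha)
  refine Eq.trans (α := EuclideanSpace ℝ (Fin k)) h ?_
  have h0 : lieFundamental hsub V p (Ad a X) = 0 :=
    mlieBracket_fundamentalField_invariant hsub (Ad a X) hV p
  rw [h0, zero_add]

/-- The covariant derivative of the invariant field given by an element of `sp(1)` is skew-symmetric,
which means that the field is a Killing field. -/
theorem inner_cov_invariantField_skew (p : G ⧸ H) (u v : TangentSpace (𝓡 k) p) :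
    g.inner p (cov V p u) v + g.inner p u (cov V p v) = 0 := by
  let b : EuclideanSpace ℝ (Fin k) →L[ℝ] EuclideanSpace ℝ (Fin k) →L[ℝ] ℝ := g.inner p
  let A : EuclideanSpace ℝ (Fin k) →L[ℝ] EuclideanSpace ℝ (Fin k) := cov V p
  have key : ∀ u v, b (A u) v + b u (A v) = 0 := by
    intro u v
    obtain ⟨X, hX, rfl⟩ := D.exists_translProj_eq hsub h𝔥 (out_smul_base p) u
    obtain ⟨Y, hY, rfl⟩ := D.exists_translProj_eq hsub h𝔥 (out_smul_base p) v
    have hA : ∀ Z ∈ D.m, A (translProj k H p.out Z) =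
        translProj k H p.out (D.nomizu Z (D.xiComb τ)) := fun Z hZ =>
      D.cov_invariantField hsub h𝔥 hB hg hcov hV hVo (out_smul_base p) hZ
    have hb : ∀ Z Z' : GroupLieAlgebra (𝓡 d) G, b (translProj k H p.out Z)
        (translProj k H p.out Z') = D.metricForm n Z Z' :=
      D.inner_translProj hsub h𝔥 hB hg (out_smul_base p)
    rw [hA X hX, hA Y hY, hb, hb]
    exact D.metricForm_nomizu_sp1_skew n X Y (D.xiComb_mem τ)
  exact key u v

theorem isKillingField_invariantField : IsKillingField (I := 𝓡 k) g V := by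
  have : IsManifold (𝓡 k) 2 (G ⧸ H) := .of_le (n := ∞) (by norm_cast)
  intro Y Z hY hZ p
  have hVd := (isSmoothField_of_invariant hsub hV).mdifferentiableAt (x := p) (by simp)
  have hYd := hY.mdifferentiableAt (x := p) (by simp)
  have hZd := hZ.mdifferentiableAt (x := p) (by simp)
  have h1 := (CovariantDerivative.torsion_eq_zero_iff cov).1 hcov.2 hVd hYd
  have h2 := (CovariantDerivative.torsion_eq_zero_iff cov).1 hcov.2 hVd hZd
  have h3 := hcov.1 p Y Z hYd hZd (V p)
  have h4 := D.inner_cov_invariantField_skew hsub h𝔥 hB hg hcov hV hVo p (Y p) (Z p)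
  rw [← h1, ← h2, h3, map_sub, map_sub, sub_apply]
  linear_combination h4

/-- The Sasakian identity `(∇_X φ)(Y) = g(X, Y) ξ - η(Y) X`: since `φ` is invariant, it commutes
with Lie derivatives along fundamental fields, and the identity reduces to an algebraic one at the
base point. -/
theorem cov_phi (hn : Module.finrank ℝ D.g1 = 4 * n) {Y : G ⧸ H → EuclideanSpace ℝ (Fin k)}
    (hY : IsSmoothField (I := 𝓡 k) Y) (p : G ⧸ H) (v : EuclideanSpace ℝ (Fin k)) :
    let φ : G ⧸ H → EuclideanSpace ℝ (Fin k) →L[ℝ] EuclideanSpace ℝ (Fin k) := fun q => -cov V q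
    let b : EuclideanSpace ℝ (Fin k) →L[ℝ] EuclideanSpace ℝ (Fin k) →L[ℝ] ℝ := g.inner p
    (cov (fun q => φ q (Y q)) p v : EuclideanSpace ℝ (Fin k)) =
      φ p (cov Y p v) + (b v (Y p) • V p - b (V p) (Y p) • v) := by
  intro φ b
  have : FiniteDimensional ℝ (GroupLieAlgebra (𝓡 d) G) :=
    inferInstanceAs (FiniteDimensional ℝ (EuclideanSpace ℝ (Fin d)))
  have : IsManifold (𝓡 k) 1 (G ⧸ H) := .of_le (n := ∞) (by norm_cast)
  have hφ : ∀ (a : G) (p : G ⧸ H) (v : EuclideanSpace ℝ (Fin k)),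
      φ (a • p) (translMap a p v) = translMap a p (φ p v) := by
    intro a p v
    have h := D.cov_invariantField_translMap hsub h𝔥 hB hg hcov hV a p v
    exact (congrArg Neg.neg h).trans (map_neg (translMap a p) _).symm
  have hb : ∀ Z Z' : GroupLieAlgebra (𝓡 d) G, b (translProj k H p.out Z)
      (translProj k H p.out Z') = D.metricForm n Z Z' :=
    D.inner_translProj hsub h𝔥 hB hg (out_smul_base p)
  have hφX : ∀ Z ∈ D.m, φ p (translProj k H p.out Z) =
      translProj k H p.out (-D.nomizu Z (D.xiComb τ)) := by
    intro Z hZ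
    rw [map_neg]
    exact congrArg Neg.neg
      (D.cov_invariantField hsub h𝔥 hB hg hcov hV hVo (out_smul_base p) hZ)
  have hφY : IsSmoothField (I := 𝓡 k) (fun q : G ⧸ H => φ q (Y q)) :=
    (D.contMDiff_cov_invariantField hsub h𝔥 hB hg hcov hV).clm_bundle_apply hY
  obtain ⟨x, hx, rfl⟩ := D.exists_translProj_eq hsub h𝔥 (out_smul_base p) v
  obtain ⟨y, hy, hyY⟩ := D.exists_translProj_eq hsub h𝔥 (out_smul_base p) (Y p)
  have h1 := D.leviCivita_apply hsub h𝔥 hB hg hcov (hφY.mdifferentiableAt (by simp))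
    (out_smul_base p) hx (neg_mem (D.nomizu_mem y (D.xiComb τ))) (by rw [← hyY, hφX y hy])
  have h2 := D.leviCivita_apply hsub h𝔥 hB hg hcov (hY.mdifferentiableAt (by simp))
    (out_smul_base p) hx hy hyY.symm
  have h3 : lieFundamental hsub (fun q => φ q (Y q)) p (Ad p.out x) =
      φ p (lieFundamental hsub Y p (Ad p.out x)) :=
    mlieBracket_fundamentalField_endomorphism hsub (Ad p.out x) hφ p
      (hY.mdifferentiableAt (by simp)) (hφY.mdifferentiableAt (by simp))
  have h4 := congrArg (φ p) h2
  rw [map_add, hφX _ (D.nomizu_mem x y)] at h4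
  rw [h3] at h1
  have h5 := congrArg (translProj k H p.out) (D.nomizu_sasakian hn τ (Y := y) hx)
  rw [map_sub, map_sub, map_smul, map_smul, ← hV.eq_translProj hVo (out_smul_base p), ← hb, ← hb,
    hyY, ← hV.eq_translProj hVo (out_smul_base p)] at h5
  rw [← h5]
  refine Eq.trans (α := EuclideanSpace ℝ (Fin k)) h1 ?_
  rw [h4]
  abel

/-- The invariant vector field given by a unit vector of `sp(1)` defines a Sasakian structure. -/
theorem isSasakianStructure (hn : Module.finrank ℝ D.g1 = 4 * n) (hτ : τ ⬝ᵥ τ = 1) :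
    IsSasakianStructure (I := 𝓡 k) g cov V (fun p => g.inner p (V p)) (fun p => -cov V p) where
  leviCivita := hcov
  smooth_ξ := isSmoothField_of_invariant hsub hV
  smooth_η := g.contMDiff.clm_bundle_apply (isSmoothField_of_invariant hsub hV)
  smooth_φ := D.contMDiff_cov_invariantField hsub h𝔥 hB hg hcov hV
  unit p := (D.inner_invariantField hsub h𝔥 hB hg hn hV hVo hV hVo p).trans hτ
  killing := D.isKillingField_invariantField hsub h𝔥 hB hg hcov hV hVo
  η_eq _ _ := g.symm _ _ _
  φ_eq _ _ := rfl
  cov_φ X _ _ hY p := sub_eq_of_eq_add' (D.cov_phi hsub h𝔥 hB hg hcov hV hVo hn hY p (X p))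

/-- The bracket of invariant fields given by elements of `sp(1)`, computed as `∇_V V' - ∇_{V'} V`. -/
theorem mlieBracket_invariantField {τ' : Fin 3 → ℝ} {V' V'' : G ⧸ H → EuclideanSpace ℝ (Fin k)}
    (hV' : IsInvariantField (k := k) V')
    (hVo' : V' ((1 : G) : G ⧸ H) = projMap k H (D.xiComb τ'))
    (hV'' : IsInvariantField (k := k) V'')
    (hVo'' : V'' ((1 : G) : G ⧸ H) = projMap k H (D.xiComb (τ ⨯₃ τ'))) (p : G ⧸ H) :
    (mlieBracket (𝓡 k) V V' p : EuclideanSpace ℝ (Fin k)) = (2 : ℝ) • V'' p := by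
  have : IsManifold (𝓡 k) 2 (G ⧸ H) := .of_le (n := ∞) (by norm_cast)
  have h := (CovariantDerivative.torsion_eq_zero_iff cov).1 hcov.2
    ((isSmoothField_of_invariant hsub hV).mdifferentiableAt (x := p) (by simp))
    ((isSmoothField_of_invariant hsub hV').mdifferentiableAt (x := p) (by simp))
  have h1 := D.cov_invariantField hsub h𝔥 hB hg hcov hV' hVo' (out_smul_base p)
    (D.sp1_le_m (D.xiComb_mem τ))
  have h2 := D.cov_invariantField hsub h𝔥 hB hg hcov hV hVo (out_smul_base p)
    (D.sp1_le_m (D.xiComb_mem τ'))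
  rw [← hV.eq_translProj hVo (out_smul_base p)] at h1
  rw [← hV'.eq_translProj hVo' (out_smul_base p)] at h2
  refine Eq.trans (α := EuclideanSpace ℝ (Fin k)) h.symm ?_
  refine (congrArg₂ (fun u w : EuclideanSpace ℝ (Fin k) => u - w) h1 h2).trans ?_
  rw [hV''.eq_translProj hVo'' (out_smul_base p), ← map_sub, ← map_smul]
  congr 1
  rw [D.nomizu_sp1_sp1 (D.xiComb_mem τ) (D.xiComb_mem τ'),
    D.nomizu_sp1_sp1 (D.xiComb_mem τ') (D.xiComb_mem τ), ← lie_skew (D.xiComb τ'), xiComb_lie]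
  module

end ThreeSasakianData

/-! ### Homogeneous 3-Sasakian manifolds -/

theorem theorem4p2 {d k : ℕ}
    -- a Lie group `G` and a closed connected subgroup `H`
    {G : Type*} [TopologicalSpace G] [T2Space G] [SecondCountableTopology G]
    [ChartedSpace (EuclideanSpace ℝ (Fin d)) G] [Group G] [LieGroup (𝓡 d) ∞ G]
    (H : Subgroup G) (hclosed : IsClosed (H : Set G)) (hconn : IsConnected (H : Set G))
    -- the homogeneous manifold `M = G/H`: the quotient topology, with the smooth structure
    -- for which the projection `G → G/H` is a submersion
    [ChartedSpace (EuclideanSpace ℝ (Fin k)) (G ⧸ H)] [IsManifold (𝓡 k) ∞ (G ⧸ H)]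
    (hsub : Manifold.IsSubmersion (𝓡 d) (𝓡 k) ∞ (fun x : G => (x : G ⧸ H)))
    -- the Lie algebra of `H`, and the 3-Sasakian data
    (𝔥 : LieSubalgebra ℝ (GroupLieAlgebra (𝓡 d) G)) (h𝔥 : IsLieAlgebraOfSubgroup H (𝔥 : Set (GroupLieAlgebra (𝓡 d) G)))
    {W : Type*} [AddCommGroup W] [Module ℂ W] [LieRingModule (ℂ ⊗[ℝ] 𝔥) W]
    [LieModule ℂ (ℂ ⊗[ℝ] 𝔥) W]
    (D : ThreeSasakianData (GroupLieAlgebra (𝓡 d) G) 𝔥 W) :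
    -- `M` has dimension `4n + 3`
    ∃ n : ℕ, k = 4 * n + 3 ∧ Module.finrank ℂ W = 2 * n ∧
    -- the reductive decomposition
    IsReductiveDecomposition H 𝔥.toSubmodule D.m ∧
    -- the inner product on `𝔪` ...
    (∃! B : LinearMap.BilinForm ℝ D.m, D.IsMetricForm n B) ∧
    ∀ B : LinearMap.BilinForm ℝ D.m, D.IsMetricForm n B →
    (∀ X Y, B X Y = B Y X) ∧ (∀ X, X ≠ 0 → 0 < B X X) ∧
    (∀ a ∈ H, ∀ X Y X' Y' : D.m, (X' : GroupLieAlgebra (𝓡 d) G) = Ad a X →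
      (Y' : GroupLieAlgebra (𝓡 d) G) = Ad a Y → B X' Y' = B X Y) ∧
    -- ... the corresponding invariant metric, and its Levi-Civita connection
    (∃! g : SmoothMetric (𝓡 k) (G ⧸ H), IsCorrespondingMetric B g) ∧
    ∀ g : SmoothMetric (𝓡 k) (G ⧸ H), IsCorrespondingMetric B g →
    (∃ cov : AffineConnection (𝓡 k) (G ⧸ H), IsLeviCivita g cov) ∧
    ∀ cov : AffineConnection (𝓡 k) (G ⧸ H), IsLeviCivita g cov →
    IsInvariantConnection cov ∧
    -- the multiplication on `𝔪` corresponding to it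
    (∃! α : D.m →ₗ[ℝ] D.m →ₗ[ℝ] D.m, IsNomizuMap cov α) ∧
    (∀ α : D.m →ₗ[ℝ] D.m →ₗ[ℝ] D.m, IsNomizuMap cov α → ∀ X Y : D.m,
      ((X : GroupLieAlgebra (𝓡 d) G) ∈ D.sp1 → (Y : GroupLieAlgebra (𝓡 d) G) ∈ D.g1 →
        α X Y = 0) ∧
      (((X : GroupLieAlgebra (𝓡 d) G) ∈ D.sp1 ∧ (Y : GroupLieAlgebra (𝓡 d) G) ∈ D.sp1) ∨
          ((X : GroupLieAlgebra (𝓡 d) G) ∈ D.g1 ∧ (Y : GroupLieAlgebra (𝓡 d) G) ∈ D.g1) →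
        α X Y = (1 / 2 : ℝ) • D.projM ⁅(X : GroupLieAlgebra (𝓡 d) G), (Y : GroupLieAlgebra (𝓡 d) G)⁆) ∧
      ((X : GroupLieAlgebra (𝓡 d) G) ∈ D.g1 → (Y : GroupLieAlgebra (𝓡 d) G) ∈ D.sp1 →
        α X Y = D.projM ⁅(X : GroupLieAlgebra (𝓡 d) G), (Y : GroupLieAlgebra (𝓡 d) G)⁆)) ∧
    -- the invariant vector fields given by the standard basis of `sp(1)`
    (∃! ξ : Fin 3 → Π p : G ⧸ H, TangentSpace (𝓡 k) p, ∀ i,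
      IsInvariantField (ξ i) ∧ ξ i ((1 : G) : G ⧸ H) = projDeriv k H (D.xi i)) ∧
    ∀ ξ : Fin 3 → Π p : G ⧸ H, TangentSpace (𝓡 k) p,
    (∀ i, IsInvariantField (ξ i) ∧ ξ i ((1 : G) : G ⧸ H) = projDeriv k H (D.xi i)) →
    -- the endomorphism field `φ_i = -∇ ξ_i` at the base point
    (∀ i, ∀ X ∈ D.sp1, -cov (ξ i) ((1 : G) : G ⧸ H) (projDeriv k H X) =
      projDeriv k H ((1 / 2 : ℝ) • ⁅D.xi i, X⁆)) ∧
    (∀ i, ∀ X ∈ D.g1, -cov (ξ i) ((1 : G) : G ⧸ H) (projDeriv k H X) =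
      projDeriv k H ⁅D.xi i, X⁆) ∧
    -- each `{ξ_i, η_i, φ_i}` is a Sasakian structure
    (∀ i, IsSasakianStructure g cov (ξ i) (fun p => g.inner p (ξ i p)) (fun p => -cov (ξ i) p)) ∧
    -- together they provide a 3-Sasakian structure
    IsThreeSasakianStructure g cov (fun τ => ∑ i, τ i • ξ i)
      (fun τ p => g.inner p (∑ i, τ i • ξ i p)) (fun τ p => -∑ i, τ i • cov (ξ i) p) := by
  classical
  have : FiniteDimensional ℝ (GroupLieAlgebra (𝓡 d) G) :=
    inferInstanceAs (FiniteDimensional ℝ (EuclideanSpace ℝ (Fin d)))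
  obtain ⟨n, hn⟩ := D.four_dvd_finrank_g1
  have hk : k = 4 * n + 3 := by
    rw [← D.finrank_m_eq hsub h𝔥, D.finrank_m, hn, add_comm]
  have hW : Module.finrank ℂ W = 2 * n := by
    have := D.two_mul_finrank_W
    omega
  refine ⟨n, hk, hW, D.isReductiveDecomposition hsub h𝔥 hconn, D.existsUnique_isMetricForm n,
    fun B hB => ?_⟩
  have hBf := (D.isMetricForm_iff n B).1 hB
  refine ⟨fun X Y => by rw [hBf, hBf, D.metricForm_symm], fun X hX => ?_,
    fun a ha X Y X' Y' hX' hY' => ?_, D.existsUnique_isCorrespondingMetric hsub h𝔥 hconn hB,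
    fun g hg => ⟨D.exists_isLeviCivita hsub h𝔥 hB hg, fun cov hcov => ?_⟩⟩
  · rw [hBf]
    exact D.metricForm_pos n X.2 fun h => hX (Subtype.ext h)
  · rw [hBf, hBf, hX', hY', D.metricForm_Ad hsub h𝔥 hconn n ha]
  have hα := D.isNomizuMap_iff hsub h𝔥 hB hg hcov
  refine ⟨D.isInvariantConnection hsub h𝔥 hB hg hcov,
    ⟨D.nomizuM, (hα _).2 rfl, fun α h => (hα α).1 h⟩, ?_, ?_, fun ξ hξ => ?_⟩
  · rintro α h X Y
    rw [(hα α).1 h]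
    refine ⟨D.nomizuM_sp1_g1, ?_, D.nomizuM_g1_sp1⟩
    rintro (⟨hX, hY⟩ | ⟨hX, hY⟩)
    · exact D.nomizuM_sp1_sp1 hX hY
    · exact D.nomizuM_g1_g1 hX hY
  · have h : ∀ i, ∃! V : Π p : G ⧸ H, TangentSpace (𝓡 k) p,
        IsInvariantField V ∧ V ((1 : G) : G ⧸ H) = projDeriv k H (D.xi i) := by
      intro i
      refine existsUnique_isInvariantField hsub fun a ha => D.Ad_sp1 hsub h𝔥 hconn ha ?_
      rw [← D.xiComb_single]
      exact D.xiComb_mem _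
    choose ξ hξ hξ' using h
    exact ⟨ξ, hξ, fun ξ' h => funext fun i => hξ' i _ (h i)⟩
  -- the invariant fields `ξ_τ`, with values in the model space
  let ξ' : Fin 3 → G ⧸ H → EuclideanSpace ℝ (Fin k) := ξ
  let V : (Fin 3 → ℝ) → G ⧸ H → EuclideanSpace ℝ (Fin k) := fun τ p => ∑ i, τ i • ξ' i p
  have hξ' : ∀ i (a : G) (p : G ⧸ H), ξ' i (a • p) = translMap a p (ξ' i p) := fun i => (hξ i).1
  have hξo : ∀ i, ξ' i ((1 : G) : G ⧸ H) = projMap (G := G) k H (D.xi i) := fun i => (hξ i).2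
  have hV : ∀ τ, IsInvariantField (k := k) (V τ) := by
    intro τ
    have h : ∀ (a : G) (p : G ⧸ H), V τ (a • p) = translMap a p (V τ p) := by
      intro a p
      simp only [V, map_sum, map_smul, hξ']
    exact h
  have hVo : ∀ τ, V τ ((1 : G) : G ⧸ H) = projMap (G := G) k H (D.xiComb τ) := by
    intro τ
    rw [← translProj_one, D.xiComb_apply, map_sum]
    simp only [V, hξo, map_smul, translProj_one]
  have hVs : ∀ i, V (Pi.single i 1) = ξ' i := by
    intro i
    funext p
    simp [V]
  have hVξ : ∀ τ, (∑ i, τ i • ξ i) = V τ := by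
    intro τ
    funext p
    rw [Finset.sum_apply]
    rfl
  have hξ₁ : ∀ i, IsInvariantField (k := k) (ξ' i) ∧
      ξ' i ((1 : G) : G ⧸ H) = projMap (G := G) k H (D.xiComb (Pi.single i 1)) := fun i => by
    rw [← hVs]; exact ⟨hV _, hVo _⟩
  have hcovV : ∀ τ p, (-∑ i, τ i • cov (ξ i) p : EuclideanSpace ℝ (Fin k) →L[ℝ]
      EuclideanSpace ℝ (Fin k)) = -cov (V τ) p := by
    intro τ p
    let C : Fin 3 → EuclideanSpace ℝ (Fin k) →L[ℝ] EuclideanSpace ℝ (Fin k) :=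
      fun i => cov (ξ' i) p
    let CV : EuclideanSpace ℝ (Fin k) →L[ℝ] EuclideanSpace ℝ (Fin k) := cov (V τ) p
    have h : -∑ i, τ i • C i = -CV := by
      congr 1
      ext1 v
      obtain ⟨X, hX, rfl⟩ := D.exists_translProj_eq hsub h𝔥 (out_smul_base p) v
      have h1 : CV (translProj k H p.out X) = _ :=
        D.cov_invariantField hsub h𝔥 hB hg hcov (hV τ) (hVo τ) (out_smul_base p) hX
      have h2 : ∀ i, C i (translProj k H p.out X) = translProj k H p.out (D.nomizu X (D.xi i)) := by
        intro i
        rw [← D.xiComb_single]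
        exact D.cov_invariantField hsub h𝔥 hB hg hcov (hξ₁ i).1 (hξ₁ i).2 (out_smul_base p) hX
      rw [h1, D.xiComb_apply, map_sum, map_sum, sum_apply]
      simp only [smul_apply, h2, map_smul]
    exact h
  have hcovo : ∀ i, ∀ X ∈ D.m, (-cov (ξ' i) ((1 : G) : G ⧸ H) : EuclideanSpace ℝ (Fin k) →L[ℝ]
      EuclideanSpace ℝ (Fin k)) (projMap (d := d) (G := G) k H X) =
        translProj k H (1 : G) (-D.nomizu X (D.xi i)) := by
    intro i X hX
    have h := D.cov_invariantField hsub h𝔥 hB hg hcov (hξ₁ i).1 (hξ₁ i).2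
      (one_smul G ((1 : G) : G ⧸ H)) hX
    rw [translProj_one, D.xiComb_single] at h
    exact (congrArg Neg.neg h).trans (map_neg (translProj k H (1 : G)) _).symm
  have hxi : ∀ i, D.xi i ∈ D.sp1 := fun i => by rw [← D.xiComb_single]; exact D.xiComb_mem _
  refine ⟨fun i X hX => ?_, fun i X hX => ?_, fun i => ?_, ?_, fun τ hτ => ?_,
    fun τ τ' _ _ p => ?_, fun τ τ' _ _ => ?_⟩
  · refine (hcovo i X (D.sp1_le_m hX)).trans ?_
    rw [D.nomizu_sp1_sp1 hX (hxi i), ← smul_neg, lie_skew]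
    exact translProj_one _
  · refine (hcovo i X (D.g1_le_m hX)).trans ?_
    rw [D.nomizu_g1_sp1 hX (hxi i), lie_skew]
    exact translProj_one _
  · exact D.isSasakianStructure hsub h𝔥 hB hg hcov (hξ₁ i).1 (hξ₁ i).2 hn (by simp)
  · constructor
    · intro τ τ'
      simp only [Pi.add_apply, add_smul, Finset.sum_add_distrib]
    · intro c τ
      simp only [Pi.smul_apply, smul_eq_mul, mul_smul, Finset.smul_sum]
  · have h := D.isSasakianStructure hsub h𝔥 hB hg hcov (hV τ) (hVo τ) hn hτ
    have e : (fun p => -∑ i, τ i • cov (ξ i) p) = fun p => -cov (V τ) p :=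
      funext fun p => hcovV τ p
    change IsSasakianStructure g cov (∑ i, τ i • ξ i) _ (fun p => -∑ i, τ i • cov (ξ i) p)
    rw [e, hVξ]
    exact h
  · rw [hVξ, hVξ]
    exact D.inner_invariantField hsub h𝔥 hB hg hn (hV τ) (hVo τ) (hV τ') (hVo τ') p
  · change mlieBracket (𝓡 k) (∑ i, τ i • ξ i) (∑ i, τ' i • ξ i) =
      (2 : ℝ) • ∑ i, (τ ⨯₃ τ') i • ξ i
    rw [hVξ, hVξ, hVξ]
    funext p
    exact D.mlieBracket_invariantField hsub h𝔥 hB hg hcov (hV τ) (hVo τ) (hV τ') (hVo τ')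
      (hV _) (hVo _) p
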